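/- Conventions. All manifolds are real, finite-dimensional and $C^\infty$. A Lie groupoid $\Gamma\rightrightarrows M$ has source, target, composition, unit and inversion maps $s,t,m,1,i$, all $C^\infty$, with $s,t$ submersions; $M$ is Hausdorff, second countable and of constant dimension, and $\Gamma$ is second countable (its components may have different dimensions). It is proper if $\Gamma$ is Hausdorff and $(s,t):\Gamma\to M\times M$ is a proper map. Its tangent groupoid $T\Gamma\rightrightarrows TM$ has structure maps $Ts,Tt,Tm,T1,Ti$; for $w_1,w_2\in T\Gamma$ with $Ts\,w_1=Ts\,w_2$ put $w_1\div w_2:=w_1w_2^{-1}$ (product and inverse in $T\Gamma$). Let $p\in\{0,1,2,\dots,\infty\}$. A connection $\Phi$ of class $C^p$ on $\Gamma$ is a $C^p$ family of linear maps $\eta^\Phi_g:T_{s(g)}M\to T_g\Gamma$ $(g\in\Gamma)$ with $T_gs\circ\eta^\Phi_g=\mathrm{id}$. Its effect is the family $\lambda^\Phi_g:=T_gt\circ\eta^\Phi_g:T_{s(g)}M\to T_{t(g)}M$. It is effective if $\lambda^\Phi_{1_x}=\mathrm{id}$ for all $x\in M$ and $\lambda^\Phi_{g'g}=\lambda^\Phi_{g'}\circ\lambda^\Phi_g$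 for all composable $g',g$; non-degenerate if all $\lambda^\Phi_g$ are invertible; multiplicative if $H=\bigcup_g\operatorname{im}\eta^\Phi_g\subset T\Gamma$ is a subgroupoid of $T\Gamma\rightrightarrows TM$ over the whole of $TM$. A left Haar system on $\Gamma$ is a family $\mu=\{\mu_x\}_{x\in M}$ of positive Radon measures $\mu_x$ on the target fibers $\Gamma_x=t^{-1}(x)$ such that the $\mu_x$ are the measures associated with a ($C^\infty$, positive) volume density along the target fibers and $\mu_{t(g)}(gB)=\mu_{s(g)}(B)$ for every $g\in\Gamma$ and every Borel set $B\subset\Gamma_{s(g)}$. A normalized left Haar system is a pair $\nu=(\mu,\kappa)$ where, in addition, $\kappa:M\to[0,\infty)$ is $C^\infty$, the intersection of $\operatorname{supp}(\kappa\circ s)$ with $t^{-1}(K)$ is compact for every compact $K\subset M$, and $\int_{\Gamma_x}\kappa\circ s\,d\mu_x=1$ for all $x\in M$; we write $\nu_x=(\kappa\circ s)\,\mu_x$. The multiplicative average, with respect to $\nu$, of a non-degenerate connection $\Phi$ is given by the linear maps $$\hat\eta^{\Phi}_g:T_{s(g)}M\to T_g\Gamma,\qquad \hat\eta^{\Phi}_g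 v=\int_{t(k)=s(g)}\Bigl(\eta^\Phi_{gk}(\lambda^\Phi_k)^{-1}v\Bigr)\div\Bigl(\eta^\Phi_k(\lambda^\Phi_k)^{-1}v\Bigr)\,d\nu_{s(g)}(k).$$ Proposition. Let $\Gamma\rightrightarrows M$ be a proper Lie groupoid and let $p\in\{0,1,2,\dots,\infty\}$. (1) Every effective connection $\Phi$ of class $C^p$ on $\Gamma$ is non-degenerate, and for every normalized left Haar system $\nu$ on $\Gamma$ the integrals above converge absolutely and the multiplicative average of $\Phi$ with respect to $\nu$ is the horizontal lift of a connection of class $C^p$ on $\Gamma$ which is multiplicative. (2) Consequently, $\Gamma$ admits an effective connection of class $C^p$ if and only if it admits a multiplicative connection of class $C^p$. -/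

import Mathlib

open Set Filter Topology MeasureTheory
open scoped Manifold ContDiff ENNReal

noncomputable section

universe u v

/-- The model space `ℝⁿ`.  For an `n`-dimensional manifold `A` modelled on `Eu n` and `a : A`, the
tangent space `TangentSpace (𝓡 n) a` is, as a type, `Eu n`; tangent vectors are written below as
elements of `Eu n`, with the meaning that Mathlib's `mfderiv` gives them. -/
abbrev Eu (n : ℕ) : Type := EuclideanSpace ℝ (Fin n)

/-- A manifold whose components may have different dimensions: the topological disjoint union of
its `n`-dimensional parts `A n` (each of which may be empty). -/
def MixedManifold (A : ℕ → Type u) : Type u := Σ n, A n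

namespace MixedManifold

variable {A : ℕ → Type u}

/-- The point `a` of the `n`-dimensional part, as a point of the whole manifold. -/
abbrev incl (n : ℕ) (a : A n) : MixedManifold A := Sigma.mk n a

/-- The dimension of the manifold at a point. -/
abbrev dim (x : MixedManifold A) : ℕ := Sigma.fst x

/-- A point, as a point of the part of the manifold that contains it. -/
abbrev pt (x : MixedManifold A) : A x.dim := Sigma.snd x

/-- The retraction of the manifold onto the part that contains `y`; it is the identity on that
part, and its (constant) value elsewhere plays no role. -/
def part (y x : MixedManifold A) : A y.dim := if h : x.dim = y.dim then h ▸ x.pt else y.pt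

instance [∀ n, TopologicalSpace (A n)] : TopologicalSpace (MixedManifold A) :=
  inferInstanceAs (TopologicalSpace (Σ n, A n))

instance [∀ n, TopologicalSpace (A n)] : MeasurableSpace (MixedManifold A) := borel _

instance [∀ n, TopologicalSpace (A n)] : BorelSpace (MixedManifold A) := ⟨rfl⟩

/-- Smoothness of a map `f`, defined on a subset `S` of a manifold `N` (an embedded submanifold,
in the applications), with values in a manifold of varying dimension: around every point of `S`,
the restriction of `f` to `S` extends to a `C^∞` map from an open subset of `N` to one of the
parts. -/
def SmoothInto [∀ n, TopologicalSpace (A n)] [∀ n, ChartedSpace (Eu n) (A n)]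
    {E : Type*} [NormedAddCommGroup E] [NormedSpace ℝ E] {H : Type*} [TopologicalSpace H]
    (I : ModelWithCorners ℝ E H) {N : Type*} [TopologicalSpace N] [ChartedSpace H N]
    (f : N → MixedManifold A) (S : Set N) : Prop :=
  ∀ p ∈ S, ∃ (n : ℕ) (F : N → A n) (U : Set N), IsOpen U ∧ p ∈ U ∧
    ContMDiffOn I (𝓡 n) ∞ F U ∧ ∀ q ∈ U ∩ S, f q = incl n (F q)

end MixedManifold

open MixedManifold

/-- A differentiable groupoid `Γ ⇉ M`.  The base `M` is a `d`-dimensional manifold; the arrow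
manifold, whose components may have different dimensions, is `Γ = MixedManifold A`.  The product `mul g' g` (first `g`, then `g'`) is meaningful,
and constrained, only when `src g' = tgt g`. -/
structure DiffGroupoid (d : ℕ) (M : Type v) [TopologicalSpace M] [ChartedSpace (Eu d) M]
    [IsManifold (𝓡 d) ∞ M] (A : ℕ → Type u) [∀ n, TopologicalSpace (A n)]
    [∀ n, ChartedSpace (Eu n) (A n)] [∀ n, IsManifold (𝓡 n) ∞ (A n)] where
  src : MixedManifold A → M
  tgt : MixedManifold A → M
  one : M → MixedManifold A
  inv : MixedManifold A → MixedManifold A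
  mul : MixedManifold A → MixedManifold A → MixedManifold A
  src_one : ∀ x, src (one x) = x
  tgt_one : ∀ x, tgt (one x) = x
  src_inv : ∀ g, src (inv g) = tgt g
  tgt_inv : ∀ g, tgt (inv g) = src g
  src_mul : ∀ g' g, src g' = tgt g → src (mul g' g) = src g
  tgt_mul : ∀ g' g, src g' = tgt g → tgt (mul g' g) = tgt g'
  mul_assoc : ∀ g'' g' g, src g'' = tgt g' → src g' = tgt g →
    mul (mul g'' g') g = mul g'' (mul g' g)
  one_mul : ∀ g, mul (one (tgt g)) g = g
  mul_one : ∀ g, mul g (one (src g)) = g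
  inv_mul : ∀ g, mul (inv g) g = one (src g)
  mul_inv : ∀ g, mul g (inv g) = one (tgt g)
  smooth_src : ∀ n, ContMDiff (𝓡 n) (𝓡 d) ∞ fun a : A n => src (incl n a)
  smooth_tgt : ∀ n, ContMDiff (𝓡 n) (𝓡 d) ∞ fun a : A n => tgt (incl n a)
  submersion_src : ∀ n (a : A n), Manifold.IsSubmersionAt (𝓡 n) (𝓡 d) ∞
    (fun a : A n => src (incl n a)) a
  submersion_tgt : ∀ n (a : A n), Manifold.IsSubmersionAt (𝓡 n) (𝓡 d) ∞
    (fun a : A n => tgt (incl n a)) a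
  smooth_one : SmoothInto (𝓡 d) one univ
  smooth_inv : ∀ n, SmoothInto (𝓡 n) (fun a : A n => inv (incl n a)) univ
  smooth_mul : ∀ n' n, SmoothInto ((𝓡 n').prod (𝓡 n))
    (fun q : A n' × A n => mul (incl n' q.1) (incl n q.2))
    {q | src (incl n' q.1) = tgt (incl n q.2)}

namespace DiffGroupoid

variable {d : ℕ} {M : Type v} [TopologicalSpace M] [ChartedSpace (Eu d) M]
  [IsManifold (𝓡 d) ∞ M] {A : ℕ → Type u} [∀ n, TopologicalSpace (A n)]
  [∀ n, ChartedSpace (Eu n) (A n)] [∀ n, IsManifold (𝓡 n) ∞ (A n)]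
  (Γ : DiffGroupoid d M A)

/-- A differentiable groupoid is proper if it is Hausdorff and its anchor `(s, t)` is proper. -/
def IsProper : Prop :=
  T2Space (MixedManifold A) ∧ T2Space M ∧ IsProperMap fun g => (Γ.src g, Γ.tgt g)

/-! ### The tangent groupoid `TΓ ⇉ TM` -/

/-- The tangent source map `T_g s : T_g Γ → T_{sg} M`. -/
def tsrc (g : MixedManifold A) : Eu g.dim →L[ℝ] Eu d :=
  mfderiv (𝓡 g.dim) (𝓡 d) (fun a : A g.dim => Γ.src (incl g.dim a)) g.pt

/-- The tangent target map `T_g t : T_g Γ → T_{tg} M`. -/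
def ttgt (g : MixedManifold A) : Eu g.dim →L[ℝ] Eu d :=
  mfderiv (𝓡 g.dim) (𝓡 d) (fun a : A g.dim => Γ.tgt (incl g.dim a)) g.pt

/-- The tangent unit map `T_x 1 : T_x M → T_{1x} Γ`. -/
def tone (x : M) : Eu d →L[ℝ] Eu (Γ.one x).dim :=
  mfderiv (𝓡 d) (𝓡 (Γ.one x).dim) (fun x' : M => part (Γ.one x) (Γ.one x')) x

/-- The tangent inversion `T_g i : T_g Γ → T_{g⁻¹} Γ`. -/
def tinv (g : MixedManifold A) : Eu g.dim →L[ℝ] Eu (Γ.inv g).dim :=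
  mfderiv (𝓡 g.dim) (𝓡 (Γ.inv g).dim)
    (fun a : A g.dim => part (Γ.inv g) (Γ.inv (incl g.dim a))) g.pt

/-- The tangent composition `T_{(g',g)} m`, for composable `g', g` with `y = g' g`: the derivative
of the composition along the manifold of composable pairs of arrows, evaluated on pairs
`(w', w)` with `Ts w' = Tt w`, which are the tangent vectors to that manifold.  (On these vectors
all derivatives of the composition within the set of composable pairs agree; on other vectors the
value plays no role.)  The target arrow `y` is an argument of its own so that products that are
equal as arrows have tangent vectors in the same space. -/
def tmul (g' g y : MixedManifold A) : Eu g'.dim × Eu g.dim →L[ℝ] Eu y.dim :=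
  mfderivWithin ((𝓡 g'.dim).prod (𝓡 g.dim)) (𝓡 y.dim)
    (fun q : A g'.dim × A g.dim => part y (Γ.mul (incl g'.dim q.1) (incl g.dim q.2)))
    {q | Γ.src (incl g'.dim q.1) = Γ.tgt (incl g.dim q.2)} (g'.pt, g.pt)

/-! ### Connections -/

/-- A connection of class `C^p` on `Γ`, given by its horizontal lift `η : s^*TM → TΓ`: a section of
class `C^p` of the bundle `L(s^*TM, TΓ)` over `Γ` that splits `s_* : TΓ → s^*TM`.  Being of class
`C^p` is expressed in the trivializations of `s^*TM` and `TΓ` by charts. -/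
structure Connection (p : ℕ∞) where
  lift : ∀ g : MixedManifold A, Eu d →L[ℝ] Eu g.dim
  tsrc_lift : ∀ g v, Γ.tsrc g (lift g v) = v
  contMDiff_lift : ∀ n (a₀ : A n), ContMDiffAt (𝓡 n) 𝓘(ℝ, Eu d →L[ℝ] Eu n) (p : ℕ∞ω)
    (inTangentCoordinates (𝓡 d) (𝓡 n) (fun a : A n => Γ.src (incl n a)) id
      (fun a => lift (incl n a)) a₀) a₀

namespace Connection

variable {Γ} {p : ℕ∞} (Φ : Γ.Connection p)

/-- The effect `λ_g = T_g t ∘ η_g : T_{sg} M → T_{tg} M` of a connection. -/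
def effect (g : MixedManifold A) : Eu d →L[ℝ] Eu d := (Γ.ttgt g).comp (Φ.lift g)

/-- A connection is effective if its effect is a representation of `Γ` on `TM`. -/
def IsEffective : Prop :=
  (∀ x, Φ.effect (Γ.one x) = ContinuousLinearMap.id ℝ (Eu d)) ∧
  ∀ g' g, Γ.src g' = Γ.tgt g → Φ.effect (Γ.mul g' g) = (Φ.effect g').comp (Φ.effect g)

/-- A connection is non-degenerate if its effect is invertible. -/
def IsNondegenerate : Prop := ∀ g, (Φ.effect g).IsInvertible

/-- The horizontal subspace `H_g = im η_g ⊆ T_g Γ`. -/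
def horizontal (g : MixedManifold A) : Set (Eu g.dim) := Set.range (Φ.lift g)

/-- A connection is multiplicative if its horizontal distribution `H ⊆ TΓ` is a subgroupoid, over
the whole of `TM`, of the tangent groupoid `TΓ ⇉ TM`. -/
structure IsMultiplicative : Prop where
  one_mem : ∀ x (v : Eu d), Γ.tone x v ∈ Φ.horizontal (Γ.one x)
  mul_mem : ∀ g' g, Γ.src g' = Γ.tgt g → ∀ w' ∈ Φ.horizontal g', ∀ w ∈ Φ.horizontal g,
    Γ.tsrc g' w' = Γ.ttgt g w → Γ.tmul g' g (Γ.mul g' g) (w', w) ∈ Φ.horizontal (Γ.mul g' g)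
  inv_mem : ∀ g, ∀ w ∈ Φ.horizontal g, Γ.tinv g w ∈ Φ.horizontal (Γ.inv g)

/-- The difference cocycle `δ(g, h) = (η_g ÷ η_h) ∘ λ_h⁻¹ : T_{th} M → T_{gh⁻¹} Γ` of a
non-degenerate connection, for arrows `g, h` with the same source.  Here `w₁ ÷ w₂ = w₁ w₂⁻¹` is the
quotient in the tangent groupoid, and `y = g h⁻¹`. -/
def diffCocycle (g h y : MixedManifold A) : Eu d →L[ℝ] Eu y.dim :=
  ((Γ.tmul g (Γ.inv h) y).comp
    ((Φ.lift g).prod ((Γ.tinv h).comp (Φ.lift h)))).comp (Φ.effect h).inverse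

end Connection

/-! ### Haar systems -/

/-- A local trivialization of the target map over the base: a diffeomorphism `(u, x) ↦ ψ (u, x)`
from an open subset of `ℝ^{n-d} × M` onto an open subset of the `n`-dimensional part of `Γ`, with
`t (ψ (u, x)) = x`.  For fixed `x` it parametrizes an open piece of the target fiber over `x`. -/
def IsTargetTrivialization (n : ℕ) (ψ : OpenPartialHomeomorph (Eu (n - d) × M) (A n)) : Prop :=
  ContMDiffOn ((𝓡 (n - d)).prod (𝓡 d)) (𝓡 n) ∞ ψ ψ.source ∧
  ContMDiffOn (𝓡 n) ((𝓡 (n - d)).prod (𝓡 d)) ∞ ψ.symm ψ.target ∧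
  ∀ q ∈ ψ.source, Γ.tgt (incl n (ψ q)) = q.2

/-- The coordinate vectors `∂ψ/∂u_i` at the point `ψ q` of the target fiber. -/
def coordFrame (n : ℕ) (ψ : OpenPartialHomeomorph (Eu (n - d) × M) (A n)) (q : Eu (n - d) × M)
    (i : Fin (n - d)) : Eu n :=
  mfderiv (𝓡 (n - d)) (𝓡 n) (fun u : Eu (n - d) => ψ (u, q.2)) q.1
    (EuclideanSpace.single i (1 : ℝ))

/-- A volume density along the target fibers: a smooth positive `1`-density `τ` on the bundle
`ker Tt`, whose rank at `g` is `dim_g Γ - d`.  It is evaluated on `(dim_g Γ - d)`-tuples of vertical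
vectors at `g`, with `τ (w₁, …, w_r) = |det a| τ (v₁, …, v_r)` whenever `w_i = ∑_j a_ij v_j`. -/
structure IsVolumeDensity (τ : ∀ g : MixedManifold A, (Fin (g.dim - d) → Eu g.dim) → ℝ) :
    Prop where
  homogeneous : ∀ g (v : Fin (g.dim - d) → Eu g.dim), (∀ i, Γ.ttgt g (v i) = 0) →
    ∀ a : Matrix (Fin (g.dim - d)) (Fin (g.dim - d)) ℝ,
      τ g (fun i => ∑ j, a i j • v j) = |a.det| * τ g v
  pos : ∀ g (v : Fin (g.dim - d) → Eu g.dim), (∀ i, Γ.ttgt g (v i) = 0) →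
    LinearIndependent ℝ v → 0 < τ g v
  smooth : ∀ n (ψ : OpenPartialHomeomorph (Eu (n - d) × M) (A n)), Γ.IsTargetTrivialization n ψ →
    ContMDiffOn ((𝓡 (n - d)).prod (𝓡 d)) 𝓘(ℝ, ℝ) ∞
      (fun q => τ (incl n (ψ q)) (coordFrame n ψ q)) ψ.source

/-- A left Haar system on `Γ`.  A measure on the target fiber `Γ_x = t⁻¹(x)`, a closed subset of
`Γ`, is regarded as a measure on `Γ` that is carried by `Γ_x`.  The measures `μ_x` come from a
volume density along the target fibers: in fiber coordinates `μ_x` is `τ(∂/∂u₁, …, ∂/∂u_r) du`.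
This makes each `μ_x` a Radon measure that is positive on non-empty open subsets of `Γ_x`. -/
structure IsLeftHaarSystem (μ : M → Measure (MixedManifold A)) : Prop where
  carried : ∀ x, μ x {g | Γ.tgt g ≠ x} = 0
  differentiable : ∃ τ, Γ.IsVolumeDensity τ ∧
    ∀ n (ψ : OpenPartialHomeomorph (Eu (n - d) × M) (A n)), Γ.IsTargetTrivialization n ψ →
      ∀ x (B : Set (MixedManifold A)), MeasurableSet B → B ⊆ incl n '' ψ.target →
        μ x B = ∫⁻ u in {u | (u, x) ∈ ψ.source ∧ incl n (ψ (u, x)) ∈ B},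
          ENNReal.ofReal (τ (incl n (ψ (u, x))) (coordFrame n ψ (u, x)))
  left_invariant : ∀ g (B : Set (MixedManifold A)), MeasurableSet B →
    (∀ h ∈ B, Γ.tgt h = Γ.src g) → μ (Γ.tgt g) (Γ.mul g '' B) = μ (Γ.src g) B

/-- A normalized left Haar system `(μ, κ)`: a left Haar system `μ` together with a normalizing
function `κ` for it, i.e. a smooth non-negative function on the base such that `κ ∘ s` is
`t`-properly supported and has integral one along every target fiber. -/
structure NormalizedHaarSystem where
  μ : M → Measure (MixedManifold A)
  isLeftHaarSystem : Γ.IsLeftHaarSystem μ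
  κ : M → ℝ
  smooth : ContMDiff (𝓡 d) 𝓘(ℝ, ℝ) ∞ κ
  nonneg : ∀ x, 0 ≤ κ x
  properly_supported : ∀ K : Set M, IsCompact K →
    IsCompact (tsupport (fun g => κ (Γ.src g)) ∩ Γ.tgt ⁻¹' K)
  integral_eq_one : ∀ x, ∫ g, κ (Γ.src g) ∂(μ x) = 1

variable {Γ}

/-- The measure `ν_x = (κ ∘ s) μ_x` on the target fiber over `x`. -/
def NormalizedHaarSystem.ν (H : Γ.NormalizedHaarSystem) (x : M) : Measure (MixedManifold A) :=
  (H.μ x).withDensity fun g => ENNReal.ofReal (H.κ (Γ.src g))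

/-- The multiplicative average of (the horizontal lift of) a non-degenerate connection: the linear
map `T_{sg} M → T_g Γ` given by `v ↦ ∫_{tk = sg} δ(gk, k) v dν_{sg}(k)`. -/
def Connection.average {p : ℕ∞} (Φ : Γ.Connection p) (H : Γ.NormalizedHaarSystem)
    (g : MixedManifold A) : Eu d →L[ℝ] Eu g.dim :=
  ∫ k, Φ.diffCocycle (Γ.mul g k) k g ∂(H.ν (Γ.src g))

end DiffGroupoid

end

/-! An effective connection is non-degenerate because a representation sends `inv g` to an inverse
of the operator of `g`. The averaged quantity is δ(gk, k) = (η_{gk} ÷ η_k) ∘ λ_k⁻¹. Its source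
component is the identity, and its target component is λ_{gk} λ_k⁻¹ = λ_g, independent of k. Since
each `ν x` is a probability measure, the average is again a splitting of Ts and has the same effect
as Φ. At a unit the integrand is constantly the tangent unit map (`quot_self`).

Products rest on the cocycle identity (w₁ ÷ w₂)(w₂ ÷ w₃) = w₁ ÷ w₃ (`tmul_quot`). Left invariance
moves the integral for g' at λ_g v from the fiber over t(g) to the fiber over s(g) by k ↦ gk. As
λ_{gk}⁻¹ λ_g = λ_k⁻¹, the two integrands become η_{g'gk} ÷ η_{gk} and η_{gk} ÷ η_k at one and the
same vector. Tangent composition is linear, so it passes under the integral and yields the integrand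
for g'g (`IsEffective.tmul_average`). Stability under inversion then follows from units and products
(`isMultiplicative_of_lift`).

Identities in the tangent groupoid are never computed by hand. A horizontal lift is the derivative
of a local section of the source map, so each such identity is the derivative of an identity between
arrows. `HasTDeriv` records derivatives of families of arrows, and `HasTDeriv.unique` compares two
ways of differentiating one family.

Regularity is local. In charts the cocycle is a sum of partial derivatives of a smooth extension of
the division map, applied to lifts, followed by the inverse of the effect
(`fiberSmooth_localDiffCocycle`); it is C^p jointly in g and in the fiber coordinates. Proper
support of κ ∘ s reduces the average to integrals over fixed compact sets, which may be
differentiated in the parameter (`IsFiberMeasure.integral_of_properlySupported`).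

For the equivalence, a multiplicative connection is effective because a horizontal vector is
determined by its source component. The other direction also needs a normalized Haar system.
Vertical vectors are translated to the units and measured there by Gram volumes weighted by a
partition of unity; this density gives the measures. Properness supplies an open set that meets
every orbit and is relatively compact modulo the groupoid; a function supported on it is divided by
its own orbit-invariant fiber integral. -/

set_option linter.unusedSectionVars false

noncomputable section

universe u v

open MixedManifold

/-! ### Manifolds of varying dimension -/

namespace MixedManifold

variable {A : ℕ → Type u}

theorem part_eq {y : MixedManifold A} {x : MixedManifold A} {a : A y.dim}
    (h : x = incl y.dim a) : part y x = a := by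
  subst h; simp [part]

variable [∀ n, TopologicalSpace (A n)]

theorem isOpenEmbedding_incl (n : ℕ) : IsOpenEmbedding (incl n : A n → MixedManifold A) :=
  Topology.IsOpenEmbedding.sigmaMk

theorem continuous_incl (n : ℕ) : Continuous (incl n : A n → MixedManifold A) :=
  (isOpenEmbedding_incl n).continuous

theorem continuous_of_incl {X : Type*} [TopologicalSpace X] {f : MixedManifold A → X}
    (h : ∀ n, Continuous fun a : A n => f (incl n a)) : Continuous f :=
  continuous_sigma h

theorem nhds_incl (n : ℕ) (a : A n) : 𝓝 (incl n a) = map (incl n) (𝓝 a) :=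
  ((isOpenEmbedding_incl n).map_nhds_eq a).symm

/-- The smooth representatives of a map into a mixed manifold can be chosen with values in the
part that contains a given value. -/
theorem SmoothInto.exists_rep [∀ n, ChartedSpace (Eu n) (A n)]
    {E : Type*} [NormedAddCommGroup E] [NormedSpace ℝ E] {H : Type*} [TopologicalSpace H]
    {I : ModelWithCorners ℝ E H} {N : Type*} [TopologicalSpace N] [ChartedSpace H N]
    {f : N → MixedManifold A} {S : Set N} (hf : SmoothInto I f S) {p : N} (hp : p ∈ S)
    {m : ℕ} {b : A m} (hb : f p = incl m b) :
    ∃ (F : N → A m) (U : Set N), IsOpen U ∧ p ∈ U ∧ ContMDiffOn I (𝓡 m) ∞ F U ∧ F p = b ∧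
      ∀ q ∈ U, q ∈ S → f q = incl m (F q) := by
  obtain ⟨n, F, U, hU, hpU, hF, h⟩ := hf p hp
  have h1 := h p ⟨hpU, hp⟩
  rw [hb] at h1
  obtain rfl : m = n := congrArg Sigma.fst h1
  exact ⟨F, U, hU, hpU, hF, (eq_of_heq (Sigma.mk.inj h1).2).symm, fun q hq hqS => h q ⟨hq, hqS⟩⟩

end MixedManifold

namespace DiffGroupoid

variable {d : ℕ} {M : Type v} [TopologicalSpace M] [ChartedSpace (Eu d) M]
  [IsManifold (𝓡 d) ∞ M] {A : ℕ → Type u} [∀ n, TopologicalSpace (A n)]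
  [∀ n, ChartedSpace (Eu n) (A n)] [∀ n, IsManifold (𝓡 n) ∞ (A n)]
  (Γ : DiffGroupoid d M A)

/-! ### Groupoid algebra -/

theorem inv_mul_cancel_left {g' g : MixedManifold A} (h : Γ.src g' = Γ.tgt g) :
    Γ.mul (Γ.inv g') (Γ.mul g' g) = g := by
  rw [← Γ.mul_assoc _ _ _ (Γ.src_inv g') h, Γ.inv_mul, h, Γ.one_mul]

theorem mul_inv_cancel_right {g' g : MixedManifold A} (h : Γ.src g' = Γ.tgt g) :
    Γ.mul (Γ.mul g' g) (Γ.inv g) = g' := by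
  rw [Γ.mul_assoc _ _ _ h (Γ.tgt_inv g).symm, Γ.mul_inv, ← h, Γ.mul_one]

theorem eq_inv_of_mul_eq_one {g' g : MixedManifold A} (h : Γ.src g' = Γ.tgt g)
    (e : Γ.mul g' g = Γ.one (Γ.src g)) : g' = Γ.inv g := by
  rw [← Γ.mul_inv_cancel_right h, e, ← Γ.tgt_inv, Γ.one_mul]

theorem inv_inv (g : MixedManifold A) : Γ.inv (Γ.inv g) = g :=
  (Γ.eq_inv_of_mul_eq_one (Γ.tgt_inv g).symm (by rw [Γ.mul_inv, Γ.src_inv])).symm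

theorem mul_inv_cancel_left {g' g : MixedManifold A} (h : Γ.tgt g' = Γ.tgt g) :
    Γ.mul g' (Γ.mul (Γ.inv g') g) = g := by
  have := Γ.inv_mul_cancel_left (g' := Γ.inv g') (g := g) (by rw [Γ.src_inv, h])
  rwa [Γ.inv_inv] at this

theorem mul_inv_mul_cancel {g h k : MixedManifold A} (h1 : Γ.src g = Γ.src h)
    (h2 : Γ.src h = Γ.src k) :
    Γ.mul (Γ.mul g (Γ.inv h)) (Γ.mul h (Γ.inv k)) = Γ.mul g (Γ.inv k) := by
  have e : Γ.src h = Γ.tgt (Γ.inv k) := by rw [Γ.tgt_inv, h2]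
  rw [Γ.mul_assoc _ _ _ (by rw [Γ.tgt_inv, h1]) (by rw [Γ.src_inv, Γ.tgt_mul _ _ e]),
    Γ.inv_mul_cancel_left e]

theorem inv_mul_rev {g' g : MixedManifold A} (h : Γ.src g' = Γ.tgt g) :
    Γ.inv (Γ.mul g' g) = Γ.mul (Γ.inv g) (Γ.inv g') := by
  have e : Γ.src (Γ.inv g) = Γ.tgt (Γ.inv g') := by rw [Γ.src_inv, Γ.tgt_inv, h]
  refine (Γ.eq_inv_of_mul_eq_one ?_ ?_).symm
  · rw [Γ.src_mul _ _ e, Γ.src_inv, Γ.tgt_mul _ _ h]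
  · rw [Γ.mul_assoc _ _ _ e (by rw [Γ.src_inv, Γ.tgt_mul _ _ h]), Γ.inv_mul_cancel_left h,
      Γ.inv_mul, Γ.src_mul _ _ h]

/-! ### Smoothness and continuity of the structure maps -/

theorem exists_mul_rep {n' n m : ℕ} {a' : A n'} {a : A n} {b : A m}
    (h : Γ.src (incl n' a') = Γ.tgt (incl n a))
    (e : Γ.mul (incl n' a') (incl n a) = incl m b) :
    ∃ (F : A n' × A n → A m) (U : Set (A n' × A n)), IsOpen U ∧ (a', a) ∈ U ∧
      ContMDiffOn ((𝓡 n').prod (𝓡 n)) (𝓡 m) ∞ F U ∧ F (a', a) = b ∧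
      ∀ q ∈ U, Γ.src (incl n' q.1) = Γ.tgt (incl n q.2) →
        Γ.mul (incl n' q.1) (incl n q.2) = incl m (F q) :=
  (Γ.smooth_mul n' n).exists_rep (p := (a', a)) h e

theorem exists_inv_rep {n m : ℕ} {a : A n} {b : A m} (e : Γ.inv (incl n a) = incl m b) :
    ∃ (F : A n → A m) (U : Set (A n)), IsOpen U ∧ a ∈ U ∧
      ContMDiffOn (𝓡 n) (𝓡 m) ∞ F U ∧ F a = b ∧ ∀ q ∈ U, Γ.inv (incl n q) = incl m (F q) := by
  obtain ⟨F, U, hU, h1, h2, h3, h4⟩ := (Γ.smooth_inv n).exists_rep (mem_univ a) e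
  exact ⟨F, U, hU, h1, h2, h3, fun q hq => h4 q hq trivial⟩

theorem exists_one_rep {m : ℕ} {x : M} {b : A m} (e : Γ.one x = incl m b) :
    ∃ (F : M → A m) (U : Set M), IsOpen U ∧ x ∈ U ∧
      ContMDiffOn (𝓡 d) (𝓡 m) ∞ F U ∧ F x = b ∧ ∀ q ∈ U, Γ.one q = incl m (F q) := by
  obtain ⟨F, U, hU, h1, h2, h3, h4⟩ := Γ.smooth_one.exists_rep (mem_univ x) e
  exact ⟨F, U, hU, h1, h2, h3, fun q hq => h4 q hq trivial⟩

theorem continuous_src : Continuous Γ.src :=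
  continuous_of_incl fun n => (Γ.smooth_src n).continuous

theorem continuous_tgt : Continuous Γ.tgt :=
  continuous_of_incl fun n => (Γ.smooth_tgt n).continuous

theorem continuous_one : Continuous Γ.one := by
  refine continuous_iff_continuousAt.2 fun x => ?_
  obtain ⟨F, U, hU, hx, hF, -, h⟩ := Γ.exists_one_rep (x := x) (b := (Γ.one x).pt) rfl
  refine ContinuousAt.congr ((continuous_incl _).continuousAt.comp
    ((hF.continuousOn).continuousAt (hU.mem_nhds hx))) ?_
  filter_upwards [hU.mem_nhds hx] with q hq using (h q hq).symm

theorem continuousOn_mul : ContinuousOn (fun q : MixedManifold A × MixedManifold A =>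
    Γ.mul q.1 q.2) {q | Γ.src q.1 = Γ.tgt q.2} := by
  rintro ⟨⟨n', a'⟩, ⟨n, a⟩⟩ hq
  obtain ⟨F, U, hU, hx, hF, -, h⟩ := Γ.exists_mul_rep (a' := a') (a := a)
    (b := (Γ.mul (incl n' a') (incl n a)).pt) hq rfl
  have ho : IsOpenEmbedding (Prod.map (incl n' : A n' → MixedManifold A)
      (incl n : A n → MixedManifold A)) :=
    (isOpenEmbedding_incl n').prodMap (isOpenEmbedding_incl n)
  have hn : 𝓝 ((incl n' a', incl n a) : MixedManifold A × MixedManifold A)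
      = map (Prod.map (incl n') (incl n)) (𝓝 (a', a)) := (ho.map_nhds_eq (a', a)).symm
  -- The representative `F` is defined on a full neighbourhood but equals the product only on
  -- composable pairs, so the limit is taken within that set.
  change Tendsto _ (𝓝 (incl n' a', incl n a) ⊓ 𝓟 _) _
  rw [tendsto_iff_forall_eventually_mem]
  intro s hs
  rw [eventually_inf_principal, hn, eventually_map]
  have hc := ((continuous_incl _).continuousAt.comp
    ((hF.continuousOn).continuousAt (hU.mem_nhds hx)))
  have h0 := h (a', a) hx hq
  have hs' : s ∈ 𝓝 (incl _ (F (a', a))) := by rw [← h0]; exact hs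
  filter_upwards [hU.mem_nhds hx, hc hs'] with q hq1 hq2 hq3
  change Γ.mul (incl n' q.1) (incl n q.2) ∈ s
  rw [h q hq1 hq3]; exact hq2

end DiffGroupoid

/-! ### Derivatives of families of arrows -/

section HasTDeriv

variable {A : ℕ → Type u} [∀ n, TopologicalSpace (A n)]
  [∀ n, ChartedSpace (Eu n) (A n)]
  {E : Type*} [NormedAddCommGroup E] [NormedSpace ℝ E] {H : Type*} [TopologicalSpace H]
  (I : ModelWithCorners ℝ E H) {N : Type*} [TopologicalSpace N] [ChartedSpace H N]

/-- The map `G` with values in a mixed manifold takes the value `y` at `x₀`, and has the derivative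
`L` there. -/
def HasTDeriv (G : N → MixedManifold A) (x₀ : N) (y : MixedManifold A) (L : E →L[ℝ] Eu y.dim) :
    Prop :=
  G x₀ = y ∧ ∃ f : N → A y.dim, (∀ᶠ x in 𝓝 x₀, G x = incl y.dim (f x)) ∧
    HasMFDerivAt I (𝓡 y.dim) f x₀ L

variable {I} {G : N → MixedManifold A} {x₀ : N} {y : MixedManifold A} {L : E →L[ℝ] Eu y.dim}

theorem HasTDeriv.exists_rep (h : HasTDeriv I G x₀ y L) :
    ∃ f : N → A y.dim, f x₀ = y.pt ∧ (∀ᶠ x in 𝓝 x₀, G x = incl y.dim (f x)) ∧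
      HasMFDerivAt I (𝓡 y.dim) f x₀ L := by
  obtain ⟨h0, f, h1, h2⟩ := h
  refine ⟨f, ?_, h1, h2⟩
  have := h1.self_of_nhds
  rw [h0] at this
  exact (eq_of_heq (Sigma.mk.inj this).2).symm

theorem HasTDeriv.part_hasMFDerivAt (h : HasTDeriv I G x₀ y L) :
    HasMFDerivAt I (𝓡 y.dim) (fun x => part y (G x)) x₀ L := by
  obtain ⟨f, h1, h2, h3⟩ := h.exists_rep
  refine h3.congr_of_eventuallyEq ?_
  filter_upwards [h2] with x hx using part_eq hx

/-- The source of every identity between tangent maps below: one family of arrows, differentiated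
along two different expressions, gives two equal linear maps. -/
theorem HasTDeriv.unique {L' : E →L[ℝ] Eu y.dim} (h : HasTDeriv I G x₀ y L)
    (h' : HasTDeriv I G x₀ y L') : L = L' :=
  hasMFDerivAt_unique h.part_hasMFDerivAt h'.part_hasMFDerivAt

theorem HasTDeriv.congr {G' : N → MixedManifold A} (h : HasTDeriv I G x₀ y L)
    (e : ∀ᶠ x in 𝓝 x₀, G' x = G x) : HasTDeriv I G' x₀ y L := by
  obtain ⟨h0, f, h1, h2⟩ := h
  refine ⟨e.self_of_nhds.trans h0, f, ?_, h2⟩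
  filter_upwards [h1, e] with x hx hx' using hx'.trans hx

theorem HasMFDerivAt.hasTDeriv {n : ℕ} {f : N → A n} {L : E →L[ℝ] Eu n}
    (h : HasMFDerivAt I (𝓡 n) f x₀ L) :
    HasTDeriv I (fun x => incl n (f x)) x₀ (incl n (f x₀)) L :=
  ⟨rfl, f, Eventually.of_forall fun _ => rfl, h⟩

theorem hasTDeriv_const (x₀ : N) (y : MixedManifold A) :
    HasTDeriv I (fun _ : N => y) x₀ y (0 : E →L[ℝ] Eu y.dim) :=
  ⟨rfl, fun _ => y.pt, Eventually.of_forall fun _ => rfl, hasMFDerivAt_const _ _⟩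

theorem HasTDeriv.comp {E' : Type*} [NormedAddCommGroup E'] [NormedSpace ℝ E'] {H' : Type*}
    [TopologicalSpace H'] {I' : ModelWithCorners ℝ E' H'} {N' : Type*} [TopologicalSpace N']
    [ChartedSpace H' N'] {h : N' → N} {z : N'} {T : E' →L[ℝ] E}
    (hG : HasTDeriv I G x₀ y L) (hh : HasMFDerivAt I' I h z T) (e : h z = x₀) :
    HasTDeriv I' (fun x => G (h x)) z y (L.comp T) := by
  subst e
  obtain ⟨h0, f, h1, h2⟩ := hG
  exact ⟨h0, fun x => f (h x), hh.continuousAt.eventually h1, h2.comp z hh⟩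

end HasTDeriv

/-! ### Chain rules for the structure maps -/

namespace DiffGroupoid

variable {d : ℕ} {M : Type v} [TopologicalSpace M] [ChartedSpace (Eu d) M]
  [IsManifold (𝓡 d) ∞ M] {A : ℕ → Type u} [∀ n, TopologicalSpace (A n)]
  [∀ n, ChartedSpace (Eu n) (A n)] [∀ n, IsManifold (𝓡 n) ∞ (A n)]
  (Γ : DiffGroupoid d M A)
  {E : Type*} [NormedAddCommGroup E] [NormedSpace ℝ E] {H : Type*} [TopologicalSpace H]
  {I : ModelWithCorners ℝ E H} {N : Type*} [TopologicalSpace N] [ChartedSpace H N]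
  {G G' : N → MixedManifold A} {x₀ : N} {y y' : MixedManifold A} {L : E →L[ℝ] Eu y.dim}
  {L' : E →L[ℝ] Eu y'.dim}

theorem hasMFDerivAt_src (n : ℕ) (a : A n) :
    HasMFDerivAt (𝓡 n) (𝓡 d) (fun a : A n => Γ.src (incl n a)) a (Γ.tsrc (incl n a)) :=
  ((Γ.smooth_src n a).mdifferentiableAt (by simp)).hasMFDerivAt

theorem hasMFDerivAt_tgt (n : ℕ) (a : A n) :
    HasMFDerivAt (𝓡 n) (𝓡 d) (fun a : A n => Γ.tgt (incl n a)) a (Γ.ttgt (incl n a)) :=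
  ((Γ.smooth_tgt n a).mdifferentiableAt (by simp)).hasMFDerivAt

theorem _root_.HasTDeriv.src (h : HasTDeriv I G x₀ y L) :
    HasMFDerivAt I (𝓡 d) (fun x => Γ.src (G x)) x₀ ((Γ.tsrc y).comp L) := by
  obtain ⟨f, h0, h1, h2⟩ := h.exists_rep
  have h3 := Γ.hasMFDerivAt_src y.dim (f x₀)
  rw [h0] at h3
  rw [← h0] at h3
  refine (h3.comp x₀ h2).congr_of_eventuallyEq ?_ |>.congr_mfderiv ?_
  · filter_upwards [h1] with x hx using congrArg Γ.src hx
  · rw [h0]; rfl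

theorem _root_.HasTDeriv.tgt (h : HasTDeriv I G x₀ y L) :
    HasMFDerivAt I (𝓡 d) (fun x => Γ.tgt (G x)) x₀ ((Γ.ttgt y).comp L) := by
  obtain ⟨f, h0, h1, h2⟩ := h.exists_rep
  have h3 := Γ.hasMFDerivAt_tgt y.dim (f x₀)
  refine (h3.comp x₀ h2).congr_of_eventuallyEq ?_ |>.congr_mfderiv ?_
  · filter_upwards [h1] with x hx using congrArg Γ.tgt hx
  · rw [h0]; rfl

theorem _root_.HasTDeriv.inv (h : HasTDeriv I G x₀ y L) :
    HasTDeriv I (fun x => Γ.inv (G x)) x₀ (Γ.inv y) ((Γ.tinv y).comp L) := by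
  obtain ⟨f, h0, h1, h2⟩ := h.exists_rep
  obtain ⟨F, U, hU, hx, hF, hF0, hF1⟩ := Γ.exists_inv_rep (a := y.pt) (b := (Γ.inv y).pt) rfl
  have h3 : HasMFDerivAt (𝓡 y.dim) (𝓡 _) F (f x₀) (Γ.tinv y) := by
    have : Γ.tinv y = mfderiv (𝓡 y.dim) (𝓡 _) F y.pt := by
      refine Filter.EventuallyEq.mfderiv_eq ?_
      filter_upwards [hU.mem_nhds hx] with a ha using part_eq (hF1 a ha)
    rw [this, h0]
    exact ((hF.contMDiffAt (hU.mem_nhds hx)).mdifferentiableAt (by simp)).hasMFDerivAt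
  refine ⟨congrArg Γ.inv h.1, fun x => F (f x), ?_, h3.comp x₀ h2⟩
  rw [← h0] at hx
  filter_upwards [h1, h2.continuousAt (hU.mem_nhds hx)] with x hx1 hx2
  rw [hx1]; exact hF1 _ hx2

theorem hasTDeriv_one {h : N → M} {T : E →L[ℝ] Eu d} {x : M} (hh : HasMFDerivAt I (𝓡 d) h x₀ T)
    (hx₀ : h x₀ = x) :
    HasTDeriv I (fun z => Γ.one (h z)) x₀ (Γ.one x) ((Γ.tone x).comp T) := by
  subst hx₀
  obtain ⟨F, U, hU, hx, hF, hF0, hF1⟩ := Γ.exists_one_rep (x := h x₀)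
    (b := (Γ.one (h x₀)).pt) rfl
  have h3 : HasMFDerivAt (𝓡 d) (𝓡 _) F (h x₀) (mfderiv (𝓡 d) (𝓡 _) F (h x₀)) :=
    ((hF.contMDiffAt (hU.mem_nhds hx)).mdifferentiableAt (by simp)).hasMFDerivAt
  have h4 : Γ.tone (h x₀) = mfderiv (𝓡 d) (𝓡 _) F (h x₀) := by
    refine Filter.EventuallyEq.mfderiv_eq ?_
    filter_upwards [hU.mem_nhds hx] with a ha using part_eq (hF1 a ha)
  refine ⟨rfl, fun x => F (h x), ?_, ?_⟩
  · filter_upwards [hh.continuousAt (hU.mem_nhds hx)] with x hx2 using hF1 _ hx2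
  · rw [h4]; exact h3.comp x₀ hh

/-- `tmul` is a derivative within the set of composable pairs. The chain rule still gives a full
derivative, because the family stays composable near `x₀`. -/
theorem _root_.HasTDeriv.mul (h' : HasTDeriv I G' x₀ y' L') (h : HasTDeriv I G x₀ y L)
    (e : ∀ᶠ x in 𝓝 x₀, Γ.src (G' x) = Γ.tgt (G x)) {z : MixedManifold A} (hz : Γ.mul y' y = z) :
    HasTDeriv I (fun x => Γ.mul (G' x) (G x)) x₀ z ((Γ.tmul y' y z).comp (L'.prod L)) := by
  obtain ⟨f', h0', h1', h2'⟩ := h'.exists_rep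
  obtain ⟨f, h0, h1, h2⟩ := h.exists_rep
  have e0 : Γ.src y' = Γ.tgt y := by
    have := e.self_of_nhds; rwa [h'.1, h.1] at this
  obtain ⟨F, U, hU, hx, hF, hF0, hF1⟩ :=
    Γ.exists_mul_rep (a' := y'.pt) (a := y.pt) (b := z.pt) e0 hz
  have hpt : (f' x₀, f x₀) = (y'.pt, y.pt) := by rw [h0, h0']
  have h5 : HasMFDerivAt I ((𝓡 y'.dim).prod (𝓡 y.dim)) (fun x => (f' x, f x)) x₀ (L'.prod L) :=
    h2'.prodMk h2
  set S : Set (A y'.dim × A y.dim) := {q | Γ.src (incl y'.dim q.1) = Γ.tgt (incl y.dim q.2)}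
    with hSdef
  have hx' : (f' x₀, f x₀) ∈ U := by rw [hpt]; exact hx
  have hG : ∀ᶠ x in 𝓝 x₀, Γ.mul (G' x) (G x) = incl z.dim (F (f' x, f x)) := by
    filter_upwards [h1, h1', e, h5.continuousAt (hU.mem_nhds hx')] with x e1 e2 e3 e4
    rw [e1, e2] at e3 ⊢
    exact hF1 _ e4 e3
  have hS : ∀ᶠ x in 𝓝 x₀, (f' x, f x) ∈ S := by
    filter_upwards [h1, h1', e] with x e1 e2 e3
    rw [e1, e2] at e3
    exact e3
  -- The smooth extension `F` proves differentiability within `S`, and `tmul` is then one of the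
  -- derivatives within `S`; their uniqueness is not needed.
  have hd : HasMFDerivWithinAt ((𝓡 y'.dim).prod (𝓡 y.dim)) (𝓡 z.dim)
      (fun q : A y'.dim × A y.dim => part z (Γ.mul (incl y'.dim q.1) (incl y.dim q.2)))
      S (f' x₀, f x₀) (Γ.tmul y' y z) := by
    have : HasMFDerivWithinAt ((𝓡 y'.dim).prod (𝓡 y.dim)) (𝓡 z.dim)
        (fun q : A y'.dim × A y.dim => part z (Γ.mul (incl y'.dim q.1) (incl y.dim q.2)))
        S (y'.pt, y.pt) (Γ.tmul y' y z) := by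
      refine MDifferentiableWithinAt.hasMFDerivWithinAt ?_
      refine (((hF.contMDiffAt (hU.mem_nhds hx)).mdifferentiableAt
        (by simp)).mdifferentiableWithinAt (s := S)).congr_of_eventuallyEq ?_ ?_
      · filter_upwards [mem_nhdsWithin_of_mem_nhds (hU.mem_nhds hx), self_mem_nhdsWithin]
          with q e1 e2
        exact part_eq (hF1 q e1 e2)
      · exact part_eq (hF1 _ hx e0)
    rw [hpt]; exact this
  obtain ⟨V, hVS, hVo, hV⟩ := eventually_nhds_iff.1 hS
  have h6 := hd.comp x₀ (h5.hasMFDerivWithinAt (s := V))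
    (show V ⊆ (fun x => (f' x, f x)) ⁻¹' S from hVS)
  have h7 := h6.hasMFDerivAt (hVo.mem_nhds hV)
  refine ⟨by simp only [h'.1, h.1, hz], fun x => F (f' x, f x), hG, h7.congr_of_eventuallyEq ?_⟩
  filter_upwards [h1, h1', hG] with x e1 e2 e3
  rw [e1, e2] at e3
  exact (part_eq e3).symm

end DiffGroupoid

/-! ### Submersions: adapted charts and local sections -/

/-- Adapted charts for a submersion between boundaryless manifolds. -/
theorem Manifold.IsSubmersionAt.exists_charts {d n : ℕ} {M : Type*} [TopologicalSpace M]
    [ChartedSpace (Eu d) M] [IsManifold (𝓡 d) ∞ M] {X : Type*} [TopologicalSpace X]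
    [ChartedSpace (Eu n) X] [IsManifold (𝓡 n) ∞ X] {f : X → M} {a : X}
    (h : Manifold.IsSubmersionAt (𝓡 n) (𝓡 d) ∞ f a) :
    ∃ (φ : OpenPartialHomeomorph X (Eu n)) (χ : OpenPartialHomeomorph M (Eu d))
      (F : Type) (_ : NormedAddCommGroup F) (_ : NormedSpace ℝ F) (e : Eu n ≃L[ℝ] Eu d × F),
      a ∈ φ.source ∧ f a ∈ χ.source ∧ MapsTo f φ.source χ.source ∧
      ContMDiffOn (𝓡 n) (𝓡 n) ∞ φ φ.source ∧ ContMDiffOn (𝓡 n) (𝓡 n) ∞ φ.symm φ.target ∧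
      ContMDiffOn (𝓡 d) (𝓡 d) ∞ χ χ.source ∧ ContMDiffOn (𝓡 d) (𝓡 d) ∞ χ.symm χ.target ∧
      ∀ z ∈ φ.source, χ (f z) = (e (φ z)).1 := by
  refine ⟨h.domChart, h.codChart, h.complement, inferInstance, inferInstance, h.equiv,
    h.mem_domChart_source, h.mem_codChart_source, h.source_subset_preimage_source,
    contMDiffOn_of_mem_maximalAtlas h.domChart_mem_maximalAtlas,
    contMDiffOn_symm_of_mem_maximalAtlas h.domChart_mem_maximalAtlas,
    contMDiffOn_of_mem_maximalAtlas h.codChart_mem_maximalAtlas,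
    contMDiffOn_symm_of_mem_maximalAtlas h.codChart_mem_maximalAtlas, fun z hz => ?_⟩
  have := h.writtenInCharts (show h.domChart z ∈ (h.domChart.extend (𝓡 n)).target by
    simpa using h.domChart.map_source hz)
  simpa [hz] using this

theorem OpenPartialHomeomorph.mfderiv_symm_comp {E : Type*} [NormedAddCommGroup E]
    [NormedSpace ℝ E] {H : Type*} [TopologicalSpace H] {I : ModelWithCorners ℝ E H}
    {X : Type*} [TopologicalSpace X] [ChartedSpace H X]
    {E' : Type*} [NormedAddCommGroup E']
    [NormedSpace ℝ E'] {H' : Type*} [TopologicalSpace H'] {I' : ModelWithCorners ℝ E' H'}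
    {X' : Type*} [TopologicalSpace X'] [ChartedSpace H' X']
    (φ : OpenPartialHomeomorph X X')
    (h1 : ContMDiffOn I I' ∞ φ φ.source) (h2 : ContMDiffOn I' I ∞ φ.symm φ.target)
    {x : X} (hx : x ∈ φ.source) (w : E) :
    mfderiv I' I φ.symm (φ x) (mfderiv I I' φ x w) = w := by
  have e1 := ((h1.contMDiffAt (φ.open_source.mem_nhds hx)).mdifferentiableAt
    (by simp)).hasMFDerivAt
  have e2 := ((h2.contMDiffAt (φ.open_target.mem_nhds (φ.map_source hx))).mdifferentiableAt
    (by simp)).hasMFDerivAt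
  have e3 := e2.comp x e1
  have e4 : HasMFDerivAt I I (φ.symm ∘ φ) x (ContinuousLinearMap.id ℝ E) := by
    refine (hasMFDerivAt_id x).congr_of_eventuallyEq ?_
    filter_upwards [φ.open_source.mem_nhds hx] with z hz using φ.left_inv hz
  have := hasMFDerivAt_unique e3 e4
  exact congrArg (fun T : E →L[ℝ] E => T w) this

theorem OpenPartialHomeomorph.mfderiv_comp_symm {E : Type*} [NormedAddCommGroup E]
    [NormedSpace ℝ E] {H : Type*} [TopologicalSpace H] {I : ModelWithCorners ℝ E H}
    {X : Type*} [TopologicalSpace X] [ChartedSpace H X]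
    {E' : Type*} [NormedAddCommGroup E']
    [NormedSpace ℝ E'] {H' : Type*} [TopologicalSpace H'] {I' : ModelWithCorners ℝ E' H'}
    {X' : Type*} [TopologicalSpace X'] [ChartedSpace H' X']
    (φ : OpenPartialHomeomorph X X')
    (h1 : ContMDiffOn I I' ∞ φ φ.source) (h2 : ContMDiffOn I' I ∞ φ.symm φ.target)
    {x : X} (hx : x ∈ φ.source) (w : E') :
    mfderiv I I' φ x (mfderiv I' I φ.symm (φ x) w) = w := by
  have e1 : HasMFDerivAt I I' φ (φ.symm (φ x)) (mfderiv I I' φ x) := by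
    rw [φ.left_inv hx]
    exact ((h1.contMDiffAt (φ.open_source.mem_nhds hx)).mdifferentiableAt
      (by simp)).hasMFDerivAt
  have e2 := ((h2.contMDiffAt (φ.open_target.mem_nhds (φ.map_source hx))).mdifferentiableAt
    (by simp)).hasMFDerivAt
  have e3 := e1.comp (φ x) e2
  have e4 : HasMFDerivAt I' I' (φ ∘ φ.symm) (φ x) (ContinuousLinearMap.id ℝ E') := by
    refine (hasMFDerivAt_id (φ x)).congr_of_eventuallyEq ?_
    filter_upwards [φ.open_target.mem_nhds (φ.map_source hx)] with z hz using φ.right_inv hz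
  have := hasMFDerivAt_unique e3 e4
  exact congrArg (fun T : E' →L[ℝ] E' => T w) this

/-- A linear section of the derivative of a submersion is the derivative of a local section. -/
theorem Manifold.IsSubmersionAt.exists_section {d n : ℕ} {M : Type*} [TopologicalSpace M]
    [ChartedSpace (Eu d) M] [IsManifold (𝓡 d) ∞ M] {X : Type*} [TopologicalSpace X]
    [ChartedSpace (Eu n) X] [IsManifold (𝓡 n) ∞ X] {f : X → M} {a : X}
    (h : Manifold.IsSubmersionAt (𝓡 n) (𝓡 d) ∞ f a) {L : Eu d →L[ℝ] Eu n}
    (hL : ∀ v, mfderiv (𝓡 n) (𝓡 d) f a (L v) = v) :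
    ∃ σ : M → X, σ (f a) = a ∧ HasMFDerivAt (𝓡 d) (𝓡 n) σ (f a) L ∧
      ∀ᶠ x in 𝓝 (f a), f (σ x) = x := by
  obtain ⟨φ, χ, F, _, _, e, ha, hfa, hmap, h1, h2, h3, h4, h5⟩ := h.exists_charts
  let Dφ : Eu n →L[ℝ] Eu n := mfderiv (𝓡 n) (𝓡 n) φ a
  let Dχ : Eu d →L[ℝ] Eu d := mfderiv (𝓡 d) (𝓡 d) χ (f a)
  let Dχ' : Eu d →L[ℝ] Eu d := mfderiv (𝓡 d) (𝓡 d) χ.symm (χ (f a))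
  -- `T` is `L` read in the two charts. There the submersion is a linear projection, and `hT` says
  -- that `T` is a right inverse of it.
  let T : Eu d →L[ℝ] Eu n := Dφ.comp (L.comp Dχ')
  have eφ := ((h1.contMDiffAt (φ.open_source.mem_nhds ha)).mdifferentiableAt
    (by simp)).hasMFDerivAt
  have eχ := ((h3.contMDiffAt (χ.open_source.mem_nhds hfa)).mdifferentiableAt
    (by simp)).hasMFDerivAt
  have ef : HasMFDerivAt (𝓡 n) (𝓡 d) f a (mfderiv (𝓡 n) (𝓡 d) f a) :=
    (h.contMDiffAt.mdifferentiableAt (by simp)).hasMFDerivAt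
  have hT : ∀ v, (e (T v)).1 = v := by
    intro v
    have k1 := eχ.comp a ef
    have k2 : HasMFDerivAt (𝓡 n) (𝓡 d) (χ ∘ f) a
        ((((ContinuousLinearMap.fst ℝ (Eu d) F).comp (e : Eu n →L[ℝ] Eu d × F))).comp Dφ) := by
      have k3 : HasMFDerivAt (𝓡 n) (𝓡 d) (fun z => (e z).1) (φ a)
          ((ContinuousLinearMap.fst ℝ (Eu d) F).comp (e : Eu n →L[ℝ] Eu d × F)) :=
        ((ContinuousLinearMap.fst ℝ (Eu d) F).comp
          (e : Eu n →L[ℝ] Eu d × F)).hasFDerivAt.hasMFDerivAt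
      refine (k3.comp a eφ).congr_of_eventuallyEq ?_
      filter_upwards [φ.open_source.mem_nhds ha] with z hz using h5 z hz
    have k4 := congrArg (fun S : Eu n →L[ℝ] Eu d => S (L (Dχ' v))) (hasMFDerivAt_unique k1 k2)
    have k5 : Dχ (mfderiv (𝓡 n) (𝓡 d) f a (L (Dχ' v))) = (e (T v)).1 := k4
    rw [← k5, hL]
    exact χ.mfderiv_comp_symm (I := 𝓡 d) (I' := 𝓡 d) h3 h4 hfa v
  -- The section is affine in charts, through `φ a` with slope `T`; its base component is exactly `χ
  -- x`.
  let τ : M → Eu n := fun x => φ a + T (χ x - χ (f a))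
  have hτ0 : τ (f a) = φ a := by simp [τ]
  have hτ : HasMFDerivAt (𝓡 d) (𝓡 n) τ (f a) (T.comp Dχ) := by
    have k : HasMFDerivAt (𝓡 d) (𝓡 n) (fun z : Eu d => φ a + T (z - χ (f a))) (χ (f a)) T := by
      have : HasFDerivAt (fun z : Eu d => φ a + T (z - χ (f a))) T (χ (f a)) := by
        exact (T.hasFDerivAt.comp (χ (f a))
          ((hasFDerivAt_id (χ (f a))).sub_const (χ (f a)))).const_add (φ a)
      exact this.hasMFDerivAt
    exact k.comp (f a) eχ
  have hτt : ∀ᶠ x in 𝓝 (f a), τ x ∈ φ.target := by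
    refine hτ.continuousAt (φ.open_target.mem_nhds ?_)
    rw [hτ0]; exact φ.map_source ha
  have eφ' : HasMFDerivAt (𝓡 n) (𝓡 n) φ.symm (τ (f a)) (mfderiv (𝓡 n) (𝓡 n) φ.symm (φ a)) := by
    rw [hτ0]
    exact ((h2.contMDiffAt (φ.open_target.mem_nhds (φ.map_source ha))).mdifferentiableAt
      (by simp)).hasMFDerivAt
  refine ⟨fun x => φ.symm (τ x), by simp only [hτ0, φ.left_inv ha],
    (eφ'.comp (f a) hτ).congr_mfderiv ?_, ?_⟩
  · ext1 v
    have k1 := φ.mfderiv_symm_comp (I := 𝓡 n) (I' := 𝓡 n) h1 h2 ha (L (Dχ' (Dχ v)))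
    have k2 : Dχ' (Dχ v) = v := χ.mfderiv_symm_comp (I := 𝓡 d) (I' := 𝓡 d) h3 h4 hfa v
    rw [k2] at k1
    refine Eq.trans ?_ k1
    show mfderiv (𝓡 n) (𝓡 n) φ.symm (φ a) (Dφ (L (Dχ' (Dχ v)))) = _
    rw [k2]; rfl
  · filter_upwards [hτt, χ.open_source.mem_nhds hfa] with x hx hx2
    have k1 := φ.map_target hx
    refine χ.injOn (hmap k1) hx2 ?_
    rw [h5 _ k1, φ.right_inv hx]
    have : e (τ x) = e (φ a) + e (T (χ x - χ (f a))) := by simp [τ]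
    rw [this, Prod.fst_add, hT, ← h5 a ha]
    abel

namespace DiffGroupoid

variable {d : ℕ} {M : Type v} [TopologicalSpace M] [ChartedSpace (Eu d) M]
  [IsManifold (𝓡 d) ∞ M] {A : ℕ → Type u} [∀ n, TopologicalSpace (A n)]
  [∀ n, ChartedSpace (Eu n) (A n)] [∀ n, IsManifold (𝓡 n) ∞ (A n)]
  {Γ : DiffGroupoid d M A}

theorem exists_section {g : MixedManifold A} {L : Eu d →L[ℝ] Eu g.dim}
    (hL : ∀ v, Γ.tsrc g (L v) = v) :
    ∃ σ : M → MixedManifold A, HasTDeriv (𝓡 d) σ (Γ.src g) g L ∧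
      ∀ᶠ x in 𝓝 (Γ.src g), Γ.src (σ x) = x := by
  obtain ⟨σ, h1, h2, h3⟩ := (Γ.submersion_src g.dim g.pt).exists_section hL
  exact ⟨fun x => incl g.dim (σ x), ⟨congrArg (incl g.dim) h1, σ, Eventually.of_forall fun _ => rfl,
    h2⟩, h3⟩

end DiffGroupoid

/-! ### Connections, quotients of horizontal lifts, and multiplicativity -/

namespace DiffGroupoid

variable {d : ℕ} {M : Type v} [TopologicalSpace M] [ChartedSpace (Eu d) M]
  [IsManifold (𝓡 d) ∞ M] {A : ℕ → Type u} [∀ n, TopologicalSpace (A n)]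
  [∀ n, ChartedSpace (Eu n) (A n)] [∀ n, IsManifold (𝓡 n) ∞ (A n)]
  {Γ : DiffGroupoid d M A}

namespace Connection

variable {p : ℕ∞} (Φ : Γ.Connection p)

theorem exists_section (g : MixedManifold A) :
    ∃ σ : M → MixedManifold A, HasTDeriv (𝓡 d) σ (Γ.src g) g (Φ.lift g) ∧
      ∀ᶠ x in 𝓝 (Γ.src g), Γ.src (σ x) = x :=
  DiffGroupoid.exists_section (Φ.tsrc_lift g)

variable {Φ}

theorem IsEffective.effect_inv_comp (h : Φ.IsEffective) (g : MixedManifold A) :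
    (Φ.effect (Γ.inv g)).comp (Φ.effect g) = ContinuousLinearMap.id ℝ (Eu d) := by
  rw [← h.2 _ _ (Γ.src_inv g), Γ.inv_mul, h.1]

theorem IsEffective.effect_comp_inv (h : Φ.IsEffective) (g : MixedManifold A) :
    (Φ.effect g).comp (Φ.effect (Γ.inv g)) = ContinuousLinearMap.id ℝ (Eu d) := by
  rw [← h.2 _ _ (Γ.tgt_inv g).symm, Γ.mul_inv, h.1]

theorem IsEffective.isNondegenerate (h : Φ.IsEffective) : Φ.IsNondegenerate := fun g =>
  ContinuousLinearMap.IsInvertible.of_inverse (h.effect_comp_inv g) (h.effect_inv_comp g)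

theorem IsNondegenerate.effect_inverse_apply (h : Φ.IsNondegenerate) (g : MixedManifold A)
    (v : Eu d) : Φ.effect g ((Φ.effect g).inverse v) = v := by
  exact congrArg (fun T : Eu d →L[ℝ] Eu d => T v) ((h g).self_comp_inverse)

theorem IsNondegenerate.inverse_effect_apply (h : Φ.IsNondegenerate) (g : MixedManifold A)
    (v : Eu d) : (Φ.effect g).inverse (Φ.effect g v) = v := by
  exact congrArg (fun T : Eu d →L[ℝ] Eu d => T v) ((h g).inverse_comp_self)

variable (Φ)

/-- The quotient `η_g ÷ η_k` of two horizontal lifts. -/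
def quot (g k y : MixedManifold A) : Eu d →L[ℝ] Eu y.dim :=
  (Γ.tmul g (Γ.inv k) y).comp ((Φ.lift g).prod ((Γ.tinv k).comp (Φ.lift k)))

theorem diffCocycle_eq (g k y : MixedManifold A) :
    Φ.diffCocycle g k y = (Φ.quot g k y).comp (Φ.effect k).inverse := rfl

variable {Φ}

/-- Both sections are parametrized by the common source, so x ↦ σ(x) τ(x)⁻¹ is defined near `Γ.src
g` and its derivative is the quotient of the two lifts. -/
theorem hasTDeriv_quot {g k y : MixedManifold A} (h : Γ.src g = Γ.src k)
    (hy : Γ.mul g (Γ.inv k) = y) {σ τ : M → MixedManifold A}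
    (hσ : HasTDeriv (𝓡 d) σ (Γ.src g) g (Φ.lift g))
    (hσs : ∀ᶠ x in 𝓝 (Γ.src g), Γ.src (σ x) = x)
    (hτ : HasTDeriv (𝓡 d) τ (Γ.src k) k (Φ.lift k))
    (hτs : ∀ᶠ x in 𝓝 (Γ.src k), Γ.src (τ x) = x) :
    HasTDeriv (𝓡 d) (fun x => Γ.mul (σ x) (Γ.inv (τ x))) (Γ.src g) y (Φ.quot g k y) := by
  rw [← h] at hτ hτs
  refine hσ.mul Γ (hτ.inv Γ) ?_ hy
  filter_upwards [hσs, hτs] with x h1 h2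
  rw [h1, Γ.tgt_inv, h2]

/-- Derivative of s(στ⁻¹) = t(τ). -/
theorem tsrc_quot {g k y : MixedManifold A} (h : Γ.src g = Γ.src k)
    (hy : Γ.mul g (Γ.inv k) = y) (v : Eu d) : Γ.tsrc y (Φ.quot g k y v) = Φ.effect k v := by
  obtain ⟨σ, hσ, hσs⟩ := Φ.exists_section g
  obtain ⟨τ, hτ, hτs⟩ := Φ.exists_section k
  have h1 := (hasTDeriv_quot h hy hσ hσs hτ hτs).src Γ
  have h2 := hτ.tgt Γ
  rw [← h] at h2 hτs
  have h3 := hasMFDerivAt_unique h1 (h2.congr_of_eventuallyEq ?_)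
  · exact congrArg (fun T : Eu d →L[ℝ] Eu d => T v) h3
  · filter_upwards [hσs, hτs] with x h1 h2
    rw [Γ.src_mul _ _ (by rw [Γ.tgt_inv, h1, h2]), Γ.src_inv]

theorem ttgt_quot {g k y : MixedManifold A} (h : Γ.src g = Γ.src k)
    (hy : Γ.mul g (Γ.inv k) = y) (v : Eu d) : Γ.ttgt y (Φ.quot g k y v) = Φ.effect g v := by
  obtain ⟨σ, hσ, hσs⟩ := Φ.exists_section g
  obtain ⟨τ, hτ, hτs⟩ := Φ.exists_section k
  have h1 := (hasTDeriv_quot h hy hσ hσs hτ hτs).tgt Γ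
  rw [← h] at hτs
  have h3 := hasMFDerivAt_unique h1 ((hσ.tgt Γ).congr_of_eventuallyEq ?_)
  · exact congrArg (fun T : Eu d →L[ℝ] Eu d => T v) h3
  · filter_upwards [hσs, hτs] with x h1 h2
    rw [Γ.tgt_mul _ _ (by rw [Γ.tgt_inv, h1, h2])]

/-- The cocycle identity: the derivative of (σ₁σ₂⁻¹)(σ₂σ₃⁻¹) = σ₁σ₃⁻¹. -/
theorem tmul_quot {g₁ g₂ g₃ y z w : MixedManifold A} (h₁₂ : Γ.src g₁ = Γ.src g₂)
    (h₂₃ : Γ.src g₂ = Γ.src g₃) (hy : Γ.mul g₁ (Γ.inv g₂) = y) (hz : Γ.mul g₂ (Γ.inv g₃) = z)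
    (hw : Γ.mul y z = w) (v : Eu d) :
    Γ.tmul y z w (Φ.quot g₁ g₂ y v, Φ.quot g₂ g₃ z v) = Φ.quot g₁ g₃ w v := by
  obtain ⟨σ₁, hσ₁, hs₁⟩ := Φ.exists_section g₁
  obtain ⟨σ₂, hσ₂, hs₂⟩ := Φ.exists_section g₂
  obtain ⟨σ₃, hσ₃, hs₃⟩ := Φ.exists_section g₃
  have hw' : Γ.mul g₁ (Γ.inv g₃) = w := by
    rw [← hw, ← hy, ← hz, Γ.mul_inv_mul_cancel h₁₂ h₂₃]
  have e1 := hasTDeriv_quot h₁₂ hy hσ₁ hs₁ hσ₂ hs₂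
  have e2 := hasTDeriv_quot h₂₃ hz hσ₂ hs₂ hσ₃ hs₃
  have e3 := hasTDeriv_quot (h₁₂.trans h₂₃) hw' hσ₁ hs₁ hσ₃ hs₃
  rw [← h₂₃] at hs₃
  rw [← h₁₂] at e2 hs₂ hs₃
  have e4 := (e1.mul Γ e2 ?_ hw).unique (e3.congr ?_)
  · exact congrArg (fun T : Eu d →L[ℝ] Eu w.dim => T v) e4
  · filter_upwards [hs₁, hs₂, hs₃] with x k1 k2 k3
    rw [Γ.src_mul _ _ (by rw [Γ.tgt_inv, k1, k2]), Γ.tgt_mul _ _ (by rw [Γ.tgt_inv, k2, k3]),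
      Γ.src_inv]
  · filter_upwards [hs₁, hs₂, hs₃] with x k1 k2 k3
    rw [Γ.mul_inv_mul_cancel (by rw [k1, k2]) (by rw [k2, k3])]

/-- Derivative of σσ⁻¹ = 1_{tσ}. -/
theorem quot_self (k : MixedManifold A) (v : Eu d) :
    Φ.quot k k (Γ.one (Γ.tgt k)) v = Γ.tone (Γ.tgt k) (Φ.effect k v) := by
  obtain ⟨σ, hσ, hs⟩ := Φ.exists_section k
  have e1 := hasTDeriv_quot rfl (Γ.mul_inv k) hσ hs hσ hs
  have e2 := Γ.hasTDeriv_one (hσ.tgt Γ) (congrArg Γ.tgt hσ.1)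
  have e4 := e1.unique (e2.congr (Eventually.of_forall fun x => Γ.mul_inv (σ x)))
  exact congrArg (fun T : Eu d →L[ℝ] Eu _ => T v) e4

theorem tsrc_tone (x : M) (v : Eu d) : Γ.tsrc (Γ.one x) (Γ.tone x v) = v := by
  have h1 := (Γ.hasTDeriv_one (hasMFDerivAt_id (I := 𝓡 d) x) rfl).src Γ
  have h2 := hasMFDerivAt_unique h1 ((hasMFDerivAt_id (I := 𝓡 d) x).congr_of_eventuallyEq
    (Eventually.of_forall fun x => Γ.src_one x))
  exact congrArg (fun T : Eu d →L[ℝ] Eu d => T v) h2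

theorem ttgt_tone (x : M) (v : Eu d) : Γ.ttgt (Γ.one x) (Γ.tone x v) = v := by
  have h1 := (Γ.hasTDeriv_one (hasMFDerivAt_id (I := 𝓡 d) x) rfl).tgt Γ
  have h2 := hasMFDerivAt_unique h1 ((hasMFDerivAt_id (I := 𝓡 d) x).congr_of_eventuallyEq
    (Eventually.of_forall fun x => Γ.tgt_one x))
  exact congrArg (fun T : Eu d →L[ℝ] Eu d => T v) h2

/-- Composable families of arrows that realize the horizontal lifts of `v` at `g` and of
`λ_g v` at `g'`. -/
theorem exists_composable {g' g : MixedManifold A} (h : Γ.src g' = Γ.tgt g) :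
    ∃ G' G : M → MixedManifold A,
      HasTDeriv (𝓡 d) G' (Γ.src g) g' ((Φ.lift g').comp (Φ.effect g)) ∧
      HasTDeriv (𝓡 d) G (Γ.src g) g (Φ.lift g) ∧
      (∀ᶠ x in 𝓝 (Γ.src g), Γ.src (G' x) = Γ.tgt (G x)) ∧
      ∀ᶠ x in 𝓝 (Γ.src g), Γ.src (G x) = x := by
  obtain ⟨σ, hσ, hs⟩ := Φ.exists_section g
  obtain ⟨σ', hσ', hs'⟩ := Φ.exists_section g'
  have ht := hσ.tgt Γ
  have h0 : Γ.tgt (σ (Γ.src g)) = Γ.src g' := by rw [hσ.1, h]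
  have hc := ht.continuousAt
  -- Reparametrizing σ' by t ∘ σ makes the two families composable near the base point and
  -- precomposes the lift at `g'` with the effect of `g`.
  refine ⟨fun x => σ' (Γ.tgt (σ x)), σ, hσ'.comp ht h0, hσ, ?_, hs⟩
  rw [← h0] at hs'
  exact hc.eventually hs'

theorem ttgt_tmul_lift {g' g z : MixedManifold A} (h : Γ.src g' = Γ.tgt g)
    (hz : Γ.mul g' g = z) (v : Eu d) :
    Γ.ttgt z (Γ.tmul g' g z (Φ.lift g' (Φ.effect g v), Φ.lift g v)) =
      Φ.effect g' (Φ.effect g v) := by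
  obtain ⟨G', G, h1, h2, h3, -⟩ := Φ.exists_composable h
  have k := hasMFDerivAt_unique ((h1.mul Γ h2 h3 hz).tgt Γ) ((h1.tgt Γ).congr_of_eventuallyEq (by
    filter_upwards [h3] with x hx using Γ.tgt_mul _ _ hx))
  exact congrArg (fun T : Eu d →L[ℝ] Eu d => T v) k

theorem tsrc_tmul_lift {g' g z : MixedManifold A} (h : Γ.src g' = Γ.tgt g)
    (hz : Γ.mul g' g = z) (v : Eu d) :
    Γ.tsrc z (Γ.tmul g' g z (Φ.lift g' (Φ.effect g v), Φ.lift g v)) = v := by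
  obtain ⟨G', G, h1, h2, h3, -⟩ := Φ.exists_composable h
  have k := hasMFDerivAt_unique ((h1.mul Γ h2 h3 hz).src Γ) ((h2.src Γ).congr_of_eventuallyEq (by
    filter_upwards [h3] with x hx using Γ.src_mul _ _ hx))
  exact (congrArg (fun T : Eu d →L[ℝ] Eu d => T v) k).trans (Φ.tsrc_lift g v)

theorem lift_eq_of_mem_horizontal {g : MixedManifold A} {w : Eu g.dim}
    (h : w ∈ Φ.horizontal g) : Φ.lift g (Γ.tsrc g w) = w := by
  obtain ⟨v, rfl⟩ := h
  rw [Φ.tsrc_lift]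

/-- A horizontal vector is the lift of its source component. Tangent units and products of lifts are
horizontal, hence are themselves lifts; applying Tt gives the two laws of a representation. -/
theorem IsMultiplicative.isEffective (h : Φ.IsMultiplicative) : Φ.IsEffective := by
  constructor
  · intro x
    ext1 v
    have := lift_eq_of_mem_horizontal (h.one_mem x v)
    rw [tsrc_tone] at this
    show Γ.ttgt _ (Φ.lift _ v) = v
    rw [this, ttgt_tone]
  · intro g' g hg
    ext1 v
    have h1 := h.mul_mem g' g hg (Φ.lift g' (Φ.effect g v)) ⟨_, rfl⟩ (Φ.lift g v) ⟨_, rfl⟩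
      (Φ.tsrc_lift _ _)
    have h2 := lift_eq_of_mem_horizontal h1
    rw [tsrc_tmul_lift hg rfl] at h2
    show Γ.ttgt _ (Φ.lift _ v) = _
    rw [h2, ttgt_tmul_lift hg rfl]
    rfl

/-- Compatibility with units and products forces compatibility with inverses: the lift at g⁻¹ of λ_g
v, multiplied by the lift of v at g, is a tangent unit, so it is the tangent inverse of that lift.
-/
theorem isMultiplicative_of_lift (h1 : ∀ x v, Φ.lift (Γ.one x) v = Γ.tone x v)
    (h2 : ∀ g' g z, Γ.src g' = Γ.tgt g → Γ.mul g' g = z → ∀ v,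
      Γ.tmul g' g z (Φ.lift g' (Φ.effect g v), Φ.lift g v) = Φ.lift z v) :
    Φ.IsMultiplicative := by
  refine ⟨fun x v => ⟨v, h1 x v⟩, ?_, ?_⟩
  · rintro g' g hg _ ⟨v', rfl⟩ _ ⟨v, rfl⟩ hv
    rw [Φ.tsrc_lift] at hv
    subst hv
    exact ⟨v, (h2 g' g _ hg rfl v).symm⟩
  · rintro g _ ⟨v, rfl⟩
    refine ⟨Φ.effect g v, ?_⟩
    obtain ⟨G', G, e1, e2, e3, e4⟩ := Φ.exists_composable (Γ.src_inv g)
    have hone : Γ.mul (Γ.one (Γ.src g)) (Γ.inv g) = Γ.inv g := by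
      rw [← Γ.tgt_inv, Γ.one_mul]
    have k1 : HasTDeriv (𝓡 d) (fun x => Γ.mul (G' x) (G x)) (Γ.src g) (Γ.one (Γ.src g))
        (Γ.tone (Γ.src g)) := by
      have := e1.mul Γ e2 e3 (Γ.inv_mul g)
      convert this using 1
      ext1 v
      exact ((h2 _ _ _ (Γ.src_inv g) (Γ.inv_mul g) v).trans (h1 _ v)).symm
    have k2 := k1.mul Γ (e2.inv Γ) (by
      filter_upwards [e3] with x hx
      rw [Γ.src_mul _ _ hx, Γ.tgt_inv]) hone
    have k3 := e1.unique (k2.congr (by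
      filter_upwards [e3] with x hx
      rw [Γ.mul_inv_cancel_right hx]))
    have k4 : HasTDeriv (𝓡 d) Γ.one (Γ.src g) (Γ.one (Γ.src g)) (Γ.tone (Γ.src g)) :=
      Γ.hasTDeriv_one (hasMFDerivAt_id (I := 𝓡 d) (Γ.src g)) rfl
    have k5 := k4.mul Γ (e2.inv Γ) (by
      filter_upwards [e4] with x hx
      rw [Γ.src_one, Γ.tgt_inv, hx]) hone
    have k6 := (e2.inv Γ).unique (k5.congr (by
      filter_upwards [e4] with x hx
      conv_lhs => rw [← Γ.one_mul (Γ.inv (G x)), Γ.tgt_inv, hx]))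
    exact congrArg (fun T : Eu d →L[ℝ] Eu _ => T v) (k3.trans k6.symm)

end Connection

end DiffGroupoid

/-! ### Trivializations of the target map -/

theorem OpenPartialHomeomorph.eventually_mk_mem_source {X Y Z : Type*} [TopologicalSpace X]
    [TopologicalSpace Y] [TopologicalSpace Z] (ψ : OpenPartialHomeomorph (X × Y) Z) {q : X × Y}
    (hq : q ∈ ψ.source) : ∀ᶠ u in 𝓝 q.1, (u, q.2) ∈ ψ.source := by
  have : Continuous fun u : X => (u, q.2) := by fun_prop
  exact this.continuousAt (ψ.open_source.mem_nhds hq)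

namespace DiffGroupoid

variable {d : ℕ} {M : Type v} [TopologicalSpace M] [ChartedSpace (Eu d) M]
  [IsManifold (𝓡 d) ∞ M] {A : ℕ → Type u} [∀ n, TopologicalSpace (A n)]
  [∀ n, ChartedSpace (Eu n) (A n)] [∀ n, IsManifold (𝓡 n) ∞ (A n)]
  (Γ : DiffGroupoid d M A)

/-- Ensures that the truncated subtraction in the fiber dimension `n - d` loses nothing. -/
theorem le_dim (Γ : DiffGroupoid d M A) {n : ℕ} (a : A n) : d ≤ n := by
  obtain ⟨φ, χ, F, _, _, e, -⟩ := (Γ.submersion_tgt n a).exists_charts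
  have := LinearMap.finrank_le_finrank_of_injective
    (f := (e.symm : Eu d × F →L[ℝ] Eu n).toLinearMap.comp (LinearMap.inl ℝ (Eu d) F))
    (e.symm.injective.comp LinearMap.inl_injective)
  simpa using this

/-- In adapted charts the target map is a projection whose complement has dimension `n - d`.
Identifying the complement with `Eu (n - d)` and undoing the chart of the base factor gives ψ. -/
theorem exists_targetTrivialization {n : ℕ} (a : A n) :
    ∃ ψ : OpenPartialHomeomorph (Eu (n - d) × M) (A n), Γ.IsTargetTrivialization n ψ ∧
      a ∈ ψ.target := by
  obtain ⟨φ, χ, F, _, _, e, ha, hfa, hmap, h1, h2, h3, h4, h5⟩ :=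
    (Γ.submersion_tgt n a).exists_charts
  have hF : FiniteDimensional ℝ F :=
    FiniteDimensional.of_surjective
      ((LinearMap.snd ℝ (Eu d) F).comp (e : Eu n →L[ℝ] Eu d × F).toLinearMap)
      ((LinearMap.snd_surjective (R := ℝ) (M := Eu d) (M₂ := F)).comp e.surjective)
  have hr : Module.finrank ℝ (Eu (n - d)) = Module.finrank ℝ F := by
    have := e.toLinearEquiv.finrank_eq
    rw [Module.finrank_prod] at this
    simp only [finrank_euclideanSpace, Fintype.card_fin] at this ⊢
    omega
  let ε : Eu (n - d) ≃L[ℝ] F := ContinuousLinearEquiv.ofFinrankEq hr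
  let κ : (Eu (n - d) × Eu d) ≃L[ℝ] Eu n :=
    ((ContinuousLinearEquiv.prodComm ℝ (Eu (n - d)) (Eu d)).trans
      ((ContinuousLinearEquiv.refl ℝ (Eu d)).prodCongr ε)).trans e.symm
  let ρ : OpenPartialHomeomorph (Eu (n - d) × M) (Eu (n - d) × Eu d) :=
    (OpenPartialHomeomorph.refl (Eu (n - d))).prod χ
  let ψ := (ρ.trans κ.toHomeomorph.toOpenPartialHomeomorph).trans φ.symm
  have hκ : ∀ q, (e (κ q)).1 = q.2 := fun q => by simp [κ]
  have hs : ∀ q, q ∈ ψ.source ↔ q.2 ∈ χ.source ∧ κ (q.1, χ q.2) ∈ φ.target := by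
    intro q; simp [ψ, ρ]
  have hψ : ∀ q, ψ q = φ.symm (κ (q.1, χ q.2)) := fun q => rfl
  have ht : ∀ z, z ∈ ψ.target ↔ z ∈ φ.source ∧ (κ.symm (φ z)).2 ∈ χ.target := by
    intro q; simp [ψ, ρ]
  have hψ' : ∀ z, ψ.symm z = ((κ.symm (φ z)).1, χ.symm (κ.symm (φ z)).2) := fun q => rfl
  refine ⟨ψ, ⟨?_, ?_, ?_⟩, ?_⟩
  · intro q hq
    rw [hs] at hq
    have k1 : ContMDiffAt ((𝓡 (n - d)).prod (𝓡 d)) (𝓡 d) ∞ (fun q : Eu (n - d) × M => χ q.2) q :=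
      (h3.contMDiffAt (χ.open_source.mem_nhds hq.1)).comp q contMDiffAt_snd
    have k2 : ContMDiffAt ((𝓡 (n - d)).prod (𝓡 d)) (𝓡 n) ∞
        (fun q : Eu (n - d) × M => κ (q.1, χ q.2)) q :=
      κ.contDiff.contMDiff.contMDiffAt.comp q (contMDiffAt_fst.prodMk_space k1)
    exact ((h2.contMDiffAt (φ.open_target.mem_nhds hq.2)).comp q k2).contMDiffWithinAt
  · intro z hz
    rw [ht] at hz
    have k0 := h1.contMDiffAt (φ.open_source.mem_nhds hz.1)
    have k1 : ContMDiffAt (𝓡 n) (𝓡 (n - d)) ∞ (fun z => (κ.symm (φ z)).1) z :=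
      (contDiff_fst.comp κ.symm.contDiff).contMDiff.contMDiffAt.comp z k0
    have k2 : ContMDiffAt (𝓡 n) (𝓡 d) ∞ (fun z => (κ.symm (φ z)).2) z :=
      (contDiff_snd.comp κ.symm.contDiff).contMDiff.contMDiffAt.comp z k0
    have k3 : ContMDiffAt (𝓡 n) (𝓡 d) ∞ (fun z => χ.symm (κ.symm (φ z)).2) z :=
      (h4.contMDiffAt (χ.open_target.mem_nhds hz.2)).comp z k2
    exact (k1.prodMk k3).contMDiffWithinAt
  · intro q hq
    rw [hs] at hq
    have k := φ.map_target hq.2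
    refine χ.injOn (hmap k) hq.1 ?_
    change χ (Γ.tgt (incl n (φ.symm (κ (q.1, χ q.2))))) = _
    rw [h5 _ k, φ.right_inv hq.2, hκ]
  · rw [ht]
    refine ⟨ha, ?_⟩
    have : (κ.symm (φ a)).2 = χ (Γ.tgt (incl n a)) := by
      rw [h5 a ha, ← hκ, κ.apply_symm_apply]
    rw [this]
    exact χ.map_source hfa

namespace IsTargetTrivialization

variable {Γ} {n : ℕ} {ψ : OpenPartialHomeomorph (Eu (n - d) × M) (A n)}

theorem symm_snd (hψ : Γ.IsTargetTrivialization n ψ)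
    {a : A n} (ha : a ∈ ψ.target) : (ψ.symm a).2 = Γ.tgt (incl n a) := by
  rw [← hψ.2.2 _ (ψ.map_target ha), ψ.right_inv ha]

theorem contMDiffAt (hψ : Γ.IsTargetTrivialization n ψ)
    {q : Eu (n - d) × M} (hq : q ∈ ψ.source) :
    ContMDiffAt ((𝓡 (n - d)).prod (𝓡 d)) (𝓡 n) ∞ ψ q :=
  hψ.1.contMDiffAt (ψ.open_source.mem_nhds hq)

theorem contMDiffAt_symm (hψ : Γ.IsTargetTrivialization n ψ)
    {a : A n} (ha : a ∈ ψ.target) :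
    ContMDiffAt (𝓡 n) ((𝓡 (n - d)).prod (𝓡 d)) ∞ ψ.symm a :=
  hψ.2.1.contMDiffAt (ψ.open_target.mem_nhds ha)

/-- The derivative of the fiber parametrization `u ↦ ψ (u, x)`. -/
def _root_.DiffGroupoid.fiberDeriv (ψ : OpenPartialHomeomorph (Eu (n - d) × M) (A n))
    (q : Eu (n - d) × M) : Eu (n - d) →L[ℝ] Eu n :=
  mfderiv (𝓡 (n - d)) (𝓡 n) (fun u : Eu (n - d) => ψ (u, q.2)) q.1

theorem hasMFDerivAt_fiber (hψ : Γ.IsTargetTrivialization n ψ)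
    {q : Eu (n - d) × M} (hq : q ∈ ψ.source) :
    HasMFDerivAt (𝓡 (n - d)) (𝓡 n) (fun u : Eu (n - d) => ψ (u, q.2)) q.1 (fiberDeriv ψ q) := by
  have k : ContMDiffAt (𝓡 (n - d)) (𝓡 n) ∞ (fun u : Eu (n - d) => ψ (u, q.2)) q.1 :=
    (hψ.contMDiffAt hq).comp q.1 (contMDiffAt_id.prodMk contMDiffAt_const)
  exact (k.mdifferentiableAt (by simp)).hasMFDerivAt

theorem hasTDeriv_fiber (hψ : Γ.IsTargetTrivialization n ψ)
    {q : Eu (n - d) × M} (hq : q ∈ ψ.source) :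
    HasTDeriv (𝓡 (n - d)) (fun u : Eu (n - d) => incl n (ψ (u, q.2))) q.1 (incl n (ψ q))
      (fiberDeriv ψ q) :=
  (hψ.hasMFDerivAt_fiber hq).hasTDeriv

theorem ttgt_fiberDeriv (hψ : Γ.IsTargetTrivialization n ψ)
    {q : Eu (n - d) × M} (hq : q ∈ ψ.source) (c : Eu (n - d)) :
    Γ.ttgt (incl n (ψ q)) (fiberDeriv ψ q c) = 0 := by
  have h1 := (hψ.hasTDeriv_fiber hq).tgt Γ
  have h2 : HasMFDerivAt (𝓡 (n - d)) (𝓡 d) (fun u : Eu (n - d) => Γ.tgt (incl n (ψ (u, q.2)))) q.1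
      (0 : Eu (n - d) →L[ℝ] Eu d) := by
    refine (hasMFDerivAt_const q.2 q.1).congr_of_eventuallyEq ?_
    filter_upwards [ψ.eventually_mk_mem_source hq] with u hu using hψ.2.2 _ hu
  exact congrArg (fun T : Eu (n - d) →L[ℝ] Eu d => T c) (hasMFDerivAt_unique h1 h2)

theorem fiberDeriv_eq (hψ : Γ.IsTargetTrivialization n ψ)
    {q : Eu (n - d) × M} (hq : q ∈ ψ.source) (c : Eu (n - d)) :
    fiberDeriv ψ q c = mfderiv ((𝓡 (n - d)).prod (𝓡 d)) (𝓡 n) ψ q ((c, 0) : Eu (n - d) × Eu d) := by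
  have h1 : HasMFDerivAt ((𝓡 (n - d)).prod (𝓡 d)) (𝓡 n) ψ (q.1, q.2) (mfderiv _ _ ψ q) :=
    ((hψ.contMDiffAt hq).mdifferentiableAt (by simp)).hasMFDerivAt
  have h2 := (hasMFDerivAt_id (I := 𝓡 (n - d)) q.1).prodMk
    (hasMFDerivAt_const (I := 𝓡 (n - d)) (I' := 𝓡 d) q.2 q.1)
  have h3 := hasMFDerivAt_unique (hψ.hasMFDerivAt_fiber hq) (h1.comp q.1 h2)
  exact congrArg (fun T : Eu (n - d) →L[ℝ] Eu n => T c) h3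

theorem injective_fiberDeriv (hψ : Γ.IsTargetTrivialization n ψ)
    {q : Eu (n - d) × M} (hq : q ∈ ψ.source) :
    Function.Injective (fiberDeriv ψ q) := by
  intro c c' h
  rw [hψ.fiberDeriv_eq hq, hψ.fiberDeriv_eq hq] at h
  have h1 := ψ.mfderiv_symm_comp (I := (𝓡 (n - d)).prod (𝓡 d)) (I' := 𝓡 n) hψ.1 hψ.2.1 hq
  have h2 := (h1 (c, 0)).symm.trans ((congrArg _ h).trans (h1 (c', 0)))
  exact congrArg (fun z : Eu (n - d) × Eu d => z.1) h2

/-- In the coordinates ψ the target map is the second projection, so the preimage of a vertical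
vector has the form (c, 0). -/
theorem exists_fiberDeriv_eq (hψ : Γ.IsTargetTrivialization n ψ)
    {q : Eu (n - d) × M} (hq : q ∈ ψ.source) {w : Eu n}
    (hw : Γ.ttgt (incl n (ψ q)) w = 0) : ∃ c, fiberDeriv ψ q c = w := by
  have h1 := ψ.mfderiv_comp_symm (I := (𝓡 (n - d)).prod (𝓡 d)) (I' := 𝓡 n) hψ.1 hψ.2.1 hq w
  obtain ⟨z, hz⟩ : ∃ z : Eu (n - d) × Eu d,
      z = mfderiv (𝓡 n) ((𝓡 (n - d)).prod (𝓡 d)) ψ.symm (ψ q) w := exists_eq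
  rw [← hz] at h1
  have h2 : HasMFDerivAt ((𝓡 (n - d)).prod (𝓡 d)) (𝓡 d)
      (fun q : Eu (n - d) × M => Γ.tgt (incl n (ψ q))) q
      (ContinuousLinearMap.snd ℝ (Eu (n - d)) (Eu d)) := by
    refine (hasMFDerivAt_snd q).congr_of_eventuallyEq ?_
    filter_upwards [ψ.open_source.mem_nhds hq] with u hu using hψ.2.2 _ hu
  have h3 := (Γ.hasMFDerivAt_tgt n (ψ q)).comp q
    ((hψ.contMDiffAt hq).mdifferentiableAt (by simp)).hasMFDerivAt
  have h4 := congrArg (fun T : Eu (n - d) × Eu d →L[ℝ] Eu d => T z) (hasMFDerivAt_unique h3 h2)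
  have h5 : Γ.ttgt (incl n (ψ q)) w = z.2 := by
    rw [← h1]; exact h4
  refine ⟨z.1, ?_⟩
  rw [hψ.fiberDeriv_eq hq, ← h1]
  congr 1
  exact Prod.ext rfl (by rw [← h5, hw])

end IsTargetTrivialization

end DiffGroupoid

/-! ### Measures on the target fibers in coordinates -/

namespace DiffGroupoid

variable {d : ℕ} {M : Type v} [TopologicalSpace M] [ChartedSpace (Eu d) M]
  [IsManifold (𝓡 d) ∞ M] {A : ℕ → Type u} [∀ n, TopologicalSpace (A n)]
  [∀ n, ChartedSpace (Eu n) (A n)] [∀ n, IsManifold (𝓡 n) ∞ (A n)]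
  {Γ : DiffGroupoid d M A}

/-- The coordinate expression of a density in a target trivialization. -/
def coordDensity (τ : ∀ g : MixedManifold A, (Fin (g.dim - d) → Eu g.dim) → ℝ) (n : ℕ)
    (ψ : OpenPartialHomeomorph (Eu (n - d) × M) (A n)) (q : Eu (n - d) × M) : ℝ :=
  τ (incl n (ψ q)) (coordFrame n ψ q)

theorem coordFrame_eq (n : ℕ) (ψ : OpenPartialHomeomorph (Eu (n - d) × M) (A n))
    (q : Eu (n - d) × M) (i : Fin (n - d)) :
    coordFrame n ψ q i = fiberDeriv ψ q (EuclideanSpace.single i 1) := rfl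

theorem IsTargetTrivialization.linearIndependent_coordFrame {n : ℕ}
    {ψ : OpenPartialHomeomorph (Eu (n - d) × M) (A n)} (hψ : Γ.IsTargetTrivialization n ψ)
    {q : Eu (n - d) × M} (hq : q ∈ ψ.source) : LinearIndependent ℝ (coordFrame n ψ q) := by
  have h1 := ((EuclideanSpace.basisFun (Fin (n - d)) ℝ).toBasis.linearIndependent).map'
    (fiberDeriv ψ q).toLinearMap (LinearMap.ker_eq_bot.2 (hψ.injective_fiberDeriv hq))
  have h2 : coordFrame n ψ q = (fiberDeriv ψ q).toLinearMap ∘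
      (EuclideanSpace.basisFun (Fin (n - d)) ℝ).toBasis := by
    ext1 i
    simp [coordFrame_eq]
  rw [h2]
  exact h1

theorem IsTargetTrivialization.ttgt_coordFrame {n : ℕ}
    {ψ : OpenPartialHomeomorph (Eu (n - d) × M) (A n)} (hψ : Γ.IsTargetTrivialization n ψ)
    {q : Eu (n - d) × M} (hq : q ∈ ψ.source) (i : Fin (n - d)) :
    Γ.ttgt (incl n (ψ q)) (coordFrame n ψ q i) = 0 :=
  hψ.ttgt_fiberDeriv hq _

variable (Γ) in
/-- A family of measures on the target fibers that is given by a volume density. -/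
structure IsFiberMeasure (τ : ∀ g : MixedManifold A, (Fin (g.dim - d) → Eu g.dim) → ℝ)
    (μ : M → Measure (MixedManifold A)) : Prop where
  isVolumeDensity : Γ.IsVolumeDensity τ
  carried : ∀ x, μ x {g | Γ.tgt g ≠ x} = 0
  formula : ∀ n (ψ : OpenPartialHomeomorph (Eu (n - d) × M) (A n)),
    Γ.IsTargetTrivialization n ψ →
      ∀ x (B : Set (MixedManifold A)), MeasurableSet B → B ⊆ incl n '' ψ.target →
        μ x B = ∫⁻ u in {u | (u, x) ∈ ψ.source ∧ incl n (ψ (u, x)) ∈ B},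
          ENNReal.ofReal (coordDensity τ n ψ (u, x))

theorem IsLeftHaarSystem.exists_isFiberMeasure {μ : M → Measure (MixedManifold A)}
    (h : Γ.IsLeftHaarSystem μ) : ∃ τ, Γ.IsFiberMeasure τ μ := by
  obtain ⟨τ, h1, h2⟩ := h.differentiable
  exact ⟨τ, h1, h.carried, h2⟩

theorem IsVolumeDensity.coordDensity_pos
    {τ : ∀ g : MixedManifold A, (Fin (g.dim - d) → Eu g.dim) → ℝ} (hτ : Γ.IsVolumeDensity τ)
    {n : ℕ} {ψ : OpenPartialHomeomorph (Eu (n - d) × M) (A n)}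
    (hψ : Γ.IsTargetTrivialization n ψ) {q : Eu (n - d) × M} (hq : q ∈ ψ.source) :
    0 < coordDensity τ n ψ q :=
  hτ.pos (incl n (ψ q)) _ (hψ.ttgt_coordFrame hq) (hψ.linearIndependent_coordFrame hq)

/-! ### Fiber parametrizations -/

/-- The domain of the parametrization of a piece of the target fiber over `x`. -/
def fiberDomain {n : ℕ} (ψ : OpenPartialHomeomorph (Eu (n - d) × M) (A n)) (x : M) :
    Set (Eu (n - d)) := {u | (u, x) ∈ ψ.source}

theorem isOpen_fiberDomain {n : ℕ} (ψ : OpenPartialHomeomorph (Eu (n - d) × M) (A n)) (x : M) :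
    IsOpen (fiberDomain ψ x) :=
  ψ.open_source.preimage (by fun_prop : Continuous fun u : Eu (n - d) => (u, x))

/-- The parametrization of a piece of the target fiber over `x`. -/
def fiberMap {n : ℕ} (ψ : OpenPartialHomeomorph (Eu (n - d) × M) (A n)) (x : M)
    (u : fiberDomain ψ x) : MixedManifold A := incl n (ψ (u.1, x))

theorem isEmbedding_fiberMap {n : ℕ} (ψ : OpenPartialHomeomorph (Eu (n - d) × M) (A n)) (x : M) :
    IsEmbedding (fiberMap ψ x) := by
  let j : fiberDomain ψ x → ψ.source := fun u => ⟨(u.1, x), u.2⟩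
  have hj : IsEmbedding j := by
    have hjc : Continuous j := by fun_prop
    refine IsEmbedding.of_comp hjc (continuous_fst.comp continuous_subtype_val) ?_
    exact IsEmbedding.subtypeVal
  exact ((isOpenEmbedding_incl n).comp ψ.isOpenEmbedding_restrict).isEmbedding.comp hj

theorem IsTargetTrivialization.range_fiberMap {n : ℕ}
    {ψ : OpenPartialHomeomorph (Eu (n - d) × M) (A n)}
    (hψ : Γ.IsTargetTrivialization n ψ) (x : M) :
    range (fiberMap ψ x) = incl n '' ψ.target ∩ Γ.tgt ⁻¹' {x} := by
  ext k
  constructor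
  · rintro ⟨u, rfl⟩
    exact ⟨⟨_, ψ.map_source u.2, rfl⟩, hψ.2.2 _ u.2⟩
  · rintro ⟨⟨a, ha, rfl⟩, hx⟩
    have h1 : ((ψ.symm a).1, x) = ψ.symm a := Prod.ext rfl (by rw [hψ.symm_snd ha]; exact hx.symm)
    refine ⟨⟨(ψ.symm a).1, ?_⟩, ?_⟩
    · show ((ψ.symm a).1, x) ∈ ψ.source
      rw [h1]; exact ψ.map_target ha
    · show incl n (ψ ((ψ.symm a).1, x)) = _
      rw [h1, ψ.right_inv ha]

theorem measurableSet_image_target {n : ℕ}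
    (ψ : OpenPartialHomeomorph (Eu (n - d) × M) (A n)) :
    MeasurableSet (incl n '' ψ.target : Set (MixedManifold A)) :=
  ((isOpenEmbedding_incl n).isOpenMap _ ψ.open_target).measurableSet

variable [T2Space M]

theorem isClosed_fiber (x : M) : IsClosed (Γ.tgt ⁻¹' {x}) :=
  isClosed_singleton.preimage Γ.continuous_tgt

theorem IsTargetTrivialization.measurableEmbedding_fiberMap {n : ℕ}
    {ψ : OpenPartialHomeomorph (Eu (n - d) × M) (A n)}
    (hψ : Γ.IsTargetTrivialization n ψ) (x : M) : MeasurableEmbedding (fiberMap ψ x) := by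
  refine (isEmbedding_fiberMap ψ x).measurableEmbedding ?_
  rw [hψ.range_fiberMap x]
  exact (measurableSet_image_target ψ).inter (isClosed_fiber x).measurableSet

theorem IsVolumeDensity.continuousOn_coordDensity
    {τ : ∀ g : MixedManifold A, (Fin (g.dim - d) → Eu g.dim) → ℝ} (hτ : Γ.IsVolumeDensity τ)
    {n : ℕ} {ψ : OpenPartialHomeomorph (Eu (n - d) × M) (A n)}
    (hψ : Γ.IsTargetTrivialization n ψ) : ContinuousOn (coordDensity τ n ψ) ψ.source :=
  (hτ.smooth n ψ hψ).continuousOn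

namespace IsFiberMeasure

variable {τ : ∀ g : MixedManifold A, (Fin (g.dim - d) → Eu g.dim) → ℝ}
  {μ : M → Measure (MixedManifold A)}

/-- Turns the formula for sets into a pushforward of weighted Lebesgue measure, from which
vector-valued integrals can be transported. The weight is put in `NNReal` form to suit the density
lemmas; positivity of the density makes the conversion harmless. -/
theorem restrict_eq (h : Γ.IsFiberMeasure τ μ) {n : ℕ}
    {ψ : OpenPartialHomeomorph (Eu (n - d) × M) (A n)}
    (hψ : Γ.IsTargetTrivialization n ψ) (x : M) :
    (μ x).restrict (incl n '' ψ.target) =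
      (((volume : Measure (Eu (n - d))).comap ((↑) : fiberDomain ψ x → Eu (n - d))).withDensity
        fun u => ((coordDensity τ n ψ (u.1, x)).toNNReal : ℝ≥0∞)).map (fiberMap ψ x) := by
  ext B hB
  have he := hψ.measurableEmbedding_fiberMap x
  rw [he.map_apply, withDensity_apply _ (he.measurable hB), Measure.restrict_apply hB,
    h.formula n ψ hψ x _ (hB.inter (measurableSet_image_target ψ)) inter_subset_right,
    setLIntegral_subtype (isOpen_fiberDomain ψ x).measurableSet (fiberMap ψ x ⁻¹' B)
      (fun u => ((coordDensity τ n ψ (u, x)).toNNReal : ℝ≥0∞))]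
  refine congrArg (fun s => ∫⁻ u in s, ENNReal.ofReal (coordDensity τ n ψ (u, x))) ?_
  ext u
  constructor
  · rintro ⟨hu, hB, -⟩
    exact ⟨⟨u, hu⟩, hB, rfl⟩
  · rintro ⟨⟨u, hu⟩, hB, rfl⟩
    exact ⟨hu, hB, ⟨_, ψ.map_source hu, rfl⟩⟩

theorem continuous_coordDensity_fiber (h : Γ.IsFiberMeasure τ μ) {n : ℕ}
    {ψ : OpenPartialHomeomorph (Eu (n - d) × M) (A n)}
    (hψ : Γ.IsTargetTrivialization n ψ) (x : M) :
    Continuous fun u : fiberDomain ψ x => coordDensity τ n ψ (u.1, x) := by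
  have := (h.isVolumeDensity.continuousOn_coordDensity hψ)
  exact this.comp_continuous (by fun_prop) fun u => u.2

variable {E : Type*} [NormedAddCommGroup E] [NormedSpace ℝ E]

theorem integrable_iff (h : Γ.IsFiberMeasure τ μ) {n : ℕ}
    {ψ : OpenPartialHomeomorph (Eu (n - d) × M) (A n)}
    (hψ : Γ.IsTargetTrivialization n ψ) (x : M) {f : MixedManifold A → E}
    (hf : ∀ k, k ∉ incl n '' ψ.target → f k = 0) :
    Integrable f (μ x) ↔ IntegrableOn
      (fun u => coordDensity τ n ψ (u, x) • f (incl n (ψ (u, x)))) (fiberDomain ψ x) := by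
  have he := hψ.measurableEmbedding_fiberMap x
  rw [← integrableOn_iff_integrable_of_support_subset (s := incl n '' ψ.target)
    (fun k hk => by_contra fun hk' => hk (hf k hk')), IntegrableOn, h.restrict_eq hψ x,
    he.integrable_map_iff, integrable_withDensity_iff_integrable_smul
      (h.continuous_coordDensity_fiber hψ x).measurable.real_toNNReal,
    integrableOn_iff_comap_subtypeVal (isOpen_fiberDomain ψ x).measurableSet]
  refine integrable_congr (Eventually.of_forall fun u => ?_)
  show (coordDensity τ n ψ (u.1, x)).toNNReal • _ = _
  rw [NNReal.smul_def, Real.coe_toNNReal _ (h.isVolumeDensity.coordDensity_pos hψ u.2).le]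
  rfl

theorem integral_eq (h : Γ.IsFiberMeasure τ μ) {n : ℕ}
    {ψ : OpenPartialHomeomorph (Eu (n - d) × M) (A n)}
    (hψ : Γ.IsTargetTrivialization n ψ) (x : M) {f : MixedManifold A → E}
    (hf : ∀ k, k ∉ incl n '' ψ.target → f k = 0) :
    ∫ k, f k ∂(μ x) = ∫ u in fiberDomain ψ x,
      coordDensity τ n ψ (u, x) • f (incl n (ψ (u, x))) := by
  have he := hψ.measurableEmbedding_fiberMap x
  rw [← setIntegral_eq_integral_of_forall_compl_eq_zero (s := incl n '' ψ.target) hf,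
    h.restrict_eq hψ x, he.integral_map, integral_withDensity_eq_integral_smul
      (h.continuous_coordDensity_fiber hψ x).measurable.real_toNNReal,
    ← integral_subtype_comap (isOpen_fiberDomain ψ x).measurableSet
      (fun u => coordDensity τ n ψ (u, x) • f (incl n (ψ (u, x))))]
  refine integral_congr_ae (Eventually.of_forall fun u => ?_)
  show (coordDensity τ n ψ (u.1, x)).toNNReal • _ = _
  rw [NNReal.smul_def, Real.coe_toNNReal _ (h.isVolumeDensity.coordDensity_pos hψ u.2).le]
  rfl

end IsFiberMeasure

end DiffGroupoid

/-! ### Regularity of integrals along the target fibers -/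

/-- Differentiability of parameter integrals over a fixed compact set. -/
theorem contDiffOn_integral_of_compact_support {P : Type*} [NormedAddCommGroup P] [NormedSpace ℝ P]
    {V : Type*} [NormedAddCommGroup V] [InnerProductSpace ℝ V] [FiniteDimensional ℝ V]
    [MeasurableSpace V] [BorelSpace V]
    {E : Type*} [NormedAddCommGroup E] [NormedSpace ℝ E] {p : ℕ∞} {W : Set P} (hW : IsOpen W)
    {K : Set V} (hK : IsCompact K) {G : P → V → E} (hG0 : ∀ a ∈ W, ∀ u, u ∉ K → G a u = 0)
    (hG : ContDiffOn ℝ p (fun z : P × V => G z.1 z.2) (W ×ˢ univ)) :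
    (∀ a ∈ W, Integrable (G a)) ∧ ContDiffOn ℝ p (fun a => ∫ u, G a u) W := by
  constructor
  · intro a ha
    have hc : Continuous (G a) := by
      have := hG.continuousOn.comp_continuous (f := fun u : V => (a, u)) (by fun_prop)
        (fun u => ⟨ha, trivial⟩)
      exact this
    exact hc.integrable_of_hasCompactSupport (HasCompactSupport.intro hK (hG0 a ha))
  · have h1 := contDiffOn_convolution_right_with_param (μ := (volume : Measure V))
      (f := fun _ : V => (1 : ℝ)) (n := p) (ContinuousLinearMap.lsmul ℝ ℝ) (g := G) hW hK
      (fun a u ha hu => hG0 a ha u hu) (locallyIntegrable_const 1) hG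
    have h2 : ContDiffOn ℝ p (fun a : P => (a, (0 : V))) W :=
      (contDiff_id.prodMk contDiff_const).contDiffOn
    refine (h1.comp h2 (fun a ha => ⟨ha, trivial⟩)).congr fun a ha => ?_
    simp only [Function.comp, convolution, zero_sub, ContinuousLinearMap.lsmul_apply, one_smul]
    exact (integral_neg_eq_self (G a) volume).symm

namespace DiffGroupoid

variable {d : ℕ} {M : Type v} [TopologicalSpace M] [ChartedSpace (Eu d) M]
  [IsManifold (𝓡 d) ∞ M] {A : ℕ → Type u} [∀ n, TopologicalSpace (A n)]
  [∀ n, ChartedSpace (Eu n) (A n)] [∀ n, IsManifold (𝓡 n) ∞ (A n)]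
  {Γ : DiffGroupoid d M A} [T2Space M]

variable {τ : ∀ g : MixedManifold A, (Fin (g.dim - d) → Eu g.dim) → ℝ}
  {μ : M → Measure (MixedManifold A)}
  {P : Type*} [NormedAddCommGroup P] [NormedSpace ℝ P]
  {E : Type*} [NormedAddCommGroup E] [NormedSpace ℝ E]

variable (Γ) in
/-- Smoothness of class `C^p` along the target fibers and in the parameter. -/
def FiberSmooth (p : ℕ∞) (W : Set P) (σ : P → M) (f : P → MixedManifold A → E) : Prop :=
  ∀ n (ψ : OpenPartialHomeomorph (Eu (n - d) × M) (A n)), Γ.IsTargetTrivialization n ψ →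
    ContDiffOn ℝ p (fun z : P × Eu (n - d) => f z.1 (incl n (ψ (z.2, σ z.1))))
      {z | z.1 ∈ W ∧ (z.2, σ z.1) ∈ ψ.source}

/-- In the trivialization the integral becomes a Lebesgue integral over a compact set that does not
depend on the parameter, although the domain of the fiber coordinates does. -/
theorem IsFiberMeasure.integral_of_chart_support (h : Γ.IsFiberMeasure τ μ) {p : ℕ∞} {W : Set P}
    (hW : IsOpen W) {σ : P → M} (hσ : ContMDiffOn 𝓘(ℝ, P) (𝓡 d) ∞ σ W)
    {f : P → MixedManifold A → E} (hf : Γ.FiberSmooth p W σ f) {n : ℕ}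
    {ψ : OpenPartialHomeomorph (Eu (n - d) × M) (A n)}
    (hψ : Γ.IsTargetTrivialization n ψ) {C : Set (A n)} (hC : IsCompact C) (hCψ : C ⊆ ψ.target)
    (hfC : ∀ a ∈ W, ∀ k, f a k ≠ 0 → k ∈ incl n '' C) :
    (∀ a ∈ W, Integrable (f a) (μ (σ a))) ∧ ContDiffOn ℝ p (fun a => ∫ k, f a k ∂(μ (σ a))) W := by
  classical
  let C' : Set (Eu (n - d) × M) := ψ.symm '' C
  have hC' : IsCompact C' := hC.image_of_continuousOn (ψ.continuousOn_symm.mono hCψ)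
  -- Extension by zero outside the fiber domain. It stays of class C^p because it vanishes off the
  -- compact, hence closed, set `C'`, which lies inside `ψ.source`.
  let G : P → Eu (n - d) → E := fun a u =>
    if (u, σ a) ∈ ψ.source then coordDensity τ n ψ (u, σ a) • f a (incl n (ψ (u, σ a))) else 0
  have hG0 : ∀ a ∈ W, ∀ u, (u, σ a) ∉ C' → G a u = 0 := by
    intro a ha u hu
    by_cases hs : (u, σ a) ∈ ψ.source
    · have : f a (incl n (ψ (u, σ a))) = 0 := by
        by_contra hne
        obtain ⟨c, hc, hce⟩ := hfC a ha _ hne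
        obtain rfl : c = ψ (u, σ a) := (isOpenEmbedding_incl n).injective hce
        exact hu ⟨_, hc, ψ.left_inv hs⟩
      simp [G, this]
    · simp [G, hs]
  have hsupp : ∀ a ∈ W, ∀ k, k ∉ incl n '' ψ.target → f a k = 0 := by
    intro a ha k hk
    by_contra hne
    exact hk (image_mono hCψ (hfC a ha k hne))
  have hcont : ContinuousOn (fun z : P × Eu (n - d) => (z.2, σ z.1)) (W ×ˢ univ) :=
    continuousOn_snd.prodMk (hσ.continuousOn.comp continuousOn_fst fun z hz => hz.1)
  have hWu : IsOpen (W ×ˢ (univ : Set (Eu (n - d)))) := hW.prod isOpen_univ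
  have hGs : ContDiffOn ℝ p (fun z : P × Eu (n - d) => G z.1 z.2) (W ×ˢ univ) := by
    rintro ⟨a, u⟩ ⟨ha, -⟩
    refine ContDiffAt.contDiffWithinAt ?_
    have hca : ContinuousAt (fun z : P × Eu (n - d) => (z.2, σ z.1)) (a, u) :=
      hcont.continuousAt (hWu.mem_nhds ⟨ha, trivial⟩)
    have hWn : ∀ᶠ z : P × Eu (n - d) in 𝓝 (a, u), z.1 ∈ W :=
      continuous_fst.continuousAt (hW.mem_nhds ha)
    by_cases hs : (u, σ a) ∈ ψ.source
    · have hsn : ∀ᶠ z : P × Eu (n - d) in 𝓝 (a, u), (z.2, σ z.1) ∈ ψ.source :=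
        hca (ψ.open_source.mem_nhds hs)
      have k1 : ContDiffAt ℝ p (fun z : P × Eu (n - d) => f z.1 (incl n (ψ (z.2, σ z.1))))
          (a, u) := by
        refine (hf n ψ hψ).contDiffAt ?_
        filter_upwards [hWn, hsn] with z h1 h2 using ⟨h1, h2⟩
      have k2 : ContDiffAt ℝ p (fun z : P × Eu (n - d) => coordDensity τ n ψ (z.2, σ z.1))
          (a, u) := by
        have e1 : ContMDiffAt ((𝓡 (n - d)).prod (𝓡 d)) 𝓘(ℝ, ℝ) ∞ (coordDensity τ n ψ) (u, σ a) :=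
          (h.isVolumeDensity.smooth n ψ hψ).contMDiffAt (ψ.open_source.mem_nhds hs)
        have e2 : ContMDiffAt 𝓘(ℝ, P × Eu (n - d)) (𝓡 d) ∞
            (fun z : P × Eu (n - d) => σ z.1) (a, u) :=
          (hσ.contMDiffAt (hW.mem_nhds ha)).comp (a, u) contDiff_fst.contMDiff.contMDiffAt
        have e3 : ContMDiffAt 𝓘(ℝ, P × Eu (n - d)) (𝓡 (n - d)) ∞
            (fun z : P × Eu (n - d) => z.2) (a, u) := contDiff_snd.contMDiff.contMDiffAt
        have e4 := (e1.comp (a, u) (e3.prodMk e2)).contDiffAt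
        exact e4.of_le (by exact_mod_cast le_top)
      refine (k2.smul k1).congr_of_eventuallyEq ?_
      filter_upwards [hsn] with z hz
      simp [G, hz]
    · have hn : (u, σ a) ∉ C' := by
        rintro ⟨c, hc, e⟩
        exact hs (e ▸ ψ.map_target (hCψ hc))
      refine contDiffAt_const (c := (0 : E)) |>.congr_of_eventuallyEq ?_
      filter_upwards [hWn, hca (hC'.isClosed.isOpen_compl.mem_nhds hn)] with z h1 h2
      exact hG0 _ h1 _ h2
  -- The parameter-independent compact set is the projection of `C'` to the fiber coordinates.
  obtain ⟨r1, r2⟩ := contDiffOn_integral_of_compact_support hW (hC'.image continuous_fst)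
    (G := G) (fun a ha u hu => hG0 a ha u fun hc => hu ⟨_, hc, rfl⟩) hGs
  have hGind : ∀ a, G a = (fiberDomain ψ (σ a)).indicator
      fun u => coordDensity τ n ψ (u, σ a) • f a (incl n (ψ (u, σ a))) := by
    intro a
    ext u
    by_cases hs : (u, σ a) ∈ ψ.source
    · simp [G, hs, fiberDomain]
    · simp [G, hs, fiberDomain]
  constructor
  · intro a ha
    rw [h.integrable_iff hψ _ (hsupp a ha),
      ← integrable_indicator_iff (isOpen_fiberDomain ψ _).measurableSet, ← hGind]
    exact r1 a ha
  · refine r2.congr fun a ha => ?_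
    rw [h.integral_eq hψ _ (hsupp a ha), hGind,
      integral_indicator (isOpen_fiberDomain ψ _).measurableSet]

variable (Γ) in
/-- A smooth cut-off function with compact support in the image of a target trivialization. -/
structure IsCutoff (b : MixedManifold A → ℝ) : Prop where
  smooth : ∀ n, ContMDiff (𝓡 n) 𝓘(ℝ, ℝ) ∞ fun a : A n => b (incl n a)
  support : ∃ (n : ℕ) (ψ : OpenPartialHomeomorph (Eu (n - d) × M) (A n)) (C : Set (A n)),
    Γ.IsTargetTrivialization n ψ ∧ IsCompact C ∧ C ⊆ ψ.target ∧ ∀ k, b k ≠ 0 → k ∈ incl n '' C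

theorem exists_isCutoff [T2Space (MixedManifold A)] (Γ : DiffGroupoid d M A)
    (k : MixedManifold A) : ∃ b, Γ.IsCutoff b ∧ ∀ᶠ k' in 𝓝 k, b k' = 1 := by
  classical
  obtain ⟨ψ, hψ, hk⟩ := Γ.exists_targetTrivialization k.pt
  have : T2Space (A k.dim) := (isOpenEmbedding_incl k.dim).isEmbedding.t2Space
  obtain ⟨f, -, hf⟩ := (SmoothBumpFunction.nhds_basis_tsupport (I := 𝓡 k.dim) k.pt).mem_iff.1
    (ψ.open_target.mem_nhds hk)
  let b : MixedManifold A → ℝ := fun x => if x.dim = k.dim then f (part k x) else 0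
  have hb : ∀ a : A k.dim, b (incl k.dim a) = f a := fun a => by
    simp only [b, if_true]
    exact congrArg f (part_eq rfl)
  refine ⟨b, ⟨fun n => ?_, k.dim, ψ, tsupport f, hψ, f.hasCompactSupport, hf, ?_⟩, ?_⟩
  · by_cases hn : n = k.dim
    · subst hn
      simp only [hb]
      exact f.contMDiff
    · have : (fun a : A n => b (incl n a)) = fun _ => 0 := by
        ext a; simp [b, hn]
      rw [this]; exact contMDiff_const
  · intro x hx
    by_cases hn : x.dim = k.dim
    · obtain ⟨n, a⟩ := x
      obtain rfl : n = k.dim := hn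
      rw [show (⟨_, a⟩ : MixedManifold A) = incl k.dim a from rfl, hb] at hx
      exact ⟨a, subset_tsupport f hx, rfl⟩
    · simp [b, hn] at hx
  · have : 𝓝 k = map (incl k.dim) (𝓝 k.pt) := nhds_incl k.dim k.pt
    rw [this, eventually_map]
    filter_upwards [f.eventuallyEq_one] with a ha
    rw [hb, ha]; rfl

theorem fiberSmooth_of_contMDiff {b : MixedManifold A → ℝ}
    (hb : ∀ n, ContMDiff (𝓡 n) 𝓘(ℝ, ℝ) ∞ fun a : A n => b (incl n a)) (p : ℕ∞) {W : Set P}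
    (hW : IsOpen W) {σ : P → M} (hσ : ContMDiffOn 𝓘(ℝ, P) (𝓡 d) ∞ σ W) :
    Γ.FiberSmooth p W σ (fun _ => b) := by

  rintro n ψ hψ ⟨a, u⟩ ⟨ha, hs⟩
  have e2 : ContMDiffAt 𝓘(ℝ, P × Eu (n - d)) (𝓡 d) ∞
      (fun z : P × Eu (n - d) => σ z.1) (a, u) :=
    (hσ.contMDiffAt (hW.mem_nhds ha)).comp (a, u) contDiff_fst.contMDiff.contMDiffAt
  have e3 : ContMDiffAt 𝓘(ℝ, P × Eu (n - d)) (𝓡 (n - d)) ∞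
      (fun z : P × Eu (n - d) => z.2) (a, u) := contDiff_snd.contMDiff.contMDiffAt
  have e4 := ((hb n).contMDiffAt.comp (a, u)
    ((hψ.contMDiffAt hs).comp (a, u) (e3.prodMk e2))).contDiffAt
  exact (e4.of_le (by exact_mod_cast le_top)).contDiffWithinAt

theorem FiberSmooth.smul {p : ℕ∞} {W : Set P} {σ : P → M} {b : P → MixedManifold A → ℝ}
    {f : P → MixedManifold A → E} (hb : Γ.FiberSmooth p W σ b) (hf : Γ.FiberSmooth p W σ f) :
    Γ.FiberSmooth p W σ fun a k => b a k • f a k :=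
  fun n ψ hψ => (hb n ψ hψ).smul (hf n ψ hψ)

theorem FiberSmooth.sub {p : ℕ∞} {W : Set P} {σ : P → M}
    {f g : P → MixedManifold A → E} (hf : Γ.FiberSmooth p W σ f) (hg : Γ.FiberSmooth p W σ g) :
    Γ.FiberSmooth p W σ fun a k => f a k - g a k :=
  fun n ψ hψ => (hf n ψ hψ).sub (hg n ψ hψ)

/-- Integration along the target fibers preserves regularity. -/
theorem IsFiberMeasure.integral_of_compact_support [T2Space (MixedManifold A)]
    (h : Γ.IsFiberMeasure τ μ) {p : ℕ∞} {W : Set P}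
    (hW : IsOpen W) {σ : P → M} (hσ : ContMDiffOn 𝓘(ℝ, P) (𝓡 d) ∞ σ W)
    {f : P → MixedManifold A → E} (hf : Γ.FiberSmooth p W σ f) {Z : Set (MixedManifold A)}
    (hZ : IsCompact Z) (hfZ : ∀ a ∈ W, ∀ k, f a k ≠ 0 → k ∈ Z) :
    (∀ a ∈ W, Integrable (f a) (μ (σ a))) ∧ ContDiffOn ℝ p (fun a => ∫ k, f a k ∂(μ (σ a))) W := by
  choose b hb hb1 using Γ.exists_isCutoff
  obtain ⟨t, -, ht⟩ := hZ.elim_nhds_subcover (fun k => {k' | b k k' = 1}) fun k _ => hb1 k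
  -- Induction on the number of cutoffs replaces a partition of unity: `b i • f` lives in one chart,
  -- and f - b_i f vanishes where `b i` is 1, so the remaining cutoffs handle it.
  have key : ∀ (t : Finset (MixedManifold A)) (f : P → MixedManifold A → E),
      Γ.FiberSmooth p W σ f → (∀ a ∈ W, ∀ k, f a k ≠ 0 → ∃ i ∈ t, b i k = 1) →
      (∀ a ∈ W, Integrable (f a) (μ (σ a))) ∧
        ContDiffOn ℝ p (fun a => ∫ k, f a k ∂(μ (σ a))) W := by
    intro t
    induction t using Finset.cons_induction with
    | empty =>
      intro f _ hf0
      have : ∀ a ∈ W, f a = 0 := fun a ha => by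
        ext k; by_contra hne; simpa using hf0 a ha k hne
      refine ⟨fun a ha => by rw [this a ha]; exact integrable_zero _ _ _, ?_⟩
      exact (contDiffOn_const (c := (0 : E))).congr fun a ha => by simp [this a ha]
    | cons i t hi ih =>
      intro f hf hf0
      have hs := (fiberSmooth_of_contMDiff (hb i).smooth p hW hσ).smul hf
      obtain ⟨n, ψ, C, hψ, hC, hCψ, hbC⟩ := (hb i).support
      obtain ⟨r1, r2⟩ := h.integral_of_chart_support hW hσ hs hψ hC hCψ
        (fun a ha k hk => hbC k fun hz => hk (by simp [hz]))
      obtain ⟨s1, s2⟩ := ih (fun a k => f a k - b i k • f a k) (hf.sub hs) (by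
        intro a ha k hk
        obtain ⟨j, hj, hjk⟩ := hf0 a ha k fun hz => hk (by simp [hz])
        rcases Finset.mem_cons.1 hj with rfl | hj
        · simp [hjk] at hk
        · exact ⟨j, hj, hjk⟩)
      have e : ∀ a k, b i k • f a k + (f a k - b i k • f a k) = f a k := fun a k => by abel
      constructor
      · intro a ha
        have := (r1 a ha).add (s1 a ha)
        refine this.congr (Eventually.of_forall fun k => e a k)
      · refine (r2.add s2).congr fun a ha => ?_
        rw [← integral_add (r1 a ha) (s1 a ha)]
        simp only [e]
  refine key t f hf fun a ha k hk => ?_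
  simpa using ht (hfZ a ha k hk)

theorem FiberSmooth.mono {p : ℕ∞} {W W' : Set P} {σ : P → M} {f : P → MixedManifold A → E}
    (hf : Γ.FiberSmooth p W σ f) (h : W' ⊆ W) : Γ.FiberSmooth p W' σ f :=
  fun n ψ hψ => (hf n ψ hψ).mono fun _ hz => ⟨h hz.1, hz.2⟩

variable (Γ) in
/-- The support of `c ∘ s` meets the preimages of compact sets under `t` in compact sets. -/
def ProperlySupported (c : M → ℝ) : Prop := ∀ K : Set M, IsCompact K →
    IsCompact (tsupport (fun g => c (Γ.src g)) ∩ Γ.tgt ⁻¹' K)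

/-- Both conclusions are local in the parameter. Near `a₀` the base points `σ a` stay in a compact
`K`, and the part of the support over `K` is compact. -/
theorem IsFiberMeasure.integral_of_properlySupported [T2Space (MixedManifold A)]
    (h : Γ.IsFiberMeasure τ μ) {p : ℕ∞} {W : Set P}
    (hW : IsOpen W) {σ : P → M} (hσ : ContMDiffOn 𝓘(ℝ, P) (𝓡 d) ∞ σ W)
    {f : P → MixedManifold A → E} (hf : Γ.FiberSmooth p W σ f) {c : M → ℝ}
    (hc : ContMDiff (𝓡 d) 𝓘(ℝ, ℝ) ∞ c) (hcs : Γ.ProperlySupported c) :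
    (∀ a ∈ W, Integrable (fun k => c (Γ.src k) • f a k) (μ (σ a))) ∧
      ContDiffOn ℝ p (fun a => ∫ k, c (Γ.src k) • f a k ∂(μ (σ a))) W := by
  classical
  have : LocallyCompactSpace M := ChartedSpace.locallyCompactSpace (Eu d) M
  -- Setting the integrand to zero off the fiber over `σ a` changes it on a null set only, and
  -- nothing in the fiber charts; it confines the pointwise support to the preimage of `K`.
  let F : P → MixedManifold A → E := fun a k =>
    if Γ.tgt k = σ a then c (Γ.src k) • f a k else 0
  have hF : Γ.FiberSmooth p W σ F := by
    intro n ψ hψ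
    have h1 := (fiberSmooth_of_contMDiff (Γ := Γ) (b := fun k => c (Γ.src k))
      (fun n => hc.comp (Γ.smooth_src n)) p hW hσ).smul hf
    refine (h1 n ψ hψ).congr fun z hz => ?_
    simp [F, hψ.2.2 _ hz.2]
  have hFe : ∀ a, F a =ᵐ[μ (σ a)] fun k => c (Γ.src k) • f a k := by
    intro a
    rw [Filter.EventuallyEq, ae_iff]
    refine measure_mono_null (fun k hk => ?_) (h.carried (σ a))
    intro hk'
    exact hk (by simp [F, hk'])
  have key : ∀ a₀ ∈ W, ∃ W' ⊆ W, IsOpen W' ∧ a₀ ∈ W' ∧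
      (∀ a ∈ W', Integrable (F a) (μ (σ a))) ∧
        ContDiffOn ℝ p (fun a => ∫ k, F a k ∂(μ (σ a))) W' := by
    intro a₀ ha₀
    obtain ⟨K, hK, hKn⟩ := exists_compact_mem_nhds (σ a₀)
    obtain ⟨O, hOK, hO, hσO⟩ := mem_nhds_iff.1 hKn
    have hW' := hσ.continuousOn.isOpen_inter_preimage hW hO
    refine ⟨W ∩ σ ⁻¹' O, inter_subset_left, hW', ⟨ha₀, hσO⟩, ?_⟩
    refine h.integral_of_compact_support hW' (hσ.mono inter_subset_left)
      (hF.mono inter_subset_left) (hcs K hK) ?_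
    rintro a ⟨ha, haO⟩ k hk
    by_cases hkt : Γ.tgt k = σ a
    · refine ⟨subset_tsupport _ fun hz => hk ?_, ?_⟩
      · simp [F, show c (Γ.src k) = 0 from hz]
      · show Γ.tgt k ∈ K
        rw [hkt]; exact hOK haO
    · simp [F, hkt] at hk
  constructor
  · intro a ha
    obtain ⟨W', -, -, h1, h2, -⟩ := key a ha
    exact (h2 a h1).congr (hFe a)
  · intro a ha
    obtain ⟨W', h0, h1, h2, -, h3⟩ := key a ha
    refine ((h3.contDiffAt (h1.mem_nhds h2)).congr_of_eventuallyEq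
      (Eventually.of_forall fun a => ?_)).contDiffWithinAt
    exact (integral_congr_ae (hFe a)).symm

end DiffGroupoid

/-! ### Tangent maps in charts -/

section Coordinates

variable {n : ℕ} {X : Type*} [TopologicalSpace X] [ChartedSpace (Eu n) X] [IsManifold (𝓡 n) ∞ X]

/-- The derivative of a vector-valued function on a manifold. -/
def mderiv {m : ℕ} (T : X → Eu m) (x : X) : Eu n →L[ℝ] Eu m := mfderiv (𝓡 n) (𝓡 m) T x

/-- The derivative at `x` of the preferred chart at `c`. -/
def chartDeriv (c x : X) : Eu n →L[ℝ] Eu n := mfderiv (𝓡 n) (𝓡 n) (extChartAt (𝓡 n) c) x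

/-- The inverse of the derivative at `x` of the preferred chart at `c`. -/
def chartDerivInv (c x : X) : Eu n →L[ℝ] Eu n :=
  mfderivWithin (𝓡 n) (𝓡 n) (extChartAt (𝓡 n) c).symm (range (𝓡 n)) (extChartAt (𝓡 n) c x)

theorem hasMFDerivAt_chart {c x : X} (h : x ∈ (chartAt (Eu n) c).source) :
    HasMFDerivAt (𝓡 n) (𝓡 n) (extChartAt (𝓡 n) c) x (chartDeriv c x) :=
  haveI : IsManifold (𝓡 n) 1 X := IsManifold.of_le (n := ∞) (by simp)
  (mdifferentiableAt_extChartAt h).hasMFDerivAt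

theorem chartDerivInv_comp_chartDeriv {c x : X} (h : x ∈ (chartAt (Eu n) c).source) :
    (chartDerivInv c x).comp (chartDeriv c x) = ContinuousLinearMap.id ℝ (Eu n) :=
  haveI : IsManifold (𝓡 n) 1 X := IsManifold.of_le (n := ∞) (by simp)
  mfderivWithin_extChartAt_symm_comp_mfderiv_extChartAt' (by simpa using h)

theorem chartDeriv_comp_chartDerivInv {c x : X} (h : x ∈ (chartAt (Eu n) c).source) :
    (chartDeriv c x).comp (chartDerivInv c x) = ContinuousLinearMap.id ℝ (Eu n) :=
  haveI : IsManifold (𝓡 n) 1 X := IsManifold.of_le (n := ∞) (by simp)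
  mfderiv_extChartAt_comp_mfderivWithin_extChartAt_symm' (by simpa using h)

theorem isInvertible_chartDeriv {c x : X} (h : x ∈ (chartAt (Eu n) c).source) :
    (chartDeriv (n := n) c x).IsInvertible :=
  ContinuousLinearMap.IsInvertible.of_inverse (chartDeriv_comp_chartDerivInv h)
    (chartDerivInv_comp_chartDeriv h)

theorem isInvertible_chartDerivInv {c x : X} (h : x ∈ (chartAt (Eu n) c).source) :
    (chartDerivInv (n := n) c x).IsInvertible :=
  ContinuousLinearMap.IsInvertible.of_inverse (chartDerivInv_comp_chartDeriv h)
    (chartDeriv_comp_chartDerivInv h)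

theorem inverse_chartDeriv {c x : X} (h : x ∈ (chartAt (Eu n) c).source) :
    (chartDeriv (n := n) c x).inverse = chartDerivInv c x :=
  ContinuousLinearMap.inverse_eq (chartDeriv_comp_chartDerivInv h)
    (chartDerivInv_comp_chartDeriv h)

theorem chartDeriv_self (c : X) : chartDeriv c c = ContinuousLinearMap.id ℝ (Eu n) :=
  haveI : IsManifold (𝓡 n) 1 X := IsManifold.of_le (n := ∞) (by simp)
  mfderiv_extChartAt_self

theorem chartDerivInv_self (c : X) : chartDerivInv c c = ContinuousLinearMap.id ℝ (Eu n) := by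
  have := chartDerivInv_comp_chartDeriv (mem_chart_source (Eu n) c)
  rwa [chartDeriv_self] at this

variable {d : ℕ} {M : Type*} [TopologicalSpace M] [ChartedSpace (Eu d) M] [IsManifold (𝓡 d) ∞ M]

theorem inTangentCoordinates_eq_chartDeriv {N : Type*} {f : N → M} {g : N → X}
    {ξ : N → Eu d →L[ℝ] Eu n} {x₀ x : N}
    (hf : f x ∈ (chartAt (Eu d) (f x₀)).source) (hg : g x ∈ (chartAt (Eu n) (g x₀)).source) :
    inTangentCoordinates (𝓡 d) (𝓡 n) f g ξ x₀ x =
      (chartDeriv (g x₀) (g x)).comp ((ξ x).comp (chartDerivInv (f x₀) (f x))) :=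
  haveI : IsManifold (𝓡 n) 1 X := IsManifold.of_le (n := ∞) (by simp)
  haveI : IsManifold (𝓡 d) 1 M := IsManifold.of_le (n := ∞) (by simp)
  inTangentCoordinates_eq_mfderiv_comp hf hg

/-- Differentiating `T` costs one order, which a C^∞ map can afford, so the class `p` of ξ survives.
The chart derivatives at `g x` from the two factors cancel, leaving only the frame at `f x`. -/
theorem contMDiffAt_mfderiv_comp {E : Type*} [NormedAddCommGroup E] [NormedSpace ℝ E]
    {H : Type*} [TopologicalSpace H] {I : ModelWithCorners ℝ E H} {N : Type*} [TopologicalSpace N]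
    [ChartedSpace H N] [IsManifold I 1 N] {p : ℕ∞} {f : N → M} {g : N → X}
    {ξ : N → Eu d →L[ℝ] Eu n} {x₀ : N} (hf : ContinuousAt f x₀)
    (hg : ContMDiffAt I (𝓡 n) p g x₀)
    (hξ : ContMDiffAt I 𝓘(ℝ, Eu d →L[ℝ] Eu n) p
      (inTangentCoordinates (𝓡 d) (𝓡 n) f g ξ x₀) x₀) {m : ℕ} {T : N → X → Eu m}
    (hT : ContMDiffAt (I.prod (𝓡 n)) (𝓡 m) ∞ (Function.uncurry T) (x₀, g x₀)) :
    ContMDiffAt I 𝓘(ℝ, Eu d →L[ℝ] Eu m) p (fun x =>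
      (mderiv (T x) (g x)).comp
        ((ξ x).comp (chartDerivInv (f x₀) (f x)))) x₀ := by
  have : IsManifold (𝓡 n) 1 X := IsManifold.of_le (n := ∞) (by simp)
  have hp : (p : ℕ∞ω) + 1 ≤ (∞ : ℕ∞ω) := by
    exact_mod_cast (le_top : p + 1 ≤ ⊤)
  have h1 : ContMDiffAt I 𝓘(ℝ, Eu n →L[ℝ] Eu m) p (inTangentCoordinates (𝓡 n) (𝓡 m) g
      (fun x => T x (g x)) (fun x => mderiv (T x) (g x)) x₀) x₀ :=
    ContMDiffAt.mfderiv T g hT hg hp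
  refine (h1.clm_comp hξ).congr_of_eventuallyEq ?_
  filter_upwards [hf ((chartAt (Eu d) (f x₀)).open_source.mem_nhds (mem_chart_source _ _)),
    hg.continuousAt ((chartAt (Eu n) (g x₀)).open_source.mem_nhds (mem_chart_source _ _))]
    with x hx1 hx2
  rw [inTangentCoordinates_eq_chartDeriv hx1 hx2, inTangentCoordinates_eq_chartDeriv hx2
    (mem_univ _)]
  have e : (chartDeriv (T x₀ (g x₀)) (T x (g x))) = ContinuousLinearMap.id ℝ (Eu m) := by
    unfold chartDeriv
    rw [extChartAt_model_space_eq_id]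
    exact mfderiv_id
  rw [e, ContinuousLinearMap.id_comp]
  ext1 v
  have := congrArg (fun T : Eu n →L[ℝ] Eu n => T ((ξ x) (chartDerivInv (f x₀) (f x) v)))
    (chartDerivInv_comp_chartDeriv hx2)
  exact (congrArg (mderiv (T x) (g x)) this).symm

end Coordinates

/-! ### Regularity of the difference cocycle -/

namespace DiffGroupoid

variable {d : ℕ} {M : Type v} [TopologicalSpace M] [ChartedSpace (Eu d) M]
  [IsManifold (𝓡 d) ∞ M] {A : ℕ → Type u} [∀ n, TopologicalSpace (A n)]
  [∀ n, ChartedSpace (Eu n) (A n)] [∀ n, IsManifold (𝓡 n) ∞ (A n)]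
  {Γ : DiffGroupoid d M A}

theorem exists_div_rep (Γ : DiffGroupoid d M A) {m n n' : ℕ} {b : A m} {k : A n'} {a : A n}
    (h : Γ.src (incl m b) = Γ.src (incl n' k))
    (e : Γ.mul (incl m b) (Γ.inv (incl n' k)) = incl n a) :
    ∃ (F : A m × A n' → A n) (U : Set (A m × A n')), IsOpen U ∧ (b, k) ∈ U ∧
      ContMDiffOn ((𝓡 m).prod (𝓡 n')) (𝓡 n) ∞ F U ∧ F (b, k) = a ∧
      ∀ q ∈ U, Γ.src (incl m q.1) = Γ.src (incl n' q.2) →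
        Γ.mul (incl m q.1) (Γ.inv (incl n' q.2)) = incl n (F q) := by
  obtain ⟨J, U₁, hU₁, hk, hJ, hJ0, hJ1⟩ := Γ.exists_inv_rep (a := k)
    (b := (Γ.inv (incl n' k)).pt) rfl
  obtain ⟨F, U₂, hU₂, hF, hFs, hF0, hF1⟩ := Γ.exists_mul_rep (a' := b)
    (a := (Γ.inv (incl n' k)).pt) (b := a) (by rw [h]; exact (Γ.tgt_inv _).symm) e
  have hJs : ContMDiffOn ((𝓡 m).prod (𝓡 n')) ((𝓡 m).prod (𝓡 _)) ∞
      (fun q : A m × A n' => (q.1, J q.2)) (univ ×ˢ U₁) :=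
    contMDiffOn_fst.prodMk (hJ.comp contMDiffOn_snd fun q hq => hq.2)
  refine ⟨fun q => F (q.1, J q.2), univ ×ˢ U₁ ∩ (fun q : A m × A n' => (q.1, J q.2)) ⁻¹' U₂,
    hJs.continuousOn.isOpen_inter_preimage (isOpen_univ.prod hU₁) hU₂, ⟨⟨trivial, hk⟩, ?_⟩,
    hFs.comp (hJs.mono inter_subset_left) fun q hq => hq.2, ?_, ?_⟩
  · show (b, J k) ∈ U₂
    rw [hJ0]; exact hF
  · simp only [hJ0, hF0]
  · rintro q ⟨⟨-, h1⟩, h2⟩ hq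
    rw [hJ1 _ h1]
    refine hF1 _ h2 ?_
    rw [← hJ1 _ h1, Γ.tgt_inv]; exact hq

namespace Connection

variable {p : ℕ∞} {Φ : Γ.Connection p}

/-- A pair of lifts of one vector is tangent to pairs of arrows with a common source, where `F` is
division. The derivative within a subset is thereby replaced by ordinary partial derivatives of the
extension `F`, whose dependence on the arrows is visibly smooth. -/
theorem chartDeriv_quot {m n n' : ℕ} (a₀ : A n) {F : A m × A n' → A n} {U : Set (A m × A n')}
    (hU : IsOpen U) (hF : ContMDiffOn ((𝓡 m).prod (𝓡 n')) (𝓡 n) ∞ F U)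
    (hF1 : ∀ q ∈ U, Γ.src (incl m q.1) = Γ.src (incl n' q.2) →
        Γ.mul (incl m q.1) (Γ.inv (incl n' q.2)) = incl n (F q)) {b : A m} {k : A n'}
    (hbk : (b, k) ∈ U) (h : Γ.src (incl m b) = Γ.src (incl n' k))
    (hc : F (b, k) ∈ (chartAt (Eu n) a₀).source) (v : Eu d) :
    chartDeriv a₀ (F (b, k)) (Φ.quot (incl m b) (incl n' k) (incl n (F (b, k))) v) =
      mderiv (fun b' => extChartAt (𝓡 n) a₀ (F (b', k))) b
        (Φ.lift (incl m b) v) +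
      mderiv (fun k' => extChartAt (𝓡 n) a₀ (F (b, k'))) k
        (Φ.lift (incl n' k) v) := by
  obtain ⟨σ, hσ, hσs⟩ := Φ.exists_section (incl m b)
  obtain ⟨τ, hτ, hτs⟩ := Φ.exists_section (incl n' k)
  have hq := hasTDeriv_quot h (hF1 _ hbk h) hσ hσs hτ hτs
  rw [← h] at hτ hτs
  obtain ⟨f, hf0, hf1, hf2⟩ := hσ.exists_rep
  obtain ⟨g, hg0, hg1, hg2⟩ := hτ.exists_rep
  obtain ⟨r, hr0, hr1, hr2⟩ := hq.exists_rep
  change f _ = b at hf0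
  change g _ = k at hg0
  change r _ = F (b, k) at hr0
  set x := Γ.src (incl m b)
  have hfg : HasMFDerivAt (𝓡 d) ((𝓡 m).prod (𝓡 n')) (fun x => (f x, g x)) x
      ((Φ.lift (incl m b)).prod (Φ.lift (incl n' k))) := hf2.prodMk hg2
  have hT : HasMFDerivAt ((𝓡 m).prod (𝓡 n')) (𝓡 n) (fun q => extChartAt (𝓡 n) a₀ (F q)) (b, k)
      (mfderiv ((𝓡 m).prod (𝓡 n')) (𝓡 n) (fun q => extChartAt (𝓡 n) a₀ (F q)) (b, k)) := by
    refine MDifferentiableAt.hasMFDerivAt ?_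
    exact (hasMFDerivAt_chart hc).mdifferentiableAt.comp (b, k)
      ((hF.contMDiffAt (hU.mem_nhds hbk)).mdifferentiableAt (by simp))
  have hT' := hT
  rw [← hf0, ← hg0] at hT'
  have e1 := hT'.comp x hfg
  have hc' := hasMFDerivAt_chart hc
  rw [← hr0] at hc'
  have e2 := hc'.comp x hr2
  have e3 := hasMFDerivAt_unique e2 (e1.congr_of_eventuallyEq ?_)
  · have e4 := congrArg (fun T : Eu d →L[ℝ] Eu n => T v) e3
    have e5 := mfderiv_prod_eq_add_apply (v := (Φ.lift (incl m b) v, Φ.lift (incl n' k) v))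
      hT.mdifferentiableAt
    refine Eq.trans ?_ (e4.trans (Eq.trans ?_ e5))
    · rw [hr0]; rfl
    · rw [hf0, hg0]; rfl
  · have hU' : ∀ᶠ y in 𝓝 x, (f y, g y) ∈ U :=
      hfg.continuousAt (hU.mem_nhds (by rw [hf0, hg0]; exact hbk))
    filter_upwards [hf1, hg1, hr1, hσs, hτs, hU'] with y h1 h2 h3 h4 h5 h6
    have h7 := hF1 _ h6 (by
      show Γ.src (incl m (f y)) = Γ.src (incl n' (g y))
      rw [show incl m (f y) = σ y from h1.symm, show incl n' (g y) = τ y from h2.symm, h4, h5])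
    have h8 : incl n (r y) = incl n (F (f y, g y)) := by
      rw [← h7]
      refine h3.symm.trans ?_
      rw [h1, h2]
    have h9 : r y = F (f y, g y) := (isOpenEmbedding_incl n).injective h8
    exact congrArg (extChartAt (𝓡 n) a₀) h9

end Connection

end DiffGroupoid

/-- Lets an auxiliary frame `C` of the tangent space at s(k) be inserted into both factors of the
cocycle: each factor is then regular, and the frame cancels. -/
theorem ContinuousLinearMap.comp_comp_inverse_comp {E F G : Type*} [NormedAddCommGroup E]
    [NormedSpace ℝ E] [NormedAddCommGroup F] [NormedSpace ℝ F] [NormedAddCommGroup G]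
    [NormedSpace ℝ G] {X : E →L[ℝ] G} {Q : E →L[ℝ] F} {C : E →L[ℝ] E} (hQ : Q.IsInvertible)
    (hC : C.IsInvertible) : (X.comp C).comp (Q.comp C).inverse = X.comp Q.inverse := by
  obtain ⟨q, rfl⟩ := hQ
  obtain ⟨c, rfl⟩ := hC
  have : ((q : E →L[ℝ] F).comp (c : E →L[ℝ] E)).inverse =
      (c.symm : E →L[ℝ] E).comp (q.symm : F →L[ℝ] E) := by
    refine ContinuousLinearMap.inverse_eq ?_ ?_ <;> ext1 v <;> simp
  rw [this, ContinuousLinearMap.inverse_equiv]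
  ext1 v
  simp

namespace DiffGroupoid

variable {d : ℕ} {M : Type v} [TopologicalSpace M] [ChartedSpace (Eu d) M]
  [IsManifold (𝓡 d) ∞ M] {A : ℕ → Type u} [∀ n, TopologicalSpace (A n)]
  [∀ n, ChartedSpace (Eu n) (A n)] [∀ n, IsManifold (𝓡 n) ∞ (A n)]
  {Γ : DiffGroupoid d M A}

variable (Γ) in
/-- The points of the chart at `a₀` whose sources lie in the chart at the source of `a₀`. -/
def adaptedDomain {n : ℕ} (a₀ : A n) : Set (Eu n) :=
  (extChartAt (𝓡 n) a₀).target ∩ (extChartAt (𝓡 n) a₀).symm ⁻¹'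
    ((fun a => Γ.src (incl n a)) ⁻¹' (chartAt (Eu d) (Γ.src (incl n a₀))).source)

variable (Γ) in
/-- The source map in the chart at `a₀`. -/
def localSrc {n : ℕ} (a₀ : A n) (z : Eu n) : M := Γ.src (incl n ((extChartAt (𝓡 n) a₀).symm z))

theorem contMDiffOn_extChartAt_symm_adapted {n : ℕ} (a₀ : A n) :
    ContMDiffOn (𝓡 n) (𝓡 n) ∞ (extChartAt (𝓡 n) a₀).symm (Γ.adaptedDomain a₀) :=
  (contMDiffOn_extChartAt_symm a₀).mono inter_subset_left

theorem isOpen_adaptedDomain {n : ℕ} (a₀ : A n) : IsOpen (Γ.adaptedDomain a₀) :=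
  (continuousOn_extChartAt_symm a₀).isOpen_inter_preimage (isOpen_extChartAt_target a₀)
    ((chartAt (Eu d) (Γ.src (incl n a₀))).open_source.preimage (Γ.smooth_src n).continuous)

theorem contMDiffOn_localSrc {n : ℕ} (a₀ : A n) :
    ContMDiffOn (𝓡 n) (𝓡 d) ∞ (Γ.localSrc a₀) (Γ.adaptedDomain a₀) :=
  (Γ.smooth_src n).comp_contMDiffOn (contMDiffOn_extChartAt_symm_adapted a₀)

namespace Connection

variable {p : ℕ∞} (Φ : Γ.Connection p)

theorem contMDiffAt_lift_comp {E : Type*} [NormedAddCommGroup E] [NormedSpace ℝ E]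
    {H : Type*} [TopologicalSpace H] {I : ModelWithCorners ℝ E H} {N : Type*} [TopologicalSpace N]
    [ChartedSpace H N] {n : ℕ} {g : N → A n} {x₀ : N} (hg : ContMDiffAt I (𝓡 n) p g x₀) :
    ContMDiffAt I 𝓘(ℝ, Eu d →L[ℝ] Eu n) p (inTangentCoordinates (𝓡 d) (𝓡 n)
      (fun x => Γ.src (incl n (g x))) g (fun x => Φ.lift (incl n (g x))) x₀) x₀ :=
  (Φ.contMDiff_lift n (g x₀)).comp x₀ hg

/-- The difference cocycle in the charts at `a₀` and at its source. -/
def localDiffCocycle {n : ℕ} (a₀ : A n) (z : Eu n) (k : MixedManifold A) : Eu d →L[ℝ] Eu n :=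
  (chartDeriv a₀ ((extChartAt (𝓡 n) a₀).symm z)).comp
    ((Φ.diffCocycle (Γ.mul (incl n ((extChartAt (𝓡 n) a₀).symm z)) k) k
      (incl n ((extChartAt (𝓡 n) a₀).symm z))).comp
      (chartDerivInv (Γ.src (incl n a₀)) (Γ.localSrc a₀ z)))

variable {Φ}

/-- Near each point the cocycle equals (X₁ + X₂) ∘ Q⁻¹, where X₁ and X₂ are the partial derivatives
of division on the lifts at ak and k, and Q is the effect of k, all in one frame at s(k). Each is of
class C^p, and operator inversion is smooth at Q by non-degeneracy. -/
theorem fiberSmooth_localDiffCocycle (hΦ : Φ.IsNondegenerate) {n : ℕ} (a₀ : A n) :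
    Γ.FiberSmooth p (Γ.adaptedDomain a₀) (Γ.localSrc a₀) (Φ.localDiffCocycle a₀) := by
  rintro n' ψ hψ ⟨z₁, u₁⟩ ⟨hz₁, hs₁⟩
  refine ContDiffAt.contDiffWithinAt ?_
  rw [← contMDiffAt_iff_contDiffAt]
  set x₀ := Γ.src (incl n a₀) with hx₀
  set φ := extChartAt (𝓡 n) a₀ with hφ
  let N := Eu n × Eu (n' - d)
  let a : N → A n := fun q => φ.symm q.1
  let K : N → A n' := fun q => ψ (q.2, Γ.localSrc a₀ q.1)
  let q₁ : N := (z₁, u₁)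
  have hWn : ∀ᶠ q : N in 𝓝 q₁, q.1 ∈ Γ.adaptedDomain a₀ :=
    continuous_fst.continuousAt ((isOpen_adaptedDomain a₀).mem_nhds hz₁)
  have hfst : ContMDiffAt 𝓘(ℝ, N) (𝓡 n) ∞ (fun q : N => q.1) q₁ :=
    contDiff_fst.contMDiff.contMDiffAt
  have hsnd : ContMDiffAt 𝓘(ℝ, N) (𝓡 (n' - d)) ∞ (fun q : N => q.2) q₁ :=
    contDiff_snd.contMDiff.contMDiffAt
  have ha : ContMDiffAt 𝓘(ℝ, N) (𝓡 n) ∞ a q₁ :=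
    ((contMDiffOn_extChartAt_symm_adapted a₀).contMDiffAt
      ((isOpen_adaptedDomain a₀).mem_nhds hz₁)).comp q₁ hfst
  have hσ : ContMDiffAt 𝓘(ℝ, N) (𝓡 d) ∞ (fun q : N => Γ.localSrc a₀ q.1) q₁ :=
    ((contMDiffOn_localSrc a₀).contMDiffAt ((isOpen_adaptedDomain a₀).mem_nhds hz₁)).comp q₁ hfst
  have hK : ContMDiffAt 𝓘(ℝ, N) (𝓡 n') ∞ K q₁ :=
    (hψ.contMDiffAt hs₁).comp q₁ (hsnd.prodMk hσ)
  have hsn : ∀ᶠ q : N in 𝓝 q₁, (q.2, Γ.localSrc a₀ q.1) ∈ ψ.source :=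
    (hsnd.continuousAt.prodMk hσ.continuousAt) (ψ.open_source.mem_nhds hs₁)
  have htK : ∀ᶠ q : N in 𝓝 q₁, Γ.src (incl n (a q)) = Γ.tgt (incl n' (K q)) := by
    filter_upwards [hsn] with q hq using (hψ.2.2 _ hq).symm
  -- the product `a k`
  let m := (Γ.mul (incl n (a q₁)) (incl n' (K q₁))).dim
  obtain ⟨F₁, U₁, hU₁, hq₁, hF₁, hF₁0, hF₁1⟩ := Γ.exists_mul_rep
    (b := (Γ.mul (incl n (a q₁)) (incl n' (K q₁))).pt) htK.self_of_nhds rfl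
  let B : N → A m := fun q => F₁ (a q, K q)
  have hB : ContMDiffAt 𝓘(ℝ, N) (𝓡 m) ∞ B q₁ :=
    (hF₁.contMDiffAt (hU₁.mem_nhds hq₁)).comp q₁ (ha.prodMk hK)
  have hBm : ∀ᶠ q : N in 𝓝 q₁, Γ.mul (incl n (a q)) (incl n' (K q)) = incl m (B q) := by
    filter_upwards [htK, (ha.continuousAt.prodMk hK.continuousAt) (hU₁.mem_nhds hq₁)]
      with q h1 h2 using hF₁1 _ h2 h1
  have hBs : ∀ᶠ q : N in 𝓝 q₁, Γ.src (incl m (B q)) = Γ.src (incl n' (K q)) := by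
    filter_upwards [htK, hBm] with q h1 h2
    rw [← h2, Γ.src_mul _ _ h1]
  have hdiv : ∀ᶠ q : N in 𝓝 q₁,
      Γ.mul (incl m (B q)) (Γ.inv (incl n' (K q))) = incl n (a q) := by
    filter_upwards [htK, hBm] with q h1 h2
    rw [← h2, Γ.mul_inv_cancel_right h1]
  obtain ⟨F, U, hU, hBK, hF, hF0, hF1⟩ := Γ.exists_div_rep hBs.self_of_nhds hdiv.self_of_nhds
  have hUn : ∀ᶠ q : N in 𝓝 q₁, (B q, K q) ∈ U :=
    (hB.continuousAt.prodMk hK.continuousAt) (hU.mem_nhds hBK)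
  have hFa : ∀ᶠ q : N in 𝓝 q₁, F (B q, K q) = a q := by
    filter_upwards [hUn, hBs, hdiv] with q h1 h2 h3
    have := hF1 _ h1 h2
    exact (isOpenEmbedding_incl n).injective (this.symm.trans h3)
  have hchart : ∀ᶠ q : N in 𝓝 q₁, a q ∈ (chartAt (Eu n) a₀).source := by
    filter_upwards [hWn] with q hq
    have := φ.map_target hq.1
    rwa [hφ, extChartAt_source] at this
  have hT : ContMDiffAt ((𝓡 m).prod (𝓡 n')) (𝓡 n) ∞ (fun r => φ (F r)) (B q₁, K q₁) := by
    have h1 : ContMDiffAt (𝓡 n) (𝓡 n) ∞ φ (F (B q₁, K q₁)) := by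
      refine contMDiffAt_extChartAt' ?_
      rw [hFa.self_of_nhds]; exact hchart.self_of_nhds
    exact h1.comp (B q₁, K q₁) (hF.contMDiffAt (hU.mem_nhds hBK))
  let s : N → M := fun q => Γ.src (incl n' (K q))
  have hs : ContMDiffAt 𝓘(ℝ, N) (𝓡 d) ∞ s q₁ := (Γ.smooth_src n').contMDiffAt.comp q₁ hK
  have hp : (p : ℕ∞ω) ≤ (∞ : ℕ∞ω) := by exact_mod_cast le_top
  -- the two parts of the derivative of the division map
  have hX₂ : ContMDiffAt 𝓘(ℝ, N) 𝓘(ℝ, Eu d →L[ℝ] Eu n) p (fun q =>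
      (mderiv (fun k' => φ (F (B q, k'))) (K q)).comp
        ((Φ.lift (incl n' (K q))).comp (chartDerivInv (s q₁) (s q)))) q₁ := by
    refine contMDiffAt_mfderiv_comp (T := fun q k' => φ (F (B q, k'))) hs.continuousAt
      (hK.of_le hp) (Φ.contMDiffAt_lift_comp (hK.of_le hp)) ?_
    exact ContMDiffAt.comp (g := fun r => φ (F r)) (f := fun r : N × A n' => (B r.1, r.2))
      (q₁, K q₁) hT ((ContMDiffAt.comp (g := B) (f := Prod.fst) (q₁, K q₁) hB
        contMDiffAt_fst).prodMk contMDiffAt_snd)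
  have hX₁ : ContMDiffAt 𝓘(ℝ, N) 𝓘(ℝ, Eu d →L[ℝ] Eu n) p (fun q =>
      (mderiv (fun b' => φ (F (b', K q))) (B q)).comp
        ((Φ.lift (incl m (B q))).comp (chartDerivInv (s q₁) (s q)))) q₁ := by
    have h1 := contMDiffAt_mfderiv_comp (T := fun q b' => φ (F (b', K q)))
      ((Γ.smooth_src m).contMDiffAt.comp q₁ hB).continuousAt
      (hB.of_le hp) (Φ.contMDiffAt_lift_comp (hB.of_le hp))
      (ContMDiffAt.comp (g := fun r => φ (F r)) (f := fun r : N × A m => (r.2, K r.1))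
      (q₁, B q₁) hT (contMDiffAt_snd.prodMk (ContMDiffAt.comp (g := K) (f := Prod.fst) (q₁, B q₁) hK
        contMDiffAt_fst)))
    refine h1.congr_of_eventuallyEq ?_
    -- Since s(ak) = s(k), the frame appearing in `h1` is the one used for X₂ and Q.
    have e0 : Γ.src (incl m (B q₁)) = s q₁ := hBs.self_of_nhds
    filter_upwards [hBs] with q hq
    simp only [Function.comp, e0, hq, s]
  -- the effect
  have htgt : ContMDiffAt (𝓡 n') (𝓡 d) ∞
      (fun k' => extChartAt (𝓡 d) x₀ (Γ.tgt (incl n' k'))) (K q₁) := by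
    refine ContMDiffAt.comp (K q₁) (contMDiffAt_extChartAt' ?_) (Γ.smooth_tgt n').contMDiffAt
    rw [← htK.self_of_nhds]; exact hz₁.2
  have hQ : ContMDiffAt 𝓘(ℝ, N) 𝓘(ℝ, Eu d →L[ℝ] Eu d) p (fun q =>
      (mderiv (fun k' => extChartAt (𝓡 d) x₀ (Γ.tgt (incl n' k'))) (K q)).comp
        ((Φ.lift (incl n' (K q))).comp (chartDerivInv (s q₁) (s q)))) q₁ := by
    refine contMDiffAt_mfderiv_comp
      (T := fun _ k' => extChartAt (𝓡 d) x₀ (Γ.tgt (incl n' k'))) hs.continuousAt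
      (hK.of_le hp) (Φ.contMDiffAt_lift_comp (hK.of_le hp)) ?_
    exact ContMDiffAt.comp (g := fun k' => extChartAt (𝓡 d) x₀ (Γ.tgt (incl n' k')))
      (f := Prod.snd) (q₁, K q₁) htgt contMDiffAt_snd
  have hQe : ∀ᶠ q : N in 𝓝 q₁,
      (mderiv (fun k' => extChartAt (𝓡 d) x₀ (Γ.tgt (incl n' k'))) (K q)).comp
        (Φ.lift (incl n' (K q))) =
      (chartDeriv x₀ (Γ.localSrc a₀ q.1)).comp (Φ.effect (incl n' (K q))) := by
    filter_upwards [htK, hWn] with q h1 h2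
    have h3 : Γ.localSrc a₀ q.1 = Γ.tgt (incl n' (K q)) := h1
    have h4 := (hasMFDerivAt_chart (n := d) (c := x₀) (x := Γ.tgt (incl n' (K q)))
      (by rw [← h3]; exact h2.2)).comp (K q) (Γ.hasMFDerivAt_tgt n' (K q))
    have h5 : mderiv (fun k' => extChartAt (𝓡 d) x₀ (Γ.tgt (incl n' k'))) (K q) =
      (chartDeriv x₀ (Γ.localSrc a₀ q.1)).comp (Γ.ttgt (incl n' (K q))) := by
      rw [h3]; exact h4.mfderiv
    rw [h5]; rfl
  have hcs : ∀ᶠ q : N in 𝓝 q₁, s q ∈ (chartAt (Eu d) (s q₁)).source :=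
    hs.continuousAt ((chartAt (Eu d) (s q₁)).open_source.mem_nhds (mem_chart_source _ _))
  have hinv : ∀ᶠ q : N in 𝓝 q₁, ((chartDeriv (n := d) x₀ (Γ.localSrc a₀ q.1)).comp
      (Φ.effect (incl n' (K q)))).IsInvertible := by
    filter_upwards [hWn] with q hq using (isInvertible_chartDeriv hq.2).comp (hΦ _)
  have hQ' : ContMDiffAt 𝓘(ℝ, N) 𝓘(ℝ, Eu d →L[ℝ] Eu d) p (fun q =>
      (((chartDeriv x₀ (Γ.localSrc a₀ q.1)).comp (Φ.effect (incl n' (K q)))).comp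
        (chartDerivInv (s q₁) (s q))).inverse) q₁ := by
    have h1 : ContMDiffAt 𝓘(ℝ, N) 𝓘(ℝ, Eu d →L[ℝ] Eu d) p (fun q =>
      ((chartDeriv x₀ (Γ.localSrc a₀ q.1)).comp (Φ.effect (incl n' (K q)))).comp
        (chartDerivInv (s q₁) (s q))) q₁ := by
      refine hQ.congr_of_eventuallyEq ?_
      filter_upwards [hQe] with q hq
      rw [← hq]; rfl
    have h2 := (hinv.self_of_nhds.comp (isInvertible_chartDerivInv hcs.self_of_nhds))
    exact (h2.contDiffAt_map_inverse (n := p)).contMDiffAt.comp q₁ h1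
  refine ((hX₁.add hX₂).clm_comp hQ').congr_of_eventuallyEq ?_
  filter_upwards [hWn, htK, hBm, hBs, hUn, hFa, hchart, hcs, hinv] with q h1 h2 h3 h4 h5 h6 h7 h8 h9
  have e1 : ((mderiv (fun b' => φ (F (b', K q))) (B q)).comp
        ((Φ.lift (incl m (B q))).comp (chartDerivInv (s q₁) (s q))) +
      (mderiv (fun k' => φ (F (B q, k'))) (K q)).comp
        ((Φ.lift (incl n' (K q))).comp (chartDerivInv (s q₁) (s q)))) =
      ((chartDeriv a₀ (a q)).comp (Φ.quot (incl m (B q)) (incl n' (K q)) (incl n (a q)))).comp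
        (chartDerivInv (s q₁) (s q)) := by
    ext1 v
    have := chartDeriv_quot (Φ := Φ) a₀ hU hF hF1 h5 h4 (by rw [h6]; exact h7)
      (chartDerivInv (s q₁) (s q) v)
    rw [h6] at this
    exact this.symm
  rw [Pi.add_apply, e1, ContinuousLinearMap.comp_comp_inverse_comp h9 (isInvertible_chartDerivInv h8)]
  have e2 : ((chartDeriv (n := d) x₀ (Γ.localSrc a₀ q.1)).comp
      (Φ.effect (incl n' (K q)))).inverse =
      (Φ.effect (incl n' (K q))).inverse.comp (chartDerivInv x₀ (Γ.localSrc a₀ q.1)) := by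
    have hi : (chartDeriv (n := d) x₀ (Γ.localSrc a₀ q.1)).IsInvertible :=
      isInvertible_chartDeriv h1.2
    have hj : (chartDeriv (n := d) x₀ (Γ.localSrc a₀ q.1)).inverse =
      chartDerivInv x₀ (Γ.localSrc a₀ q.1) := inverse_chartDeriv h1.2
    rw [hi.inverse_comp_of_left, hj]
  rw [e2]
  show (chartDeriv a₀ (a q)).comp ((Φ.diffCocycle (Γ.mul (incl n (a q)) (incl n' (K q)))
    (incl n' (K q)) (incl n (a q))).comp _) = _
  rw [h3, diffCocycle_eq]
  rfl

end Connection

end DiffGroupoid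

namespace DiffGroupoid

variable {d : ℕ} {M : Type v} [TopologicalSpace M] [ChartedSpace (Eu d) M]
  [IsManifold (𝓡 d) ∞ M] {A : ℕ → Type u} [∀ n, TopologicalSpace (A n)]
  [∀ n, ChartedSpace (Eu n) (A n)] [∀ n, IsManifold (𝓡 n) ∞ (A n)]
  {Γ : DiffGroupoid d M A} [T2Space M]

/-! ### Left translation -/

theorem isClosed_setOf_tgt_eq (x : M) : IsClosed {k | Γ.tgt k = x} :=
  isClosed_singleton.preimage Γ.continuous_tgt

theorem continuousOn_mul_left (g : MixedManifold A) :
    ContinuousOn (Γ.mul g) {k | Γ.tgt k = Γ.src g} :=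
  Γ.continuousOn_mul.comp (continuousOn_const.prodMk continuousOn_id) fun _ hk => Eq.symm hk

/-- A measurable part of a target fiber is translated to a measurable set. -/
theorem measurableSet_mul_left_preimage (g : MixedManifold A) {B : Set (MixedManifold A)}
    (hB : MeasurableSet B) : MeasurableSet ({k | Γ.tgt k = Γ.src g} ∩ Γ.mul g ⁻¹' B) := by
  have hm : Measurable ({k | Γ.tgt k = Γ.src g}.domRestrict (Γ.mul g)) :=
    (continuousOn_iff_continuous_domRestrict.1 (continuousOn_mul_left g)).measurable
  have := (isClosed_setOf_tgt_eq (Γ := Γ) (Γ.src g)).measurableSet.subtype_image (hm hB)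
  convert this using 1
  ext k
  simp [Set.domRestrict, and_comm]

theorem image_mul_left_preimage (g : MixedManifold A) (B : Set (MixedManifold A)) :
    Γ.mul g '' ({k | Γ.tgt k = Γ.src g} ∩ Γ.mul g ⁻¹' B) = B ∩ {k | Γ.tgt k = Γ.tgt g} := by
  ext h
  constructor
  · rintro ⟨k, ⟨h1, h2⟩, rfl⟩
    exact ⟨h2, Γ.tgt_mul _ _ (Eq.symm h1)⟩
  · rintro ⟨h1, h2⟩
    have h3 : Γ.tgt (Γ.mul (Γ.inv g) h) = Γ.src g := by
      rw [Γ.tgt_mul _ _ (by rw [Γ.src_inv]; exact Eq.symm h2), Γ.tgt_inv]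
    have h4 : Γ.mul g (Γ.mul (Γ.inv g) h) = h := Γ.mul_inv_cancel_left (Eq.symm h2)
    exact ⟨_, ⟨h3, by rw [mem_preimage, h4]; exact h1⟩, h4⟩

theorem IsLeftHaarSystem.ae_tgt {μ : M → Measure (MixedManifold A)} (h : Γ.IsLeftHaarSystem μ)
    (x : M) : ∀ᵐ k ∂(μ x), Γ.tgt k = x := h.carried x

theorem IsLeftHaarSystem.aemeasurable_mul {μ : M → Measure (MixedManifold A)}
    (h : Γ.IsLeftHaarSystem μ) (g : MixedManifold A) : AEMeasurable (Γ.mul g) (μ (Γ.src g)) := by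
  rw [← Measure.restrict_eq_self_of_ae_mem (h.ae_tgt (Γ.src g))]
  exact (continuousOn_mul_left g).aemeasurable (isClosed_setOf_tgt_eq _).measurableSet

/-- Left invariance is given only for sets inside a fiber, and left translation is controlled only
there; since the measures are carried by the fibers, intersecting with them loses nothing. -/
theorem IsLeftHaarSystem.map_mul {μ : M → Measure (MixedManifold A)}
    (h : Γ.IsLeftHaarSystem μ) (g : MixedManifold A) :
    (μ (Γ.src g)).map (Γ.mul g) = μ (Γ.tgt g) := by
  ext B hB
  rw [Measure.map_apply_of_aemeasurable (h.aemeasurable_mul g) hB]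
  have h1 : μ (Γ.src g) (Γ.mul g ⁻¹' B) =
      μ (Γ.src g) ({k | Γ.tgt k = Γ.src g} ∩ Γ.mul g ⁻¹' B) := by
    refine measure_congr ?_
    filter_upwards [h.ae_tgt (Γ.src g)] with k hk
    exact propext ⟨fun hb => ⟨hk, hb⟩, fun hb => hb.2⟩
  have h2 : μ (Γ.tgt g) B = μ (Γ.tgt g) (B ∩ {k | Γ.tgt k = Γ.tgt g}) := by
    refine measure_congr ?_
    filter_upwards [h.ae_tgt (Γ.tgt g)] with k hk
    exact propext ⟨fun hb => ⟨hb, hk⟩, fun hb => hb.1⟩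
  rw [h1, h2, ← image_mul_left_preimage,
    h.left_invariant g _ (measurableSet_mul_left_preimage g hB) fun k hk => hk.1]

namespace NormalizedHaarSystem

variable (H : Γ.NormalizedHaarSystem) {E : Type*} [NormedAddCommGroup E] [NormedSpace ℝ E]

theorem measurable_κ_src : Measurable fun k => H.κ (Γ.src k) :=
  (H.smooth.continuous.comp Γ.continuous_src).measurable

theorem integrable_iff {x : M} {f : MixedManifold A → E} :
    Integrable f (H.ν x) ↔ Integrable (fun k => H.κ (Γ.src k) • f k) (H.μ x) := by
  rw [ν, integrable_withDensity_iff_integrable_smul' H.measurable_κ_src.ennreal_ofReal (by simp)]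
  simp only [ENNReal.toReal_ofReal (H.nonneg _)]

theorem integral_eq {x : M} (f : MixedManifold A → E) :
    ∫ k, f k ∂(H.ν x) = ∫ k, H.κ (Γ.src k) • f k ∂(H.μ x) := by
  rw [ν, integral_withDensity_eq_integral_toReal_smul H.measurable_κ_src.ennreal_ofReal (by simp)]
  simp only [ENNReal.toReal_ofReal (H.nonneg _)]

instance (x : M) : IsProbabilityMeasure (H.ν x) := by
  have h1 := H.integral_eq_one x
  have h2 : Integrable (fun k => H.κ (Γ.src k)) (H.μ x) := by
    -- A non-integrable function has Bochner integral 0, so the normalization to 1 already implies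
    -- integrability.
    by_contra hn
    rw [integral_undef hn] at h1
    exact zero_ne_one h1
  constructor
  rw [ν, withDensity_apply _ MeasurableSet.univ, Measure.restrict_univ,
    ← ofReal_integral_eq_lintegral_ofReal h2 (Eventually.of_forall fun k => H.nonneg _), h1,
    ENNReal.ofReal_one]

theorem ae_tgt (x : M) : ∀ᵐ k ∂(H.ν x), Γ.tgt k = x :=
  (withDensity_absolutelyContinuous _ _).ae_le (H.isLeftHaarSystem.ae_tgt x)

/-- The weight κ ∘ s is unchanged by left translation because s(gk) = s(k), so ν inherits the
invariance of μ. -/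
theorem integrable_comp_mul {g : MixedManifold A} {f : MixedManifold A → E}
    (hf : Integrable f (H.ν (Γ.tgt g))) :
    Integrable (fun k => f (Γ.mul g k)) (H.ν (Γ.src g)) := by
  rw [H.integrable_iff] at hf ⊢
  rw [← H.isLeftHaarSystem.map_mul] at hf
  rw [integrable_map_measure hf.aestronglyMeasurable (H.isLeftHaarSystem.aemeasurable_mul g)] at hf
  refine hf.congr ?_
  filter_upwards [H.isLeftHaarSystem.ae_tgt (Γ.src g)] with k hk
  simp only [Function.comp, Γ.src_mul _ _ hk.symm]

theorem integral_comp_mul {g : MixedManifold A} {f : MixedManifold A → E}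
    (hf : Integrable f (H.ν (Γ.tgt g))) :
    ∫ k, f (Γ.mul g k) ∂(H.ν (Γ.src g)) = ∫ k, f k ∂(H.ν (Γ.tgt g)) := by
  rw [H.integrable_iff, ← H.isLeftHaarSystem.map_mul] at hf
  rw [H.integral_eq, H.integral_eq, ← H.isLeftHaarSystem.map_mul,
    integral_map (H.isLeftHaarSystem.aemeasurable_mul g) hf.aestronglyMeasurable]
  refine integral_congr_ae ?_
  filter_upwards [H.isLeftHaarSystem.ae_tgt (Γ.src g)] with k hk
  simp only [Γ.src_mul _ _ hk.symm]

end NormalizedHaarSystem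

namespace Connection

variable {p : ℕ∞} {Φ : Γ.Connection p}

/-! ### The multiplicative average -/

theorem localDiffCocycle_extChartAt {n : ℕ} {a₀ a : A n}
    (ha : a ∈ (chartAt (Eu n) a₀).source) (k : MixedManifold A) :
    Φ.localDiffCocycle a₀ (extChartAt (𝓡 n) a₀ a) k =
      (chartDeriv a₀ a).comp ((Φ.diffCocycle (Γ.mul (incl n a) k) k (incl n a)).comp
        (chartDerivInv (Γ.src (incl n a₀)) (Γ.src (incl n a)))) := by
  have h : (extChartAt (𝓡 n) a₀).symm (extChartAt (𝓡 n) a₀ a) = a :=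
    (extChartAt (𝓡 n) a₀).left_inv (by rwa [extChartAt_source])
  rw [localDiffCocycle, localSrc, h]

theorem localSrc_extChartAt {n : ℕ} {a₀ a : A n} (ha : a ∈ (chartAt (Eu n) a₀).source) :
    Γ.localSrc a₀ (extChartAt (𝓡 n) a₀ a) = Γ.src (incl n a) := by
  rw [localSrc, (extChartAt (𝓡 n) a₀).left_inv (by rwa [extChartAt_source])]

theorem extChartAt_mem_adaptedDomain {n : ℕ} {a₀ a : A n} (ha : a ∈ (chartAt (Eu n) a₀).source)
    (hs : Γ.src (incl n a) ∈ (chartAt (Eu d) (Γ.src (incl n a₀))).source) :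
    extChartAt (𝓡 n) a₀ a ∈ Γ.adaptedDomain a₀ := by
  have h : a ∈ (extChartAt (𝓡 n) a₀).source := by rwa [extChartAt_source]
  refine ⟨(extChartAt (𝓡 n) a₀).map_source h, ?_⟩
  rw [mem_preimage, (extChartAt (𝓡 n) a₀).left_inv h]
  exact hs

theorem integral_localDiffCocycle [T2Space (MixedManifold A)] (hΦ : Φ.IsNondegenerate)
    (H : Γ.NormalizedHaarSystem) {n : ℕ} (a₀ : A n) :
    (∀ z ∈ Γ.adaptedDomain a₀,
      Integrable (Φ.localDiffCocycle a₀ z) (H.ν (Γ.localSrc a₀ z))) ∧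
    ContDiffOn ℝ p (fun z => ∫ k, Φ.localDiffCocycle a₀ z k ∂(H.ν (Γ.localSrc a₀ z)))
      (Γ.adaptedDomain a₀) := by
  obtain ⟨τ, hτ⟩ := H.isLeftHaarSystem.exists_isFiberMeasure
  have := hτ.integral_of_properlySupported (isOpen_adaptedDomain a₀) (contMDiffOn_localSrc a₀)
    (fiberSmooth_localDiffCocycle hΦ a₀) H.smooth H.properly_supported
  simp only [H.integrable_iff, H.integral_eq]
  exact this

theorem integrable_diffCocycle [T2Space (MixedManifold A)] (hΦ : Φ.IsNondegenerate)
    (H : Γ.NormalizedHaarSystem) (g : MixedManifold A) :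
    Integrable (fun k => Φ.diffCocycle (Γ.mul g k) k g) (H.ν (Γ.src g)) := by
  have hs := mem_chart_source (Eu g.dim) g.pt
  have h := (integral_localDiffCocycle hΦ H g.pt).1 _
    (extChartAt_mem_adaptedDomain (Γ := Γ) hs (mem_chart_source _ _))
  rw [localSrc_extChartAt hs] at h
  refine h.congr (Eventually.of_forall fun k => ?_)
  -- At the center of the charts both chart derivatives are the identity, so the local expression is
  -- the cocycle itself.
  rw [localDiffCocycle_extChartAt hs, chartDeriv_self, chartDerivInv_self]
  rfl

/-- For fixed `a` the change to charts is a continuous linear operation on Hom spaces, so it passes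
under the integral. -/
theorem chartDeriv_comp_average [T2Space (MixedManifold A)] (hΦ : Φ.IsNondegenerate)
    (H : Γ.NormalizedHaarSystem) {n : ℕ} {a₀ a : A n} (ha : a ∈ (chartAt (Eu n) a₀).source) :
    (chartDeriv a₀ a).comp ((Φ.average H (incl n a)).comp
        (chartDerivInv (Γ.src (incl n a₀)) (Γ.src (incl n a)))) =
      ∫ k, Φ.localDiffCocycle a₀ (extChartAt (𝓡 n) a₀ a) k
        ∂(H.ν (Γ.localSrc a₀ (extChartAt (𝓡 n) a₀ a))) := by
  have h1 := integrable_diffCocycle hΦ H (incl n a)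
  let L : (Eu d →L[ℝ] Eu n) →L[ℝ] (Eu d →L[ℝ] Eu n) :=
    (ContinuousLinearMap.compL ℝ (Eu d) (Eu n) (Eu n) (chartDeriv a₀ a)).comp
      ((ContinuousLinearMap.compL ℝ (Eu d) (Eu d) (Eu n)).flip
        (chartDerivInv (Γ.src (incl n a₀)) (Γ.src (incl n a))))
  rw [localSrc_extChartAt ha]
  simp only [localDiffCocycle_extChartAt ha]
  exact (L.integral_comp_comm h1).symm

theorem average_apply [T2Space (MixedManifold A)] (hΦ : Φ.IsNondegenerate)
    (H : Γ.NormalizedHaarSystem) (g : MixedManifold A) (v : Eu d) :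
    Φ.average H g v = ∫ k, Φ.diffCocycle (Γ.mul g k) k g v ∂(H.ν (Γ.src g)) :=
  ContinuousLinearMap.integral_apply (integrable_diffCocycle hΦ H g) v

theorem integrable_diffCocycle_apply [T2Space (MixedManifold A)] (hΦ : Φ.IsNondegenerate)
    (H : Γ.NormalizedHaarSystem) (g : MixedManifold A) (v : Eu d) :
    Integrable (fun k => Φ.diffCocycle (Γ.mul g k) k g v) (H.ν (Γ.src g)) :=
  (integrable_diffCocycle hΦ H g).apply_continuousLinearMap v

/-- The multiplicative average of a non-degenerate connection, as a connection. -/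
def averageConnection [T2Space (MixedManifold A)] (hΦ : Φ.IsNondegenerate)
    (H : Γ.NormalizedHaarSystem) : Γ.Connection p where
  lift := Φ.average H
  tsrc_lift g v := by
    rw [average_apply hΦ,
      ← (Γ.tsrc g).integral_comp_comm (integrable_diffCocycle_apply hΦ H g v)]
    have : ∀ᵐ k ∂(H.ν (Γ.src g)), Γ.tsrc g (Φ.diffCocycle (Γ.mul g k) k g v) = v := by
      filter_upwards [H.ae_tgt (Γ.src g)] with k hk
      rw [diffCocycle_eq, ContinuousLinearMap.comp_apply,
        tsrc_quot (Γ.src_mul _ _ hk.symm) (Γ.mul_inv_cancel_right hk.symm),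
        hΦ.effect_inverse_apply]
    rw [integral_congr_ae this]
    simp
  contMDiff_lift n a₀ := by
    have h1 := (integral_localDiffCocycle hΦ H a₀).2.contDiffAt
      ((isOpen_adaptedDomain a₀).mem_nhds
        (extChartAt_mem_adaptedDomain (Γ := Γ) (mem_chart_source (Eu n) a₀)
          (mem_chart_source _ _)))
    have h2 : ContMDiffAt (𝓡 n) 𝓘(ℝ, Eu n) p (extChartAt (𝓡 n) a₀) a₀ := contMDiffAt_extChartAt
    refine (h1.contMDiffAt.comp a₀ h2).congr_of_eventuallyEq ?_
    filter_upwards [(chartAt (Eu n) a₀).open_source.mem_nhds (mem_chart_source _ _),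
      (Γ.smooth_src n).continuous.continuousAt ((chartAt (Eu d)
        (Γ.src (incl n a₀))).open_source.mem_nhds (mem_chart_source _ _))] with a ha hs
    rw [inTangentCoordinates_eq_chartDeriv (f := fun a : A n => Γ.src (incl n a)) (g := id) hs ha]
    exact chartDeriv_comp_average hΦ H ha

/-- The target component of the integrand is λ_{gk} λ_k⁻¹ v = λ_g v, constant in k, and the total
mass is 1. -/
theorem IsEffective.effect_averageConnection [T2Space (MixedManifold A)] (hΦ : Φ.IsEffective)
    (H : Γ.NormalizedHaarSystem) (g : MixedManifold A) (v : Eu d) :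
    (averageConnection hΦ.isNondegenerate H).effect g v = Φ.effect g v := by
  have hn := hΦ.isNondegenerate
  show Γ.ttgt g (Φ.average H g v) = _
  rw [average_apply hn, ← (Γ.ttgt g).integral_comp_comm (integrable_diffCocycle_apply hn H g v)]
  have : ∀ᵐ k ∂(H.ν (Γ.src g)), Γ.ttgt g (Φ.diffCocycle (Γ.mul g k) k g v) = Φ.effect g v := by
    filter_upwards [H.ae_tgt (Γ.src g)] with k hk
    rw [diffCocycle_eq, ContinuousLinearMap.comp_apply,
      ttgt_quot (Γ.src_mul _ _ hk.symm) (Γ.mul_inv_cancel_right hk.symm),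
      hΦ.2 _ _ hk.symm, ContinuousLinearMap.comp_apply, hn.effect_inverse_apply]
  rw [integral_congr_ae this]
  simp

theorem IsNondegenerate.average_one [T2Space (MixedManifold A)] (hΦ : Φ.IsNondegenerate)
    (H : Γ.NormalizedHaarSystem) (x : M) (v : Eu d) :
    Φ.average H (Γ.one x) v = Γ.tone x v := by
  rw [average_apply hΦ]
  have : ∀ᵐ k ∂(H.ν (Γ.src (Γ.one x))),
      Φ.diffCocycle (Γ.mul (Γ.one x) k) k (Γ.one x) v = Γ.tone x v := by
    filter_upwards [H.ae_tgt (Γ.src (Γ.one x))] with k hk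
    rw [Γ.src_one] at hk
    subst hk
    rw [Γ.one_mul, diffCocycle_eq, ContinuousLinearMap.comp_apply, quot_self,
      hΦ.effect_inverse_apply]
  rw [integral_congr_ae this]
  simp

theorem IsEffective.inverse_effect_mul (hΦ : Φ.IsEffective) {g k : MixedManifold A}
    (h : Γ.src g = Γ.tgt k) (v : Eu d) :
    (Φ.effect (Γ.mul g k)).inverse (Φ.effect g v) = (Φ.effect k).inverse v := by
  have hn := hΦ.isNondegenerate
  conv_lhs => rw [← hn.effect_inverse_apply k v]
  have : Φ.effect g (Φ.effect k ((Φ.effect k).inverse v)) =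
      Φ.effect (Γ.mul g k) ((Φ.effect k).inverse v) := by rw [hΦ.2 _ _ h]; rfl
  rw [this, hn.inverse_effect_apply]

/-- The heart of part (1). After the substitution k ↦ gk in the average at `g'`, both integrands are
quotients of lifts of the single vector λ_k⁻¹ v, with the middle arrow gk in common, and the cocycle
identity applies pointwise. -/
theorem IsEffective.tmul_average [T2Space (MixedManifold A)] (hΦ : Φ.IsEffective)
    (H : Γ.NormalizedHaarSystem) {g' g z : MixedManifold A} (h : Γ.src g' = Γ.tgt g)
    (hz : Γ.mul g' g = z) (v : Eu d) :
    Γ.tmul g' g z (Φ.average H g' (Φ.effect g v), Φ.average H g v) = Φ.average H z v := by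
  have hn := hΦ.isNondegenerate
  have hs : Γ.src z = Γ.src g := by rw [← hz, Γ.src_mul _ _ h]
  have i1 := integrable_diffCocycle_apply hn H g' (Φ.effect g v)
  rw [h] at i1
  have i2 := integrable_diffCocycle_apply hn H g v
  have i3 := H.integrable_comp_mul i1
  -- Once both averages run over the fiber over s(g), the pair of integrals is the integral of the
  -- pair, and the linear map `tmul` moves inside.
  rw [average_apply hn, average_apply hn, average_apply hn, h, ← H.integral_comp_mul i1,
    ← integral_pair i3 i2, ← (Γ.tmul g' g z).integral_comp_comm (i3.prodMk i2), hs]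
  refine integral_congr_ae ?_
  filter_upwards [H.ae_tgt (Γ.src g)] with k hk
  have h1 : Γ.mul g' (Γ.mul g k) = Γ.mul z k := by rw [← hz, Γ.mul_assoc _ _ _ h hk.symm]
  rw [h1, diffCocycle_eq, diffCocycle_eq, diffCocycle_eq, ContinuousLinearMap.comp_apply,
    ContinuousLinearMap.comp_apply, ContinuousLinearMap.comp_apply,
    hΦ.inverse_effect_mul hk.symm]
  have e1 : Γ.src (Γ.mul g k) = Γ.src k := Γ.src_mul _ _ hk.symm
  have e2 : Γ.src (Γ.mul z k) = Γ.src k := Γ.src_mul _ _ (hs.trans hk.symm)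
  refine tmul_quot (e2.trans e1.symm) e1 ?_ (Γ.mul_inv_cancel_right hk.symm) hz _
  rw [← h1, Γ.mul_inv_cancel_right]
  rw [h, Γ.tgt_mul _ _ hk.symm]

theorem IsEffective.isMultiplicative_averageConnection [T2Space (MixedManifold A)]
    (hΦ : Φ.IsEffective) (H : Γ.NormalizedHaarSystem) :
    (averageConnection hΦ.isNondegenerate H).IsMultiplicative := by
  refine isMultiplicative_of_lift (hΦ.isNondegenerate.average_one H) fun g' g z h hz v => ?_
  rw [hΦ.effect_averageConnection]
  exact hΦ.tmul_average H h hz v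

end Connection

end DiffGroupoid

/-! ### Gram volumes -/

/-- The volume of the parallelepiped spanned by a tuple of vectors. -/
def gramVolume {V : Type*} [NormedAddCommGroup V] [InnerProductSpace ℝ V] {r : ℕ}
    (v : Fin r → V) : ℝ := Real.sqrt (Matrix.gram ℝ v).det

section GramVolume

variable {V : Type*} [NormedAddCommGroup V] [InnerProductSpace ℝ V] {r : ℕ}

theorem gramVolume_nonneg (v : Fin r → V) : 0 ≤ gramVolume v := Real.sqrt_nonneg _

theorem det_gram_pos {v : Fin r → V} (hv : LinearIndependent ℝ v) :
    0 < (Matrix.gram ℝ v).det := (Matrix.posDef_gram_of_linearIndependent hv).det_pos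

theorem gramVolume_pos {v : Fin r → V} (hv : LinearIndependent ℝ v) : 0 < gramVolume v :=
  Real.sqrt_pos.2 (det_gram_pos hv)

/-- The Gram matrix transforms as a G aᵀ; the square root of its determinant is a 1-density. -/
theorem gramVolume_smul (v : Fin r → V) (a : Matrix (Fin r) (Fin r) ℝ) :
    gramVolume (fun i => ∑ j, a i j • v j) = |a.det| * gramVolume v := by
  have h : Matrix.gram ℝ (fun i => ∑ j, a i j • v j) = a * Matrix.gram ℝ v * a.transpose := by
    ext i j
    simp only [Matrix.gram_apply, Matrix.mul_apply, Matrix.transpose_apply, inner_sum, sum_inner,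
      inner_smul_left, inner_smul_right, Finset.sum_mul, Finset.mul_sum, conj_trivial]
    refine Finset.sum_congr rfl fun k _ => Finset.sum_congr rfl fun l _ => by ring
  rw [gramVolume, gramVolume, h, Matrix.det_mul, Matrix.det_mul, Matrix.det_transpose,
    mul_right_comm, Real.sqrt_mul (mul_self_nonneg _), Real.sqrt_mul_self_eq_abs]

theorem contDiffAt_gramVolume [FiniteDimensional ℝ V] {v : Fin r → V}
    (hv : LinearIndependent ℝ v) : ContDiffAt ℝ ∞ (gramVolume (V := V) (r := r)) v := by
  have h : ContDiff ℝ ∞ fun v : Fin r → V => (Matrix.gram ℝ v).det := by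
    simp only [Matrix.det_apply', Matrix.gram_apply]
    refine ContDiff.sum fun σ _ => contDiff_const.mul (contDiff_prod fun i _ => ?_)
    exact (contDiff_apply ℝ V _).inner ℝ (contDiff_apply ℝ V _)
  exact h.contDiffAt.sqrt (det_gram_pos hv).ne'

end GramVolume

namespace DiffGroupoid

variable {d : ℕ} {M : Type v} [TopologicalSpace M] [ChartedSpace (Eu d) M]
  [IsManifold (𝓡 d) ∞ M] {A : ℕ → Type u} [∀ n, TopologicalSpace (A n)]
  [∀ n, ChartedSpace (Eu n) (A n)] [∀ n, IsManifold (𝓡 n) ∞ (A n)]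
  {Γ : DiffGroupoid d M A}
  {E : Type*} [NormedAddCommGroup E] [NormedSpace ℝ E] {H : Type*} [TopologicalSpace H]
  {I : ModelWithCorners ℝ E H} {N : Type*} [TopologicalSpace N] [ChartedSpace H N]

/-! ### Left translation of vertical vectors -/

theorem hasTDeriv_mul_left {G : N → MixedManifold A} {z₀ : N} {g k z : MixedManifold A}
    {L : E →L[ℝ] Eu k.dim} (h : HasTDeriv I G z₀ k L)
    (e : ∀ᶠ x in 𝓝 z₀, Γ.src g = Γ.tgt (G x)) (hz : Γ.mul g k = z) :
    HasTDeriv I (fun x => Γ.mul g (G x)) z₀ z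
      (((Γ.tmul g k z).comp (ContinuousLinearMap.inr ℝ (Eu g.dim) (Eu k.dim))).comp L) :=
  (hasTDeriv_const z₀ g).mul Γ h e hz

variable (Γ) in
/-- The chart at the unit `1_{x₀}`, on the part of the arrow manifold that contains it. -/
def unitChart (x₀ : M) (h : MixedManifold A) : Eu (Γ.one x₀).dim :=
  extChartAt (𝓡 (Γ.one x₀).dim) (Γ.one x₀).pt (part (Γ.one x₀) h)

variable (Γ) in
/-- The domain of the chart at the unit `1_{x₀}`. -/
def unitDomain (x₀ : M) : Set (MixedManifold A) :=
  incl (Γ.one x₀).dim '' (chartAt (Eu (Γ.one x₀).dim) (Γ.one x₀).pt).source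

variable (Γ) in
/-- The derivative of the chart at the unit `1_{x₀}`. -/
def unitChartDeriv (x₀ : M) (y : MixedManifold A) : Eu y.dim →L[ℝ] Eu (Γ.one x₀).dim :=
  mfderiv (𝓡 y.dim) (𝓡 (Γ.one x₀).dim) (fun a : A y.dim => Γ.unitChart x₀ (incl y.dim a)) y.pt

theorem isOpen_unitDomain (x₀ : M) : IsOpen (Γ.unitDomain x₀) :=
  (isOpenEmbedding_incl _).isOpenMap _ (chartAt (Eu (Γ.one x₀).dim) (Γ.one x₀).pt).open_source

theorem one_mem_unitDomain (x₀ : M) : Γ.one x₀ ∈ Γ.unitDomain x₀ :=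
  ⟨_, mem_chart_source _ _, rfl⟩

theorem unitChart_incl (x₀ : M) (b : A (Γ.one x₀).dim) :
    Γ.unitChart x₀ (incl _ b) = extChartAt (𝓡 (Γ.one x₀).dim) (Γ.one x₀).pt b := by
  rw [unitChart]
  exact congrArg _ (part_eq rfl)

theorem unitChartDeriv_incl (x₀ : M) (b : A (Γ.one x₀).dim) :
    Γ.unitChartDeriv x₀ (incl _ b) = chartDeriv (Γ.one x₀).pt b := by
  exact Filter.EventuallyEq.mfderiv_eq (Eventually.of_forall fun a => unitChart_incl x₀ a)

theorem injective_unitChartDeriv {x₀ : M} {y : MixedManifold A} (hy : y ∈ Γ.unitDomain x₀) :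
    Function.Injective (Γ.unitChartDeriv x₀ y) := by
  obtain ⟨b, hb, rfl⟩ := hy
  rw [unitChartDeriv_incl]
  exact (isInvertible_chartDeriv hb).injective

theorem hasMFDerivAt_unitChart {x₀ : M} {y : MixedManifold A} (hy : y ∈ Γ.unitDomain x₀)
    {G : N → MixedManifold A} {z₀ : N} {L : E →L[ℝ] Eu y.dim} (h : HasTDeriv I G z₀ y L) :
    HasMFDerivAt I (𝓡 (Γ.one x₀).dim) (fun x => Γ.unitChart x₀ (G x)) z₀
      ((Γ.unitChartDeriv x₀ y).comp L) := by
  obtain ⟨b, hb, rfl⟩ := hy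
  obtain ⟨f, h0, h1, h2⟩ := h.exists_rep
  change f z₀ = b at h0
  have h3 := hasMFDerivAt_chart hb
  rw [← h0] at h3
  refine ((h3.comp z₀ h2).congr_of_eventuallyEq ?_).congr_mfderiv ?_
  · filter_upwards [h1] with x hx
    rw [hx]
    exact unitChart_incl x₀ (f x)
  · rw [unitChartDeriv_incl, h0]
    rfl

variable (Γ) in
/-- Left translation of vertical vectors at `g` to the unit `1_{sg}`, followed by the chart at
`1_{x₀}`. -/
def vertDeriv (x₀ : M) (g : MixedManifold A) : Eu g.dim →L[ℝ] Eu (Γ.one x₀).dim :=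
  (Γ.unitChartDeriv x₀ (Γ.one (Γ.src g))).comp ((Γ.tmul (Γ.inv g) g (Γ.one (Γ.src g))).comp
    (ContinuousLinearMap.inr ℝ (Eu (Γ.inv g).dim) (Eu g.dim)))

theorem hasMFDerivAt_vertDeriv {x₀ : M} {g : MixedManifold A}
    (hg : Γ.one (Γ.src g) ∈ Γ.unitDomain x₀) {G : N → MixedManifold A} {z₀ : N}
    {L : E →L[ℝ] Eu g.dim} (h : HasTDeriv I G z₀ g L)
    (e : ∀ᶠ x in 𝓝 z₀, Γ.tgt (G x) = Γ.tgt g) :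
    HasMFDerivAt I (𝓡 (Γ.one x₀).dim) (fun x => Γ.unitChart x₀ (Γ.mul (Γ.inv g) (G x))) z₀
      ((Γ.vertDeriv x₀ g).comp L) :=
  hasMFDerivAt_unitChart hg (hasTDeriv_mul_left h
    (e.mono fun x hx => by rw [Γ.src_inv, hx]) (Γ.inv_mul g))

/-- Left translation is injective on vertical vectors. -/
theorem tmul_inr_injective {G : N → MixedManifold A} {z₀ : N} {g k z : MixedManifold A}
    {L : E →L[ℝ] Eu k.dim} (h : HasTDeriv I G z₀ k L)
    (e : ∀ᶠ x in 𝓝 z₀, Γ.src g = Γ.tgt (G x)) (hz : Γ.mul g k = z) {c : E}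
    (hc : Γ.tmul g k z (0, L c) = 0) : L c = 0 := by
  have h0 : Γ.src g = Γ.tgt k := by rw [← h.1]; exact e.self_of_nhds
  have h1 := hasTDeriv_mul_left h e hz
  have hk : Γ.mul (Γ.inv g) z = k := by rw [← hz, Γ.inv_mul_cancel_left h0]
  have h2 := hasTDeriv_mul_left (g := Γ.inv g) h1
    (e.mono fun x hx => by rw [Γ.src_inv, Γ.tgt_mul _ _ hx]) hk
  have h3 := h.unique (h2.congr (e.mono fun x hx => by rw [Γ.inv_mul_cancel_left hx]))
  have h4 : L c = Γ.tmul (Γ.inv g) z k (0, Γ.tmul g k z (0, L c)) :=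
    congrArg (fun T : E →L[ℝ] Eu k.dim => T c) h3
  rw [h4, hc, Prod.mk_zero_zero, map_zero]

theorem IsTargetTrivialization.eventually_tgt {n : ℕ}
    {ψ : OpenPartialHomeomorph (Eu (n - d) × M) (A n)} (hψ : Γ.IsTargetTrivialization n ψ)
    {q : Eu (n - d) × M} (hq : q ∈ ψ.source) :
    ∀ᶠ u in 𝓝 q.1, Γ.tgt (incl n (ψ (u, q.2))) = Γ.tgt (incl n (ψ q)) := by
  filter_upwards [ψ.eventually_mk_mem_source hq] with u hu
  rw [hψ.2.2 _ hu, hψ.2.2 _ hq]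

/-- A vertical vector is tangent to a fiber parametrization, along which left translation by g⁻¹ can
be undone. -/
theorem vertDeriv_injOn {x₀ : M} {g : MixedManifold A} (hg : Γ.one (Γ.src g) ∈ Γ.unitDomain x₀)
    {w : Eu g.dim} (hw : Γ.ttgt g w = 0) (h : Γ.vertDeriv x₀ g w = 0) : w = 0 := by
  obtain ⟨ψ, hψ, ha⟩ := Γ.exists_targetTrivialization g.pt
  obtain ⟨q, hq, hqg⟩ : ∃ q ∈ ψ.source, ψ q = g.pt := ⟨_, ψ.map_target ha, ψ.right_inv ha⟩
  have key : ∀ b : A g.dim, b = g.pt → ∀ w : Eu g.dim, Γ.ttgt (incl g.dim b) w = 0 →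
    Γ.vertDeriv x₀ (incl g.dim b) w = 0 → ψ q = b → w = 0 := by
    rintro b hb w hw h rfl
    obtain ⟨c, rfl⟩ := hψ.exists_fiberDeriv_eq hq hw
    have hg' : Γ.one (Γ.src (incl g.dim (ψ q))) ∈ Γ.unitDomain x₀ := by rw [hb]; exact hg
    refine tmul_inr_injective (hψ.hasTDeriv_fiber hq) (g := Γ.inv (incl g.dim (ψ q)))
      ((hψ.eventually_tgt hq).mono fun u hu => by rw [Γ.src_inv, hu]) (Γ.inv_mul _)
      (injective_unitChartDeriv hg' ?_)
    rw [map_zero]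
    exact h
  exact key _ rfl w hw h hqg

theorem linearIndependent_vertDeriv {x₀ : M} {g : MixedManifold A}
    (hg : Γ.one (Γ.src g) ∈ Γ.unitDomain x₀) {r : ℕ} {v : Fin r → Eu g.dim}
    (hv : ∀ i, Γ.ttgt g (v i) = 0) (hl : LinearIndependent ℝ v) :
    LinearIndependent ℝ fun i => Γ.vertDeriv x₀ g (v i) := by
  rw [Fintype.linearIndependent_iff] at hl ⊢
  intro c hc
  refine hl c (vertDeriv_injOn hg (x₀ := x₀) ?_ ?_)
  · simp [map_sum, hv]
  · simpa [map_sum] using hc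

/-- Derivative of (gk)⁻¹(g G(x)) = k⁻¹ G(x): translating back to the unit forgets `g`. This is what
makes the density below left invariant. -/
theorem vertDeriv_mul {x₀ : M} {g k z : MixedManifold A}
    (hk : Γ.one (Γ.src k) ∈ Γ.unitDomain x₀) {G : N → MixedManifold A} {z₀ : N}
    {L : E →L[ℝ] Eu k.dim} {L' : E →L[ℝ] Eu z.dim} (h : HasTDeriv I G z₀ k L)
    (e : ∀ᶠ x in 𝓝 z₀, Γ.src g = Γ.tgt (G x)) (hz : Γ.mul g k = z)
    (h' : HasTDeriv I (fun x => Γ.mul g (G x)) z₀ z L') (c : E) :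
    Γ.vertDeriv x₀ z (L' c) = Γ.vertDeriv x₀ k (L c) := by
  have h0 : Γ.src g = Γ.tgt k := by rw [← h.1]; exact e.self_of_nhds
  have hs : Γ.src z = Γ.src k := by rw [← hz, Γ.src_mul _ _ h0]
  have e1 := hasMFDerivAt_vertDeriv hk h (e.mono fun x hx => by rw [← hx, h0])
  have e2 := hasMFDerivAt_vertDeriv (x₀ := x₀) (by rw [hs]; exact hk) h'
    (e.mono fun x hx => by rw [Γ.tgt_mul _ _ hx, ← hz, Γ.tgt_mul _ _ h0])
  have e3 := hasMFDerivAt_unique e2 (e1.congr_of_eventuallyEq ?_)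
  · exact congrArg (fun T : E →L[ℝ] Eu _ => T c) e3
  · filter_upwards [e] with x hx
    rw [← hz, Γ.inv_mul_rev h0, Γ.mul_assoc, Γ.inv_mul_cancel_left hx]
    · rw [Γ.src_inv, Γ.tgt_inv, h0]
    · rw [Γ.src_inv, Γ.tgt_mul _ _ hx]

/-- The map is the derivative in u, at u = q.1, of the chart expression of ψ(q)⁻¹ ψ(u, q.2), which
is jointly smooth in q and u. -/
theorem contMDiffAt_vertDeriv_fiberDeriv {x₀ : M} {n : ℕ}
    {ψ : OpenPartialHomeomorph (Eu (n - d) × M) (A n)} (hψ : Γ.IsTargetTrivialization n ψ)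
    {q₀ : Eu (n - d) × M} (hq₀ : q₀ ∈ ψ.source)
    (h₀ : Γ.one (Γ.src (incl n (ψ q₀))) ∈ Γ.unitDomain x₀) :
    ContMDiffAt ((𝓡 (n - d)).prod (𝓡 d)) 𝓘(ℝ, Eu (n - d) →L[ℝ] Eu (Γ.one x₀).dim) ∞
      (fun q => (Γ.vertDeriv x₀ (incl n (ψ q))).comp (fiberDeriv ψ q)) q₀ := by
  obtain ⟨b, hb, hbe⟩ := id h₀
  obtain ⟨J, U₁, hU₁, hk, hJ, hJ0, hJ1⟩ := Γ.exists_inv_rep (a := ψ q₀)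
    (b := (Γ.inv (incl n (ψ q₀))).pt) rfl
  obtain ⟨F, U₂, hU₂, hF, hFs, hF0, hF1⟩ := Γ.exists_mul_rep
    (a' := (Γ.inv (incl n (ψ q₀))).pt) (a := ψ q₀) (b := b) (Γ.src_inv _)
    ((Γ.inv_mul _).trans hbe.symm)
  let T : Eu (n - d) × M → Eu (n - d) → Eu (Γ.one x₀).dim := fun q u =>
    extChartAt (𝓡 (Γ.one x₀).dim) (Γ.one x₀).pt (F (J (ψ q), ψ (u, q.2)))
  let P : (Eu (n - d) × M) × Eu (n - d) → A (Γ.inv (incl n (ψ q₀))).dim × A n := fun r =>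
    (J (ψ r.1), ψ (r.2, r.1.2))
  let r₀ : (Eu (n - d) × M) × Eu (n - d) := (q₀, q₀.1)
  have hP0 : P r₀ = ((Γ.inv (incl n (ψ q₀))).pt, ψ q₀) := Prod.ext hJ0 rfl
  have hP : ContMDiffAt (((𝓡 (n - d)).prod (𝓡 d)).prod (𝓡 (n - d)))
      ((𝓡 (Γ.inv (incl n (ψ q₀))).dim).prod (𝓡 n)) ∞ P r₀ := by
    have h1 : ContMDiffAt (((𝓡 (n - d)).prod (𝓡 d)).prod (𝓡 (n - d))) (𝓡 n) ∞
        (fun r : (Eu (n - d) × M) × Eu (n - d) => ψ r.1) r₀ :=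
      ContMDiffAt.comp (g := ψ) (f := Prod.fst) r₀ (hψ.contMDiffAt hq₀) contMDiffAt_fst
    have h2 : ContMDiffAt (((𝓡 (n - d)).prod (𝓡 d)).prod (𝓡 (n - d))) (𝓡 n) ∞
        (fun r : (Eu (n - d) × M) × Eu (n - d) => ψ (r.2, r.1.2)) r₀ := by
      refine ContMDiffAt.comp (g := ψ) (f := fun r : (Eu (n - d) × M) × Eu (n - d) =>
        (r.2, r.1.2)) r₀ (hψ.contMDiffAt hq₀) (contMDiffAt_snd.prodMk ?_)
      exact contMDiffAt_snd.comp r₀ contMDiffAt_fst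
    exact ((hJ.contMDiffAt (hU₁.mem_nhds hk)).comp r₀ h1).prodMk h2
  have hFP : ContMDiffAt (((𝓡 (n - d)).prod (𝓡 d)).prod (𝓡 (n - d))) (𝓡 (Γ.one x₀).dim) ∞
      (fun r => F (P r)) r₀ := by
    refine ContMDiffAt.comp r₀ (hFs.contMDiffAt (hU₂.mem_nhds ?_)) hP
    rw [hP0]; exact hF
  have hT : ContMDiffAt (((𝓡 (n - d)).prod (𝓡 d)).prod (𝓡 (n - d))) (𝓡 (Γ.one x₀).dim) ∞
      (Function.uncurry T) (q₀, q₀.1) := by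
    refine ContMDiffAt.comp r₀ (contMDiffAt_extChartAt' ?_) hFP
    show F (P r₀) ∈ _
    rw [hP0, hF0]; exact hb
  have h1 : ContMDiffAt ((𝓡 (n - d)).prod (𝓡 d)) 𝓘(ℝ, Eu (n - d) →L[ℝ] Eu (Γ.one x₀).dim) ∞
      (fun q => mderiv (n := n - d) (T q) q.1) q₀ := by
    have hfst : ContMDiffAt ((𝓡 (n - d)).prod (𝓡 d)) (𝓡 (n - d)) ∞
      (fun q : Eu (n - d) × M => q.1) q₀ := contMDiffAt_fst
    have := ContMDiffAt.mfderiv (m := (∞ : ℕ∞ω)) T (fun q : Eu (n - d) × M => q.1) hT hfst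
      (by simp)
    have e := inTangentCoordinates_model_space (I := 𝓡 (n - d)) (I' := 𝓡 (Γ.one x₀).dim)
      (fun q : Eu (n - d) × M => q.1) (fun q => T q q.1)
      (fun q => mderiv (n := n - d) (T q) q.1) q₀
    exact e ▸ this
  refine h1.congr_of_eventuallyEq ?_
  have hN : ∀ᶠ r in 𝓝 r₀, (r.2, r.1.2) ∈ ψ.source ∧ ψ r.1 ∈ U₁ ∧ P r ∈ U₂ := by
    have c1 : ContinuousAt (fun r : (Eu (n - d) × M) × Eu (n - d) => (r.2, r.1.2)) r₀ := by
      fun_prop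
    have c2 : ContinuousAt (fun r : (Eu (n - d) × M) × Eu (n - d) => ψ r.1) r₀ :=
      ContinuousAt.comp (g := ψ) (f := Prod.fst) (hψ.contMDiffAt hq₀).continuousAt
        continuousAt_fst
    exact Filter.inter_mem (c1 (ψ.open_source.mem_nhds hq₀)) (Filter.inter_mem
      (c2 (hU₁.mem_nhds hk)) (hP.continuousAt (hU₂.mem_nhds (by rw [hP0]; exact hF))))
  have c3 : ContinuousAt (fun q : Eu (n - d) × M => (q, q.1)) q₀ := by fun_prop
  have hsrc : ContinuousAt (fun q => Γ.one (Γ.src (incl n (ψ q)))) q₀ :=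
    Γ.continuous_one.continuousAt.comp ((Γ.smooth_src n).continuous.continuousAt.comp
      (hψ.contMDiffAt hq₀).continuousAt)
  -- For q near q₀ the representatives must be valid for all u near q.1, since a derivative in u is
  -- compared; hence the iterated neighbourhood.
  filter_upwards [c3 (eventually_eventually_nhds.2 hN), ψ.open_source.mem_nhds hq₀,
    hsrc ((isOpen_unitDomain x₀).mem_nhds h₀)] with q hq hqs hqd
  have hd := hasMFDerivAt_vertDeriv hqd (hψ.hasTDeriv_fiber hqs) (hψ.eventually_tgt hqs)
  refine (hd.congr_of_eventuallyEq ?_).mfderiv.symm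
  have c4 : ContinuousAt (fun u : Eu (n - d) => (q, u)) q.1 := by fun_prop
  filter_upwards [c4 hq] with u ⟨hu1, hu2, hu3⟩
  rw [hJ1 _ hu2, hF1 _ hu3]
  · exact (unitChart_incl x₀ _).symm
  · rw [← hJ1 _ hu2, Γ.src_inv, hψ.2.2 _ hu1, hψ.2.2 _ hqs]

end DiffGroupoid

namespace DiffGroupoid

variable {d : ℕ} {M : Type v} [TopologicalSpace M] [ChartedSpace (Eu d) M]
  [IsManifold (𝓡 d) ∞ M] {A : ℕ → Type u} [∀ n, TopologicalSpace (A n)]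
  [∀ n, ChartedSpace (Eu n) (A n)] [∀ n, IsManifold (𝓡 n) ∞ (A n)]
  {Γ : DiffGroupoid d M A}

/-! ### A left-invariant volume density -/

variable (Γ) in
/-- Invariance of a density under left translations. -/
def IsLeftInvariantDensity (τ : ∀ g : MixedManifold A, (Fin (g.dim - d) → Eu g.dim) → ℝ) : Prop :=
  ∀ (n : ℕ) (g : MixedManifold A) (a b : A n) (G : Eu (n - d) → MixedManifold A) (z₀ : Eu (n - d))
    (L L' : Eu (n - d) →L[ℝ] Eu n), HasTDeriv (𝓡 (n - d)) G z₀ (incl n a) L →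
    (∀ᶠ x in 𝓝 z₀, Γ.src g = Γ.tgt (G x)) → Γ.mul g (incl n a) = incl n b →
    HasTDeriv (𝓡 (n - d)) (fun x => Γ.mul g (G x)) z₀ (incl n b) L' →
    ∀ c : Fin (n - d) → Eu (n - d),
      τ (incl n b) (fun i => L' (c i)) = τ (incl n a) (fun i => L (c i))

variable (Γ) in
/-- The density obtained by left translation of a density along the units. -/
def leftDensity (ρ : SmoothPartitionOfUnity M (𝓡 d) M univ) (g : MixedManifold A)
    (v : Fin (g.dim - d) → Eu g.dim) : ℝ :=
  ∑ᶠ x₀, ρ x₀ (Γ.src g) * gramVolume fun i => Γ.vertDeriv x₀ g (v i)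

section LeftDensity

variable {ρ : SmoothPartitionOfUnity M (𝓡 d) M univ}

theorem leftDensity_eq_sum {g : MixedManifold A} {t : Finset M} (ht : ρ.finsupport (Γ.src g) ⊆ t)
    (v : Fin (g.dim - d) → Eu g.dim) : Γ.leftDensity ρ g v =
      ∑ x₀ ∈ t, ρ x₀ (Γ.src g) * gramVolume fun i => Γ.vertDeriv x₀ g (v i) := by
  refine finsum_eq_sum_of_support_subset _ fun x₀ hx₀ => ht ?_
  rw [SmoothPartitionOfUnity.mem_finsupport]
  exact left_ne_zero_of_mul hx₀

theorem one_src_mem_unitDomain (hρ : ρ.IsSubordinate fun x₀ => Γ.one ⁻¹' Γ.unitDomain x₀)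
    {x₀ x : M} (h : ρ x₀ x ≠ 0) : Γ.one x ∈ Γ.unitDomain x₀ :=
  hρ x₀ (subset_tsupport _ h)

theorem isLeftInvariantDensity_leftDensity
    (hρ : ρ.IsSubordinate fun x₀ => Γ.one ⁻¹' Γ.unitDomain x₀) :
    Γ.IsLeftInvariantDensity (Γ.leftDensity ρ) := by
  intro n g a b G z₀ L L' h e hz h' c
  have h0 : Γ.src g = Γ.tgt (incl n a) := by rw [← h.1]; exact e.self_of_nhds
  have hs : Γ.src (incl n b) = Γ.src (incl n a) := by rw [← hz, Γ.src_mul _ _ h0]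
  refine finsum_congr fun x₀ => ?_
  rw [hs]
  by_cases hx : ρ x₀ (Γ.src (incl n a)) = 0
  · rw [hx, zero_mul, zero_mul]
  · refine congrArg (fun w => _ * gramVolume w) (funext fun i => ?_)
    exact vertDeriv_mul (one_src_mem_unitDomain hρ hx) h e hz h' (c i)

/-- Scaling comes from the Gram volume. Positivity holds because the terms are non-negative and some
weight is positive. Smoothness holds because only finitely many terms matter locally and Gram volume
is smooth at independent tuples. -/
theorem isVolumeDensity_leftDensity
    (hρ : ρ.IsSubordinate fun x₀ => Γ.one ⁻¹' Γ.unitDomain x₀) :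
    Γ.IsVolumeDensity (Γ.leftDensity ρ) where
  homogeneous g v hv a := by
    rw [leftDensity_eq_sum Finset.Subset.rfl, leftDensity_eq_sum Finset.Subset.rfl, Finset.mul_sum]
    refine Finset.sum_congr rfl fun x₀ _ => ?_
    have := gramVolume_smul (fun i => Γ.vertDeriv x₀ g (v i)) a
    simp only [map_sum, map_smul]
    rw [this]
    ring
  pos g v hv hl := by
    rw [leftDensity_eq_sum Finset.Subset.rfl]
    obtain ⟨x₀, hx₀⟩ := ρ.exists_pos_of_mem (mem_univ (Γ.src g))
    refine Finset.sum_pos' (fun i _ => mul_nonneg (ρ.nonneg i _) (gramVolume_nonneg _))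
      ⟨x₀, (ρ.mem_finsupport _).2 hx₀.ne', mul_pos hx₀ (gramVolume_pos ?_)⟩
    exact linearIndependent_vertDeriv (one_src_mem_unitDomain hρ hx₀.ne') hv hl
  smooth n ψ hψ := by
    intro q hq
    refine ContMDiffAt.contMDiffWithinAt ?_
    have hsrc : ContMDiffAt ((𝓡 (n - d)).prod (𝓡 d)) (𝓡 d) ∞
        (fun q => Γ.src (incl n (ψ q))) q := (Γ.smooth_src n).contMDiffAt.comp q (hψ.contMDiffAt hq)
    -- The fixed index set consists of the indices whose closed supports contain the base point: it
    -- contains the indices active at nearby points, and each index in it has a usable unit chart.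
    have key : ContMDiffAt ((𝓡 (n - d)).prod (𝓡 d)) 𝓘(ℝ, ℝ) ∞
        (fun q' => ∑ x₀ ∈ ρ.fintsupport (Γ.src (incl n (ψ q))), ρ x₀ (Γ.src (incl n (ψ q'))) *
          gramVolume fun i => Γ.vertDeriv x₀ (incl n (ψ q')) (coordFrame n ψ q' i)) q := by
      refine ContMDiffAt.sum fun x₀ hx₀ => ?_
      have hx : Γ.one (Γ.src (incl n (ψ q))) ∈ Γ.unitDomain x₀ :=
        hρ x₀ ((ρ.mem_fintsupport_iff _ _).1 hx₀)
      have h1 : ContMDiffAt ((𝓡 (n - d)).prod (𝓡 d)) 𝓘(ℝ, ℝ) ∞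
        (fun q' => ρ x₀ (Γ.src (incl n (ψ q')))) q := (ρ x₀).contMDiff.contMDiffAt.comp q hsrc
      have h2 : ContMDiffAt ((𝓡 (n - d)).prod (𝓡 d))
          𝓘(ℝ, Fin (n - d) → Eu (Γ.one x₀).dim) ∞
          (fun q' i => Γ.vertDeriv x₀ (incl n (ψ q')) (coordFrame n ψ q' i)) q := by
        refine contMDiffAt_pi_space.2 fun i => ?_
        exact (contMDiffAt_vertDeriv_fiberDeriv hψ hq hx).clm_apply contMDiffAt_const
      have h3 := contDiffAt_gramVolume (linearIndependent_vertDeriv hx (hψ.ttgt_coordFrame hq)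
        (hψ.linearIndependent_coordFrame hq))
      exact h1.mul (ContMDiffAt.comp (g := gramVolume) (f := fun q' i =>
        Γ.vertDeriv x₀ (incl n (ψ q')) (coordFrame n ψ q' i)) q h3.contMDiffAt h2)
    refine key.congr_of_eventuallyEq ?_
    filter_upwards [hsrc.continuousAt (ρ.eventually_finsupport_subset (Γ.src (incl n (ψ q))))]
      with q' hq'
    exact leftDensity_eq_sum hq' _

end LeftDensity

variable (Γ) in
theorem exists_leftInvariantDensity [T2Space M] [SecondCountableTopology M] :
    ∃ τ, Γ.IsVolumeDensity τ ∧ Γ.IsLeftInvariantDensity τ := by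
  have : LocallyCompactSpace M := ChartedSpace.locallyCompactSpace (Eu d) M
  obtain ⟨ρ, hρ⟩ := SmoothPartitionOfUnity.exists_isSubordinate (𝓡 d) isClosed_univ
    (fun x₀ => Γ.one ⁻¹' Γ.unitDomain x₀)
    (fun x₀ => (isOpen_unitDomain x₀).preimage Γ.continuous_one)
    (fun x _ => mem_iUnion.2 ⟨x, one_mem_unitDomain x⟩)
  exact ⟨_, isVolumeDensity_leftDensity hρ, isLeftInvariantDensity_leftDensity hρ⟩

/-! ### Change of variables along the target fibers -/

/-- Left translation embeds the vertical space at k into the one at gk. With the reverse inequality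
from g⁻¹, the fiber coordinates on both sides have equal dimension, as the change of variables
requires. -/
theorem dim_le_dim_mul {g k : MixedManifold A} (h : Γ.src g = Γ.tgt k) :
    k.dim ≤ (Γ.mul g k).dim := by
  obtain ⟨n, a, ha⟩ : ∃ n, ∃ a : A n, incl n a = k := ⟨k.dim, k.pt, rfl⟩
  obtain ⟨n', b, hb⟩ : ∃ n, ∃ a : A n, incl n a = Γ.mul g k := ⟨_, (Γ.mul g k).pt, rfl⟩
  rw [← hb]
  subst ha
  show n ≤ n'
  obtain ⟨ψ, hψ, ha'⟩ := Γ.exists_targetTrivialization a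
  obtain ⟨q, hq, rfl⟩ : ∃ q ∈ ψ.source, ψ q = a := ⟨_, ψ.map_target ha', ψ.right_inv ha'⟩
  obtain ⟨ψ', hψ', hb'⟩ := Γ.exists_targetTrivialization b
  obtain ⟨q', hq', rfl⟩ : ∃ q ∈ ψ'.source, ψ' q = b := ⟨_, ψ'.map_target hb', ψ'.right_inv hb'⟩
  have e : ∀ᶠ u in 𝓝 q.1, Γ.src g = Γ.tgt (incl n (ψ (u, q.2))) :=
    (hψ.eventually_tgt hq).mono fun u hu => by rw [hu, h]
  have h1 := hasTDeriv_mul_left (hψ.hasTDeriv_fiber hq) e hb.symm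
  obtain ⟨L, hL⟩ : ∃ L : Eu (n - d) →L[ℝ] Eu n', L = ((Γ.tmul g (incl n (ψ q))
    (incl n' (ψ' q'))).comp (ContinuousLinearMap.inr ℝ (Eu g.dim) (Eu n))).comp
      (fiberDeriv ψ q) := ⟨_, rfl⟩
  have hinj : Function.Injective L := by
    rw [injective_iff_map_eq_zero]
    intro c hc
    rw [hL] at hc
    have := tmul_inr_injective (hψ.hasTDeriv_fiber hq) e hb.symm hc
    exact hψ.injective_fiberDeriv hq (this.trans (map_zero _).symm)
  have hker : ∀ c, Γ.ttgt (incl n' (ψ' q')) (L c) = 0 := by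
    intro c
    have h2 := h1.tgt Γ
    have h3 : HasMFDerivAt (𝓡 (n - d)) (𝓡 d) (fun u : Eu (n - d) =>
        Γ.tgt (Γ.mul g (incl n (ψ (u, q.2))))) q.1 (0 : Eu (n - d) →L[ℝ] Eu d) := by
      refine (hasMFDerivAt_const (Γ.tgt g) q.1).congr_of_eventuallyEq ?_
      filter_upwards [e] with u hu using Γ.tgt_mul _ _ hu
    rw [hL]
    exact congrArg (fun T : Eu (n - d) →L[ℝ] Eu d => T c) (hasMFDerivAt_unique h2 h3)
  have hr : LinearMap.range L.toLinearMap ≤ LinearMap.range (fiberDeriv ψ' q').toLinearMap := by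
    rintro _ ⟨c, rfl⟩
    exact hψ'.exists_fiberDeriv_eq hq' (hker c)
  have h4 := Submodule.finrank_mono hr
  rw [LinearMap.finrank_range_of_inj (show Function.Injective L.toLinearMap from hinj)] at h4
  have h5 := LinearMap.finrank_range_le (fiberDeriv ψ' q').toLinearMap
  have h6 := Γ.le_dim (ψ q)
  have h7 := Γ.le_dim (ψ' q')
  simp only [finrank_euclideanSpace, Fintype.card_fin] at h4 h5
  omega

theorem dim_mul {g k : MixedManifold A} (h : Γ.src g = Γ.tgt k) : (Γ.mul g k).dim = k.dim := by
  refine le_antisymm ?_ (dim_le_dim_mul h)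
  have := dim_le_dim_mul (Γ := Γ) (g := Γ.inv g) (k := Γ.mul g k)
    (by rw [Γ.src_inv, Γ.tgt_mul _ _ h])
  rwa [Γ.inv_mul_cancel_left h] at this

/-- The coordinates of the points of a set that lie in the target fiber over `x`. -/
def fiberSet {n : ℕ} (ψ : OpenPartialHomeomorph (Eu (n - d) × M) (A n)) (x : M)
    (B : Set (MixedManifold A)) : Set (Eu (n - d)) :=
  {u | (u, x) ∈ ψ.source ∧ incl n (ψ (u, x)) ∈ B}

theorem measurableSet_fiberSet {n : ℕ} (ψ : OpenPartialHomeomorph (Eu (n - d) × M) (A n)) (x : M)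
    {B : Set (MixedManifold A)} (hB : MeasurableSet B) : MeasurableSet (fiberSet ψ x B) := by
  have := (isOpen_fiberDomain ψ x).measurableSet.subtype_image
    ((isEmbedding_fiberMap ψ x).continuous.measurable hB)
  convert this using 1
  ext u
  constructor
  · rintro ⟨h1, h2⟩
    exact ⟨⟨u, h1⟩, h2, rfl⟩
  · rintro ⟨⟨u, h1⟩, h2, rfl⟩
    exact ⟨h1, h2⟩

/-- The value of a density on a transformed coordinate frame. -/
theorem IsVolumeDensity.apply_comp {τ : ∀ g : MixedManifold A, (Fin (g.dim - d) → Eu g.dim) → ℝ}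
    (hτ : Γ.IsVolumeDensity τ) {n : ℕ} {ψ : OpenPartialHomeomorph (Eu (n - d) × M) (A n)}
    (hψ : Γ.IsTargetTrivialization n ψ) {q : Eu (n - d) × M} (hq : q ∈ ψ.source)
    (T : Eu (n - d) →L[ℝ] Eu (n - d)) :
    τ (incl n (ψ q)) (fun i => fiberDeriv ψ q (T (EuclideanSpace.single i 1))) =
      |T.det| * coordDensity τ n ψ q := by
  have h1 := hτ.homogeneous (incl n (ψ q)) (coordFrame n ψ q) (hψ.ttgt_coordFrame hq)
    (fun i j => T (EuclideanSpace.single i 1) j)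
  have h2 : Matrix.det (fun i j : Fin (n - d) => T (EuclideanSpace.single i 1) j) = T.det := by
    rw [ContinuousLinearMap.det, ← LinearMap.det_toMatrix
      (EuclideanSpace.basisFun (Fin (n - d)) ℝ).toBasis, ← Matrix.det_transpose]
    congr 1
  rw [h2] at h1
  rw [coordDensity, ← h1]
  congr 1
  ext1 i
  have h3 : T (EuclideanSpace.single i 1) = ∑ j, T (EuclideanSpace.single i 1) j •
      EuclideanSpace.single j (1 : ℝ) := by
    have := (EuclideanSpace.basisFun (Fin (n - d)) ℝ).sum_repr (T (EuclideanSpace.single i 1))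
    simpa using this.symm
  conv_lhs => rw [h3]
  rw [map_sum]
  simp only [map_smul]
  rfl

/-- In coordinates left translation is a map Θ between open pieces of Euclidean space. Invariance of
τ says that the coordinate densities differ by |det DΘ|, and the change of variables formula
concludes. -/
theorem lintegral_coordDensity_mul
    {τ : ∀ g : MixedManifold A, (Fin (g.dim - d) → Eu g.dim) → ℝ}
    (hτ : Γ.IsVolumeDensity τ) (hτi : Γ.IsLeftInvariantDensity τ) {n n' : ℕ}
    {ψ : OpenPartialHomeomorph (Eu (n - d) × M) (A n)} (hψ : Γ.IsTargetTrivialization n ψ)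
    {ψ' : OpenPartialHomeomorph (Eu (n' - d) × M) (A n')} (hψ' : Γ.IsTargetTrivialization n' ψ')
    (g : MixedManifold A) {B : Set (MixedManifold A)} (hB : MeasurableSet B)
    (hBt : ∀ k ∈ B, Γ.tgt k = Γ.src g) (hBψ : B ⊆ incl n '' ψ.target)
    (hgB : Γ.mul g '' B ⊆ incl n' '' ψ'.target) :
    ∫⁻ u in fiberSet ψ' (Γ.tgt g) (Γ.mul g '' B),
        ENNReal.ofReal (coordDensity τ n' ψ' (u, Γ.tgt g)) =
      ∫⁻ u in fiberSet ψ (Γ.src g) B, ENNReal.ofReal (coordDensity τ n ψ (u, Γ.src g)) := by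
  rcases B.eq_empty_or_nonempty with rfl | ⟨k₀, hk₀⟩
  · simp [fiberSet]
  obtain ⟨a₀, ha₀, hk₀e⟩ := hBψ hk₀
  obtain ⟨b₀, hb₀, hb₀e⟩ := hgB ⟨k₀, hk₀, rfl⟩
  obtain rfl : n' = n := by
    have h1 := dim_mul (hBt k₀ hk₀).symm
    rw [← hb₀e, ← hk₀e] at h1
    exact h1
  have hinj := (isOpenEmbedding_incl (A := A) n').injective
  -- The arrow `a₀` only names the part of dimension `n'`; the arbitrary value of `part` elsewhere
  -- is never met on the coordinates of `B`.
  let Θ : Eu (n' - d) → Eu (n' - d) := fun u =>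
    (ψ'.symm (part (incl n' a₀) (Γ.mul g (incl n' (ψ (u, Γ.src g)))))).1
  have hΘ : ∀ u b, b ∈ ψ'.target → Γ.mul g (incl n' (ψ (u, Γ.src g))) = incl n' b →
      (u, Γ.src g) ∈ ψ.source → (Θ u, Γ.tgt g) ∈ ψ'.source ∧ ψ' (Θ u, Γ.tgt g) = b := by
    intro u b hb hub hu
    have h1 : Θ u = (ψ'.symm b).1 := congrArg (fun a => (ψ'.symm a).1) (part_eq hub)
    have h2 : (Θ u, Γ.tgt g) = ψ'.symm b := by
      refine Prod.ext h1 ?_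
      rw [hψ'.symm_snd hb, ← hub, Γ.tgt_mul _ _ (hψ.2.2 _ hu).symm]
    rw [h2]
    exact ⟨ψ'.map_target hb, ψ'.right_inv hb⟩
  have hΘS : ∀ u ∈ fiberSet ψ (Γ.src g) B, (Θ u, Γ.tgt g) ∈ ψ'.source ∧
      incl n' (ψ' (Θ u, Γ.tgt g)) = Γ.mul g (incl n' (ψ (u, Γ.src g))) := by
    rintro u ⟨hu, huB⟩
    obtain ⟨b, hb, hbe⟩ := hgB ⟨_, huB, rfl⟩
    obtain ⟨h1, h2⟩ := hΘ u b hb hbe.symm hu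
    exact ⟨h1, by rw [h2]; exact hbe⟩
  have himage : Θ '' fiberSet ψ (Γ.src g) B = fiberSet ψ' (Γ.tgt g) (Γ.mul g '' B) := by
    ext u'
    constructor
    · rintro ⟨u, hu, rfl⟩
      exact ⟨(hΘS u hu).1, _, hu.2, (hΘS u hu).2.symm⟩
    · rintro ⟨hu', k, hk, hke⟩
      obtain ⟨a, ha, rfl⟩ := hBψ hk
      have h1 : ψ.symm a = ((ψ.symm a).1, Γ.src g) :=
        Prod.ext rfl (by rw [hψ.symm_snd ha, hBt _ hk])
      have h2 : (ψ.symm a).1 ∈ fiberSet ψ (Γ.src g) B := by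
        refine ⟨?_, ?_⟩
        · rw [← h1]; exact ψ.map_target ha
        · rw [← h1, ψ.right_inv ha]; exact hk
      refine ⟨_, h2, ?_⟩
      have h3 := (hΘS _ h2).2
      rw [← h1, ψ.right_inv ha, hke] at h3
      exact congrArg Prod.fst (ψ'.injOn (hΘS _ h2).1 hu' (hinj h3))
  have hinjOn : InjOn Θ (fiberSet ψ (Γ.src g) B) := by
    intro u₁ h₁ u₂ h₂ h
    have h3 : Γ.mul g (incl n' (ψ (u₁, Γ.src g))) = Γ.mul g (incl n' (ψ (u₂, Γ.src g))) := by
      rw [← (hΘS _ h₁).2, ← (hΘS _ h₂).2, h]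
    have h4 := congrArg (Γ.mul (Γ.inv g)) h3
    rw [Γ.inv_mul_cancel_left (hψ.2.2 _ h₁.1).symm, Γ.inv_mul_cancel_left (hψ.2.2 _ h₂.1).symm] at h4
    exact congrArg Prod.fst (ψ.injOn h₁.1 h₂.1 (hinj h4))
  have key : ∀ u ∈ fiberSet ψ (Γ.src g) B, ∃ T : Eu (n' - d) →L[ℝ] Eu (n' - d),
      HasFDerivAt Θ T u ∧ coordDensity τ n' ψ (u, Γ.src g) =
        |T.det| * coordDensity τ n' ψ' (Θ u, Γ.tgt g) := by
    intro u hu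
    have e : ∀ᶠ u' in 𝓝 u, (u', Γ.src g) ∈ ψ.source :=
      ψ.eventually_mk_mem_source (q := (u, Γ.src g)) hu.1
    have et : ∀ᶠ u' in 𝓝 u, Γ.src g = Γ.tgt (incl n' (ψ (u', Γ.src g))) :=
      e.mono fun u' hu' => (hψ.2.2 _ hu').symm
    have h1 := hψ.hasTDeriv_fiber (q := (u, Γ.src g)) hu.1
    obtain ⟨hs, hm⟩ := hΘS u hu
    have h2 := hasTDeriv_mul_left h1 et hm.symm
    obtain ⟨L', hL'⟩ : ∃ L' : Eu (n' - d) →L[ℝ] Eu n', L' = ((Γ.tmul g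
      (incl n' (ψ (u, Γ.src g))) (incl n' (ψ' (Θ u, Γ.tgt g)))).comp
      (ContinuousLinearMap.inr ℝ (Eu g.dim) (Eu n'))).comp (fiberDeriv ψ (u, Γ.src g)) := ⟨_, rfl⟩
    rw [show _ = L' from hL'.symm] at h2
    obtain ⟨f, hf0, hf1, hf2⟩ := h2.exists_rep
    change f u = ψ' (Θ u, Γ.tgt g) at hf0
    have hfΘ : ∀ᶠ u' in 𝓝 u, Θ u' = (ψ'.symm (f u')).1 := by
      filter_upwards [hf1] with u' hu'
      exact congrArg (fun a => (ψ'.symm a).1) (part_eq hu')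
    have hb : f u ∈ ψ'.target := by rw [hf0]; exact ψ'.map_source hs
    have h3 : HasMFDerivAt (𝓡 n') ((𝓡 (n' - d)).prod (𝓡 d)) ψ'.symm (f u) (mfderiv _ _ _ _) :=
      ((hψ'.contMDiffAt_symm hb).mdifferentiableAt (by simp)).hasMFDerivAt
    have h4 := (hasMFDerivAt_fst (ψ'.symm (f u))).comp u (h3.comp u hf2)
    obtain ⟨T, hT⟩ : ∃ T : Eu (n' - d) →L[ℝ] Eu (n' - d), HasMFDerivAt (𝓡 (n' - d)) (𝓡 (n' - d))
      Θ u T := ⟨_, h4.congr_of_eventuallyEq hfΘ⟩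
    refine ⟨T, hasMFDerivAt_iff_hasFDerivAt.1 hT, ?_⟩
    have h5 := (hψ'.hasTDeriv_fiber hs).comp hT rfl
    have h6 : ∀ᶠ u' in 𝓝 u, Γ.mul g (incl n' (ψ (u', Γ.src g))) =
        incl n' (ψ' (Θ u', Γ.tgt g)) := by
      filter_upwards [hf1, e, hf2.continuousAt (ψ'.open_target.mem_nhds hb)] with u' k1 k2 k3
      rw [(hΘ u' (f u') k3 k1 k2).2]
      exact k1
    have h7 := h2.unique (h5.congr h6)
    have h8 := hτi n' g _ _ _ _ _ _ h1 et hm.symm h2 fun i => EuclideanSpace.single i 1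
    rw [← hτ.apply_comp hψ' hs T]
    refine h8.symm.trans ?_
    rw [h7]
    rfl
  choose! T hT hTd using key
  rw [← himage, lintegral_image_eq_lintegral_abs_det_fderiv_mul volume
    (measurableSet_fiberSet ψ _ hB) (fun u hu => (hT u hu).hasFDerivWithinAt) hinjOn]
  refine setLIntegral_congr_fun (measurableSet_fiberSet ψ _ hB) fun u hu => ?_
  simp only [hTd u hu, ENNReal.ofReal_mul (abs_nonneg _)]

end DiffGroupoid

/-- Gluing of measures that agree on the overlaps of a countable measurable cover. -/
theorem MeasureTheory.Measure.exists_restrict_eq {X ι : Type*} [MeasurableSpace X] [Countable ι]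
    {C : ι → Set X} (hC : ∀ i, MeasurableSet (C i)) (hU : ⋃ i, C i = univ) (m : ι → Measure X)
    (h : ∀ i j B, MeasurableSet B → B ⊆ C i → B ⊆ C j → m i B = m j B) :
    ∃ μ : Measure X, ∀ i B, MeasurableSet B → B ⊆ C i → μ B = m i B := by
  rcases isEmpty_or_nonempty ι with hι | hι
  · exact ⟨0, fun i => isEmptyElim i⟩
  obtain ⟨f, hf⟩ := exists_surjective_nat ι
  have hD : ∀ n, MeasurableSet (disjointed (C ∘ f) n) := fun n =>
    MeasurableSet.disjointed (fun k => hC (f k)) n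
  -- Enumerate the cover and use each local measure only on what earlier members miss; repetitions
  -- in the enumeration contribute empty sets.
  refine ⟨Measure.sum fun n => (m (f n)).restrict (disjointed (C ∘ f) n), fun i B hB hBC => ?_⟩
  have h1 : B = ⋃ n, B ∩ disjointed (C ∘ f) n := by
    rw [← inter_iUnion, iUnion_disjointed, show ⋃ n, (C ∘ f) n = univ from (hf.iUnion_comp C).trans hU,
      inter_univ]
  rw [Measure.sum_apply _ hB]
  conv_rhs => rw [h1]
  rw [measure_iUnion]
  · refine tsum_congr fun n => ?_
    rw [Measure.restrict_apply hB]
    exact h _ _ _ (hB.inter (hD n)) (inter_subset_right.trans (disjointed_subset (C ∘ f) n))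
      (inter_subset_left.trans hBC)
  · intro a b hab
    exact ((disjoint_disjointed (C ∘ f)) hab).mono inter_subset_right inter_subset_right
  · exact fun n => hB.inter (hD n)

namespace DiffGroupoid

variable {d : ℕ} {M : Type v} [TopologicalSpace M] [ChartedSpace (Eu d) M]
  [IsManifold (𝓡 d) ∞ M] {A : ℕ → Type u} [∀ n, TopologicalSpace (A n)]
  [∀ n, ChartedSpace (Eu n) (A n)] [∀ n, IsManifold (𝓡 n) ∞ (A n)]
  {Γ : DiffGroupoid d M A}

/-! ### Existence of left Haar systems -/

/-- The measure on the target fiber over `x` that a density gives in a target trivialization. -/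
def chartMeasure (τ : ∀ g : MixedManifold A, (Fin (g.dim - d) → Eu g.dim) → ℝ) {n : ℕ}
    (ψ : OpenPartialHomeomorph (Eu (n - d) × M) (A n)) (x : M) : Measure (MixedManifold A) :=
  (((volume : Measure (Eu (n - d))).comap ((↑) : fiberDomain ψ x → Eu (n - d))).withDensity
    fun u => ENNReal.ofReal (coordDensity τ n ψ (u.1, x))).map (fiberMap ψ x)

theorem chartMeasure_apply (τ : ∀ g : MixedManifold A, (Fin (g.dim - d) → Eu g.dim) → ℝ) {n : ℕ}
    (ψ : OpenPartialHomeomorph (Eu (n - d) × M) (A n)) (x : M) {B : Set (MixedManifold A)}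
    (hB : MeasurableSet B) : chartMeasure τ ψ x B =
      ∫⁻ u in fiberSet ψ x B, ENNReal.ofReal (coordDensity τ n ψ (u, x)) := by
  have hm := (isEmbedding_fiberMap ψ x).continuous.measurable
  rw [chartMeasure, Measure.map_apply hm hB, withDensity_apply _ (hm hB),
    setLIntegral_subtype (isOpen_fiberDomain ψ x).measurableSet (fiberMap ψ x ⁻¹' B)
      (fun u => ENNReal.ofReal (coordDensity τ n ψ (u, x)))]
  refine congrArg (fun s => ∫⁻ u in s, ENNReal.ofReal (coordDensity τ n ψ (u, x))) ?_
  ext u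
  constructor
  · rintro ⟨⟨u, hu⟩, hB, rfl⟩
    exact ⟨hu, hB⟩
  · rintro ⟨hu, hB⟩
    exact ⟨⟨u, hu⟩, hB, rfl⟩

theorem image_mul_left_eq (g : MixedManifold A) {B : Set (MixedManifold A)}
    (hB : ∀ k ∈ B, Γ.tgt k = Γ.src g) :
    Γ.mul g '' B = {k | Γ.tgt k = Γ.src (Γ.inv g)} ∩ Γ.mul (Γ.inv g) ⁻¹' B := by
  ext h
  constructor
  · rintro ⟨k, hk, rfl⟩
    refine ⟨?_, ?_⟩
    · rw [mem_ofPred_eq, Γ.tgt_mul _ _ (hB k hk).symm, Γ.src_inv]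
    · rw [mem_preimage, Γ.inv_mul_cancel_left (hB k hk).symm]; exact hk
  · rintro ⟨h1, h2⟩
    rw [mem_ofPred_eq, Γ.src_inv] at h1
    exact ⟨_, h2, Γ.mul_inv_cancel_left h1.symm⟩

variable [T2Space M] {τ : ∀ g : MixedManifold A, (Fin (g.dim - d) → Eu g.dim) → ℝ}

theorem chartMeasure_fiber {n : ℕ} {ψ : OpenPartialHomeomorph (Eu (n - d) × M) (A n)}
    (hψ : Γ.IsTargetTrivialization n ψ) (x : M) {B : Set (MixedManifold A)}
    (hB : MeasurableSet B) :
    chartMeasure τ ψ x B = chartMeasure τ ψ x (B ∩ {k | Γ.tgt k = x}) := by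
  rw [chartMeasure_apply τ ψ x hB, chartMeasure_apply τ ψ x
    (hB.inter (isClosed_setOf_tgt_eq x).measurableSet)]
  congr 2
  ext u
  exact ⟨fun h => ⟨h.1, h.2, hψ.2.2 _ h.1⟩, fun h => ⟨h.1, h.2.1⟩⟩

theorem measurableSet_mul_left_image (g : MixedManifold A) {B : Set (MixedManifold A)}
    (hB : MeasurableSet B) (hBt : ∀ k ∈ B, Γ.tgt k = Γ.src g) :
    MeasurableSet (Γ.mul g '' B) := by
  rw [image_mul_left_eq g hBt]
  exact measurableSet_mul_left_preimage _ hB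

theorem chartMeasure_mul (hτ : Γ.IsVolumeDensity τ) (hτi : Γ.IsLeftInvariantDensity τ) {n n' : ℕ}
    {ψ : OpenPartialHomeomorph (Eu (n - d) × M) (A n)} (hψ : Γ.IsTargetTrivialization n ψ)
    {ψ' : OpenPartialHomeomorph (Eu (n' - d) × M) (A n')} (hψ' : Γ.IsTargetTrivialization n' ψ')
    (g : MixedManifold A) {B : Set (MixedManifold A)} (hB : MeasurableSet B)
    (hBt : ∀ k ∈ B, Γ.tgt k = Γ.src g) (hBψ : B ⊆ incl n '' ψ.target)
    (hgB : Γ.mul g '' B ⊆ incl n' '' ψ'.target) :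
    chartMeasure τ ψ' (Γ.tgt g) (Γ.mul g '' B) = chartMeasure τ ψ (Γ.src g) B := by
  rw [chartMeasure_apply τ ψ _ hB, chartMeasure_apply τ ψ' _ (measurableSet_mul_left_image g hB hBt)]
  exact lintegral_coordDensity_mul hτ hτi hψ hψ' g hB hBt hBψ hgB

/-- Independence of the chart is the case of left translation by the unit at `x`. -/
theorem chartMeasure_congr (hτ : Γ.IsVolumeDensity τ) (hτi : Γ.IsLeftInvariantDensity τ)
    {n n' : ℕ} {ψ : OpenPartialHomeomorph (Eu (n - d) × M) (A n)}
    (hψ : Γ.IsTargetTrivialization n ψ) {ψ' : OpenPartialHomeomorph (Eu (n' - d) × M) (A n')}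
    (hψ' : Γ.IsTargetTrivialization n' ψ') (x : M) {B : Set (MixedManifold A)}
    (hB : MeasurableSet B) (hBψ : B ⊆ incl n '' ψ.target) (hBψ' : B ⊆ incl n' '' ψ'.target) :
    chartMeasure τ ψ x B = chartMeasure τ ψ' x B := by
  rw [chartMeasure_fiber hψ x hB, chartMeasure_fiber hψ' x hB]
  have he : Γ.mul (Γ.one x) '' (B ∩ {k | Γ.tgt k = x}) = B ∩ {k | Γ.tgt k = x} := by
    refine (image_congr fun k hk => ?_).trans (image_id _)
    obtain ⟨-, rfl⟩ := hk
    exact Γ.one_mul k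
  have := chartMeasure_mul hτ hτi hψ hψ' (Γ.one x)
    (hB.inter (isClosed_setOf_tgt_eq (Γ := Γ) x).measurableSet)
    (fun k hk => by rw [Γ.src_one]; exact hk.2) (inter_subset_left.trans hBψ)
    (by rw [he]; exact inter_subset_left.trans hBψ')
  rw [he, Γ.src_one, Γ.tgt_one] at this
  exact this.symm

variable (Γ) in
-- Second countability gives a countable cover by trivializations, on which the chart measures agree
-- and glue. Left invariance is then checked on pieces small enough to use one chart before and one
-- after translation.
theorem exists_isLeftHaarSystem [∀ n, SecondCountableTopology (A n)]
    (hτ : Γ.IsVolumeDensity τ) (hτi : Γ.IsLeftInvariantDensity τ) :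
    ∃ μ, Γ.IsLeftHaarSystem μ := by
  have : SecondCountableTopology (MixedManifold A) :=
    inferInstanceAs (SecondCountableTopology (Σ n, A n))
  choose ψ hψ hmem using fun k : MixedManifold A => Γ.exists_targetTrivialization k.pt
  let C : MixedManifold A → Set (MixedManifold A) := fun k => incl k.dim '' (ψ k).target
  have hCm : ∀ k, MeasurableSet (C k) := fun k => measurableSet_image_target (ψ k)
  obtain ⟨s, hs, hsU⟩ := TopologicalSpace.countable_cover_nhds (f := C) fun k =>
    ((isOpenEmbedding_incl _).isOpenMap _ (ψ k).open_target).mem_nhds ⟨k.pt, hmem k, rfl⟩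
  have := hs.to_subtype
  have hU : ⋃ i : s, C i = univ := by rw [← hsU, biUnion_eq_iUnion]
  choose μ hμ using fun x => Measure.exists_restrict_eq (C := fun i : s => C i)
    (fun i => hCm i) hU (fun i => chartMeasure τ (ψ i) x) fun i j B hB h1 h2 =>
      chartMeasure_congr hτ hτi (hψ i) (hψ j) x hB h1 h2
  have hformula : ∀ n (φ : OpenPartialHomeomorph (Eu (n - d) × M) (A n)),
      Γ.IsTargetTrivialization n φ → ∀ x (B : Set (MixedManifold A)), MeasurableSet B →
      B ⊆ incl n '' φ.target → μ x B = chartMeasure τ φ x B := by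
    intro n φ hφ x B hB hBφ
    have : (μ x).restrict B = (chartMeasure τ φ x).restrict B := by
      refine (Measure.ext_iff_of_iUnion_eq_univ hU).2 fun i => ?_
      ext B' hB'
      have h1 : MeasurableSet (B' ∩ C i ∩ B) := (hB'.inter (hCm i)).inter hB
      rw [Measure.restrict_apply hB', Measure.restrict_apply hB',
        Measure.restrict_apply (hB'.inter (hCm i)), Measure.restrict_apply (hB'.inter (hCm i)),
        hμ x i _ h1 (inter_subset_left.trans inter_subset_right)]
      exact chartMeasure_congr hτ hτi (hψ i) hφ x h1 (inter_subset_left.trans inter_subset_right)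
        (inter_subset_right.trans hBφ)
    rw [← Measure.restrict_apply_self, this, Measure.restrict_apply_self]
  have hcarried : ∀ x, μ x {g | Γ.tgt g ≠ x} = 0 := by
    intro x
    have h0 : MeasurableSet {g | Γ.tgt g ≠ x} :=
      (isClosed_setOf_tgt_eq (Γ := Γ) x).measurableSet.compl
    have h1 : {g | Γ.tgt g ≠ x} ⊆ ⋃ i : s, {g | Γ.tgt g ≠ x} ∩ C i := by
      rw [← inter_iUnion, hU, inter_univ]
    refine measure_mono_null h1 (measure_iUnion_null fun i => ?_)
    rw [hμ x i _ (h0.inter (hCm i)) inter_subset_right,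
      chartMeasure_fiber (hψ i) x (h0.inter (hCm i))]
    have : {g | Γ.tgt g ≠ x} ∩ C i ∩ {k | Γ.tgt k = x} = ∅ := by
      ext k; simp; tauto
    rw [this, measure_empty]
  refine ⟨μ, hcarried, ⟨τ, hτ, fun n φ hφ x B hB hBφ => ?_⟩, ?_⟩
  · rw [hformula n φ hφ x B hB hBφ, chartMeasure_apply τ φ x hB]
    rfl
  intro g B hB hBt
  have hfib : ∀ x (B : Set (MixedManifold A)), μ x B = μ x ({k | Γ.tgt k = x} ∩ B) := by
    intro x B
    refine measure_congr ?_
    filter_upwards [show ∀ᵐ k ∂(μ x), Γ.tgt k = x from hcarried x] with k hk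
    exact propext ⟨fun h => ⟨hk, h⟩, fun h => h.2⟩
  have hae : AEMeasurable (Γ.mul (Γ.inv g)) (μ (Γ.tgt g)) := by
    rw [← Measure.restrict_eq_self_of_ae_mem (hcarried (Γ.tgt g)), ← Γ.src_inv]
    exact (continuousOn_mul_left (Γ.inv g)).aemeasurable (isClosed_setOf_tgt_eq _).measurableSet
  have himage : ∀ B : Set (MixedManifold A), MeasurableSet B → (∀ h ∈ B, Γ.tgt h = Γ.src g) →
      μ (Γ.tgt g) (Γ.mul g '' B) = (μ (Γ.tgt g)).map (Γ.mul (Γ.inv g)) B := by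
    intro B hB hBt
    rw [Measure.map_apply_of_aemeasurable hae hB, image_mul_left_eq g hBt, Γ.src_inv, ← hfib]
  let S : Set (MixedManifold A) := {k | Γ.tgt k = Γ.src g}
  have hS : MeasurableSet S := (isClosed_setOf_tgt_eq (Γ := Γ) (Γ.src g)).measurableSet
  -- Each piece lies in one chart and its translate lies in one chart; countably many such pieces
  -- cover the fiber over `Γ.src g`.
  let D : s × s → Set (MixedManifold A) := fun i => C i.1 ∩ (S ∩ Γ.mul g ⁻¹' C i.2)
  have hD : ∀ i, MeasurableSet (D i) := fun i =>
    (hCm i.1).inter (measurableSet_mul_left_preimage g (hCm i.2))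
  have hDU : ⋃ i, D i = S := by
    refine Subset.antisymm (iUnion_subset fun i k hk => hk.2.1) fun k hk => ?_
    obtain ⟨i, hi⟩ := mem_iUnion.1 (hU.symm ▸ mem_univ k : k ∈ ⋃ i : s, C i)
    obtain ⟨j, hj⟩ := mem_iUnion.1 (hU.symm ▸ mem_univ (Γ.mul g k) : Γ.mul g k ∈ ⋃ i : s, C i)
    exact mem_iUnion.2 ⟨(i, j), hi, hk, hj⟩
  have hres : ((μ (Γ.tgt g)).map (Γ.mul (Γ.inv g))).restrict S = (μ (Γ.src g)).restrict S := by
    rw [← hDU, Measure.restrict_iUnion_congr]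
    intro i
    ext B' hB'
    have h1 : MeasurableSet (B' ∩ D i) := hB'.inter (hD i)
    rw [Measure.restrict_apply hB', Measure.restrict_apply hB',
      ← himage _ h1 fun k hk => hk.2.2.1, hμ (Γ.src g) i.1 _ h1 fun k hk => hk.2.1,
      hμ (Γ.tgt g) i.2 _ (measurableSet_mul_left_image g h1 fun k hk => hk.2.2.1)
        (by rintro _ ⟨k, hk, rfl⟩; exact hk.2.2.2)]
    exact chartMeasure_mul hτ hτi (hψ i.1) (hψ i.2) g h1 (fun k hk => hk.2.2.1)
      (fun k hk => hk.2.1) (by rintro _ ⟨k, hk, rfl⟩; exact hk.2.2.2)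
  have hBS : B ∩ S = B := inter_eq_left.2 hBt
  rw [himage B hB hBt, ← hBS, ← Measure.restrict_apply hB, ← Measure.restrict_apply hB, hres]

end DiffGroupoid

namespace DiffGroupoid

variable {d : ℕ} {M : Type v} [TopologicalSpace M] [ChartedSpace (Eu d) M]
  [IsManifold (𝓡 d) ∞ M] {A : ℕ → Type u} [∀ n, TopologicalSpace (A n)]
  [∀ n, ChartedSpace (Eu n) (A n)] [∀ n, IsManifold (𝓡 n) ∞ (A n)]
  {Γ : DiffGroupoid d M A}

/-! ### Normalizing functions -/

/-- A proper groupoid has an open set in its base that meets every orbit, and whose intersection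
with the saturation of any compact set is relatively compact. -/
theorem IsProper.exists_isOpen_meeting [SecondCountableTopology M] (hΓ : Γ.IsProper) :
    ∃ O : Set M, IsOpen O ∧ (∀ x, ∃ k, Γ.tgt k = x ∧ Γ.src k ∈ O) ∧
      ∀ K, IsCompact K → ∃ L, IsCompact L ∧ ∀ k, Γ.src k ∈ O → Γ.tgt k ∈ K → Γ.src k ∈ L := by
  have : T2Space M := hΓ.2.1
  have : LocallyCompactSpace M := ChartedSpace.locallyCompactSpace (Eu d) M
  let K := CompactExhaustion.choice M
  -- The saturation of `K i`. It is closed: the anchor is a closed map, and projecting along the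
  -- compact factor `K i` is closed.
  let S : ℕ → Set M := fun i => Γ.tgt '' (Γ.src ⁻¹' K i)
  have hS : ∀ i, IsClosed (S i) := by
    intro i
    have h1 := hΓ.2.2.isClosedMap _ ((K.isCompact i).isClosed.preimage Γ.continuous_src)
    have h2 : (fun x : K i × M => x.2) '' ((fun x : K i × M => ((x.1 : M), x.2)) ⁻¹'
        ((fun g => (Γ.src g, Γ.tgt g)) '' (Γ.src ⁻¹' K i))) = S i := by
      ext y
      constructor
      · rintro ⟨⟨a, b⟩, ⟨g, hg, he⟩, rfl⟩
        exact ⟨g, hg, congrArg Prod.snd he⟩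
      · rintro ⟨g, hg, rfl⟩
        exact ⟨(⟨Γ.src g, hg⟩, Γ.tgt g), ⟨g, hg, rfl⟩, rfl⟩
    have : CompactSpace (K i) := isCompact_iff_compactSpace.1 (K.isCompact i)
    rw [← h2]
    exact isClosedMap_snd_of_compactSpace _ (h1.preimage (by fun_prop))
  -- An orbit may enter the j-th term only if it misses `K i` for every i < j. The first j for which
  -- the orbit meets the interior of `K (j + 1)` therefore works, and no later terms than a bounded
  -- number see a given compact set.
  let O : Set M := ⋃ j, interior (K (j + 1)) \ ⋃ i ∈ Finset.range j, S i
  refine ⟨O, isOpen_iUnion fun j => isOpen_interior.sdiff ?_, fun x => ?_, fun C hC => ?_⟩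
  · exact isClosed_biUnion_finset fun i _ => hS i
  · have hex : ∃ j, ∃ k, Γ.tgt k = x ∧ Γ.src k ∈ interior (K (j + 1)) := by
      obtain ⟨j, hj⟩ := K.exists_mem x
      exact ⟨j, Γ.one x, Γ.tgt_one x, by rw [Γ.src_one]; exact K.subset_interior_succ j hj⟩
    classical
    obtain ⟨k, hk, hks⟩ := Nat.find_spec hex
    refine ⟨k, hk, mem_iUnion.2 ⟨Nat.find hex, hks, ?_⟩⟩
    simp only [mem_iUnion, Finset.mem_range, not_exists]
    rintro i hi ⟨h, hh, he⟩
    refine Nat.find_min hex hi ⟨Γ.mul k h, ?_, ?_⟩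
    · rw [Γ.tgt_mul _ _ he.symm, hk]
    · rw [Γ.src_mul _ _ he.symm]; exact K.subset_interior_succ i hh
  · obtain ⟨m, hm⟩ := K.exists_superset_of_isCompact hC
    refine ⟨K (m + 1), K.isCompact _, fun k hk hkt => ?_⟩
    obtain ⟨j, hj, hjS⟩ := mem_iUnion.1 hk
    simp only [mem_iUnion, Finset.mem_range, not_exists] at hjS
    -- If j > m, the arrow k⁻¹ from t(k) ∈ K m would place s(k) in the saturation `S m`, which was
    -- removed.
    have hjm : j ≤ m := by
      by_contra hlt
      refine hjS m (not_le.1 hlt) ⟨Γ.inv k, ?_, Γ.tgt_inv k⟩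
      rw [mem_preimage, Γ.src_inv]; exact hm hkt
    exact K.subset (Nat.succ_le_succ hjm) (interior_subset hj)

/-- The hypothesis controls only the points where c ∘ s is non-zero. Enlarging `K` to a compact
neighbourhood `K'` lets the bound pass to the closed support, which over `K` lies in the compact
anchor preimage of L × K'. -/
theorem IsProper.properlySupported (hΓ : Γ.IsProper) {c : M → ℝ}
    (h : ∀ K, IsCompact K → ∃ L, IsCompact L ∧ ∀ k, c (Γ.src k) ≠ 0 → Γ.tgt k ∈ K → Γ.src k ∈ L) :
    Γ.ProperlySupported c := by
  have : T2Space M := hΓ.2.1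
  have : LocallyCompactSpace M := ChartedSpace.locallyCompactSpace (Eu d) M
  intro K hK
  obtain ⟨K', hK', hKK'⟩ := exists_compact_superset hK
  obtain ⟨L, hL, hLs⟩ := h K' hK'
  have hZ := hΓ.2.2.isCompact_preimage (hL.prod hK')
  refine hZ.of_isClosed_subset ((isClosed_tsupport _).inter
    (hK.isClosed.preimage Γ.continuous_tgt)) ?_
  rintro k ⟨hk1, hk2⟩
  have hZc : IsClosed ((fun g => (Γ.src g, Γ.tgt g)) ⁻¹' (L ×ˢ K')) :=
    (hL.prod hK').isClosed.preimage hΓ.2.2.continuous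
  rw [← hZc.closure_eq, mem_closure_iff_nhds]
  intro t ht
  obtain ⟨k', ⟨hk't, hk'K⟩, hk'⟩ := mem_closure_iff_nhds.1 hk1 _ (inter_mem ht
    ((isOpen_interior.preimage Γ.continuous_tgt).mem_nhds (hKK' hk2)))
  exact ⟨k', hk't, hLs k' hk' (interior_subset hk'K), interior_subset hk'K⟩

/-- In fiber coordinates an open set through `k` has positive Lebesgue measure, and the density is
positive there. -/
theorem IsFiberMeasure.measure_pos_of_isOpen [T2Space M]
    {τ : ∀ g : MixedManifold A, (Fin (g.dim - d) → Eu g.dim) → ℝ}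
    {μ : M → Measure (MixedManifold A)} (h : Γ.IsFiberMeasure τ μ) {U : Set (MixedManifold A)}
    (hU : IsOpen U) {k : MixedManifold A} (hk : k ∈ U) : 0 < μ (Γ.tgt k) U := by
  obtain ⟨ψ, hψ, hmem⟩ := Γ.exists_targetTrivialization k.pt
  refine lt_of_lt_of_le ?_ (measure_mono (inter_subset_left : U ∩ incl k.dim '' ψ.target ⊆ U))
  have hB : MeasurableSet (U ∩ incl k.dim '' ψ.target) :=
    hU.measurableSet.inter (measurableSet_image_target ψ)
  rw [h.formula _ ψ hψ _ _ hB inter_subset_right]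
  change 0 < ∫⁻ u in fiberSet ψ (Γ.tgt k) _, _
  have hopen : IsOpen (fiberSet ψ (Γ.tgt k) (U ∩ incl k.dim '' ψ.target)) := by
    have h1 : IsOpen (ψ.source ∩ ψ ⁻¹' (incl k.dim ⁻¹' U)) :=
      ψ.continuousOn.isOpen_inter_preimage ψ.open_source (hU.preimage (continuous_incl _))
    have h2 := h1.preimage (by fun_prop : Continuous fun u : Eu (k.dim - d) => (u, Γ.tgt k))
    convert h2 using 1
    ext u
    exact ⟨fun hu => ⟨hu.1, hu.2.1⟩, fun hu => ⟨hu.1, hu.2, _, ψ.map_source hu.1, rfl⟩⟩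
  have hq : ψ.symm k.pt = ((ψ.symm k.pt).1, Γ.tgt k) := Prod.ext rfl (hψ.symm_snd hmem)
  have hne : (ψ.symm k.pt).1 ∈ fiberSet ψ (Γ.tgt k) (U ∩ incl k.dim '' ψ.target) := by
    refine ⟨?_, ?_⟩
    · rw [← hq]; exact ψ.map_target hmem
    · rw [← hq, ψ.right_inv hmem]
      exact ⟨hk, _, hmem, rfl⟩
  have hcont : ContinuousOn (fun u => ENNReal.ofReal (coordDensity τ k.dim ψ (u, Γ.tgt k)))
      (fiberSet ψ (Γ.tgt k) (U ∩ incl k.dim '' ψ.target)) :=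
    ENNReal.continuous_ofReal.comp_continuousOn
      ((h.isVolumeDensity.continuousOn_coordDensity hψ).comp (by fun_prop) fun u hu => hu.1)
  rw [pos_iff_ne_zero, Ne, setLIntegral_eq_zero_iff' hopen.measurableSet
    (hcont.aemeasurable hopen.measurableSet)]
  intro h0
  refine (hopen.measure_pos volume ⟨_, hne⟩).ne' (measure_mono_null ?_ (ae_iff.1 h0))
  intro u hu hu'
  exact (ENNReal.ofReal_pos.2 (h.isVolumeDensity.coordDensity_pos hψ hu.1)).ne' (hu' hu)

/-- The integrals of `c ∘ s` along the target fibers. -/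
def fiberIntegral (Γ : DiffGroupoid d M A) (μ : M → Measure (MixedManifold A)) (c : M → ℝ)
    (x : M) : ℝ := ∫ k, c (Γ.src k) ∂(μ x)

variable {μ : M → Measure (MixedManifold A)} {c : M → ℝ}

/-- Left invariance makes the fiber integral constant on orbits, so dividing by it at s(k) or at
t(k) is the same. -/
theorem IsLeftHaarSystem.fiberIntegral_tgt [T2Space M] (h : Γ.IsLeftHaarSystem μ)
    (hc : Continuous c) (g : MixedManifold A) :
    Γ.fiberIntegral μ c (Γ.tgt g) = Γ.fiberIntegral μ c (Γ.src g) := by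
  have hm : Measurable fun k => c (Γ.src k) := (hc.comp Γ.continuous_src).measurable
  rw [fiberIntegral, fiberIntegral, ← h.map_mul g, integral_map (h.aemeasurable_mul g)
    hm.aestronglyMeasurable]
  refine integral_congr_ae ?_
  filter_upwards [h.ae_tgt (Γ.src g)] with k hk
  simp only [Γ.src_mul _ _ hk.symm]

theorem IsFiberMeasure.contMDiff_fiberIntegral [T2Space M] [T2Space (MixedManifold A)]
    {τ : ∀ g : MixedManifold A, (Fin (g.dim - d) → Eu g.dim) → ℝ}
    (h : Γ.IsFiberMeasure τ μ) (hc : ContMDiff (𝓡 d) 𝓘(ℝ, ℝ) ∞ c) (hcs : Γ.ProperlySupported c) :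
    (∀ x, Integrable (fun k => c (Γ.src k)) (μ x)) ∧
      ContMDiff (𝓡 d) 𝓘(ℝ, ℝ) ∞ (Γ.fiberIntegral μ c) := by
  have key := fun x₀ : M => h.integral_of_properlySupported (p := ⊤) (E := ℝ)
    (isOpen_extChartAt_target (I := 𝓡 d) x₀) (contMDiffOn_extChartAt_symm x₀)
    (f := fun _ _ => (1 : ℝ)) (fun n ψ _ => contDiffOn_const) hc hcs
  have e1 : ∀ r : ℝ, r • (1 : ℝ) = r := fun r => _root_.mul_one r
  simp only [e1] at key
  have hinv : ∀ x₀ x : M, x ∈ (extChartAt (𝓡 d) x₀).source →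
      (extChartAt (𝓡 d) x₀).symm (extChartAt (𝓡 d) x₀ x) = x := fun x₀ x hx =>
    (extChartAt (𝓡 d) x₀).left_inv hx
  refine ⟨fun x => ?_, fun x => ?_⟩
  · have := (key x).1 _ (mem_extChartAt_target x)
    rwa [hinv x x (mem_extChartAt_source x)] at this
  · have h1 := ((key x).2.contDiffAt ((isOpen_extChartAt_target x).mem_nhds
      (mem_extChartAt_target x))).contMDiffAt
    refine (h1.comp x contMDiffAt_extChartAt).congr_of_eventuallyEq ?_
    filter_upwards [extChartAt_source_mem_nhds (I := 𝓡 d) x] with x' hx'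
    simp only [Function.comp, hinv x x' hx']
    rfl

/-- Take c smooth, non-negative and non-zero exactly on an open set meeting every orbit. Its fiber
integrals are positive, smooth and orbit-invariant, so c divided by them is normalized. -/
theorem IsProper.nonempty_normalizedHaarSystem [SecondCountableTopology M]
    [∀ n, SecondCountableTopology (A n)] (hΓ : Γ.IsProper) : Nonempty Γ.NormalizedHaarSystem := by
  have : T2Space M := hΓ.2.1
  have : T2Space (MixedManifold A) := hΓ.1
  have : LocallyCompactSpace M := ChartedSpace.locallyCompactSpace (Eu d) M
  obtain ⟨τ₀, hτ₀, hτi⟩ := Γ.exists_leftInvariantDensity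
  obtain ⟨μ, hμ⟩ := Γ.exists_isLeftHaarSystem hτ₀ hτi
  obtain ⟨τ, hτ⟩ := hμ.exists_isFiberMeasure
  obtain ⟨O, hO, hOx, hOK⟩ := hΓ.exists_isOpen_meeting
  obtain ⟨c, hcO, hc, hc0⟩ := hO.exists_contMDiff_support_eq (n := ⊤) (𝓡 d)
  have hcO' : ∀ x, c x ≠ 0 ↔ x ∈ O := fun x => by rw [← hcO]; rfl
  have hcs : Γ.ProperlySupported c := hΓ.properlySupported fun K hK => by
    simpa only [hcO'] using hOK K hK
  obtain ⟨hint, hsm⟩ := hτ.contMDiff_fiberIntegral hc hcs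
  have hpos : ∀ x, 0 < Γ.fiberIntegral μ c x := by
    intro x
    obtain ⟨k, rfl, hk⟩ := hOx x
    rw [fiberIntegral, integral_pos_iff_support_of_nonneg (fun k => hc0 _) (hint _)]
    have : Function.support (fun k => c (Γ.src k)) = Γ.src ⁻¹' O := by
      ext k; exact hcO' _
    rw [this]
    exact hτ.measure_pos_of_isOpen (hO.preimage Γ.continuous_src) hk
  have hκs : Γ.ProperlySupported fun x => c x / Γ.fiberIntegral μ c x := by
    refine hΓ.properlySupported fun K hK => ?_
    obtain ⟨L, hL, h⟩ := hOK K hK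
    refine ⟨L, hL, fun k hk => h k ((hcO' _).1 fun hz => hk ?_)⟩
    rw [hz, zero_div]
  have hκ1 : ∀ x, ∫ k, c (Γ.src k) / Γ.fiberIntegral μ c (Γ.src k) ∂(μ x) = 1 := by
    intro x
    have h1 : ∀ᵐ k ∂(μ x), c (Γ.src k) / Γ.fiberIntegral μ c (Γ.src k) =
        c (Γ.src k) / Γ.fiberIntegral μ c x := by
      filter_upwards [hμ.ae_tgt x] with k hk
      rw [← hμ.fiberIntegral_tgt hc.continuous k, hk]
    rw [integral_congr_ae h1, integral_div]
    exact div_self (hpos x).ne'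
  exact ⟨{
    μ := μ
    isLeftHaarSystem := hμ
    κ := fun x => c x / Γ.fiberIntegral μ c x
    smooth := hc.div₀ hsm fun x => (hpos x).ne'
    nonneg := fun x => div_nonneg (hc0 x) (hpos x).le
    properly_supported := hκs
    integral_eq_one := hκ1 }⟩

end DiffGroupoid

end

/-! ### The proposition -/

theorem mainTheorem3 {d : ℕ} {M : Type*} [TopologicalSpace M] [ChartedSpace (Eu d) M]
    [IsManifold (𝓡 d) ∞ M] [T2Space M] [SecondCountableTopology M]
    {A : ℕ → Type*} [∀ n, TopologicalSpace (A n)] [∀ n, ChartedSpace (Eu n) (A n)]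
    [∀ n, IsManifold (𝓡 n) ∞ (A n)] [∀ n, SecondCountableTopology (A n)]
    (Γ : DiffGroupoid d M A) (hΓ : Γ.IsProper) (p : ℕ∞) :
    (∀ Φ : Γ.Connection p, Φ.IsEffective →
      Φ.IsNondegenerate ∧
      ∀ H : Γ.NormalizedHaarSystem,
        (∀ g, Integrable (fun k => Φ.diffCocycle (Γ.mul g k) k g) (H.ν (Γ.src g))) ∧
        ∃ Ψ : Γ.Connection p, (∀ g, Ψ.lift g = Φ.average H g) ∧ Ψ.IsMultiplicative) ∧
    ((∃ Φ : Γ.Connection p, Φ.IsEffective) ↔ ∃ Ψ : Γ.Connection p, Ψ.IsMultiplicative) := by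
  have : T2Space (MixedManifold A) := hΓ.1
  refine ⟨fun Φ hΦ => ⟨hΦ.isNondegenerate, fun H =>
    ⟨DiffGroupoid.Connection.integrable_diffCocycle hΦ.isNondegenerate H,
      DiffGroupoid.Connection.averageConnection hΦ.isNondegenerate H, fun _ => rfl,
      hΦ.isMultiplicative_averageConnection H⟩⟩, ?_, ?_⟩
  · rintro ⟨Φ, hΦ⟩
    obtain ⟨H⟩ := hΓ.nonempty_normalizedHaarSystem
    exact ⟨_, hΦ.isMultiplicative_averageConnection H⟩
  · rintro ⟨Ψ, hΨ⟩
    exact ⟨Ψ, hΨ.isEffective⟩
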